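/- All graphs are finite and simple. A set $S$ of vertices of a graph $G$ is a disjunctive dominating set of $G$ if every vertex not in $S$ is adjacent to a vertex of $S$ or has at least two vertices of $S$ at distance $2$ from it in $G$; the disjunctive domination number $\gamma^{d}_2(G)$ is the minimum cardinality of a disjunctive dominating set of $G$. Let $\mathscr{A}=\{C_4,C_5,G_1,G_2,G_3,G_4,G_5,G_6\}$, where $C_n$ is the cycle on $n$ vertices and - $G_1$ is the house, i.e. a $5$-cycle with one chord; - $G_2$ is a $5$-cycle with two chords that have no common endpoint; - $G_3$ is the complete bipartite graph $K_{2,3}$; - $G_4$ consists of two vertex-disjoint $4$-cycles and one edge joining a vertex of one to a vertex of the other; - $G_5$ consists of a $4$-cycle and a $5$-cycle that share exactly one vertex; - $G_6$ is obtained from $G_5$ by adding the edge between the two neighbours, on the $5$-cycle, of the shared vertex. **Theorem 2.6.** Let $G$ be a graph of order $|G|\ge 3$ with minimum degree $\delta(G)\ge 2$ such that no connected component of $G$ is isomorphic to a graph in $\mathscr{A}$. Then $$\gamma^{d}_2(G)\le \frac{|G|}{3}.$$ -/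

import Mathlib

namespace SimpleGraph

/-- `S` is a disjunctive dominating set of `G`: every vertex outside `S` is adjacent to a vertex
of `S` or has at least two vertices of `S` at distance `2` from it in `G`.
(`G.dist` is `0` between different components, so it is `2` only for genuine distance `2`.) -/
def IsDisjunctiveDominating {V : Type*} (G : SimpleGraph V) (S : Finset V) : Prop :=
  ∀ v : V, v ∉ S →
    (∃ u ∈ S, G.Adj v u) ∨
      (∃ u ∈ S, ∃ w ∈ S, u ≠ w ∧ G.dist v u = 2 ∧ G.dist v w = 2)

/-- The whole vertex set is a disjunctive dominating set, so the minimum below is attained. -/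
theorem isDisjunctiveDominating_univ {V : Type*} [Fintype V] (G : SimpleGraph V) :
    G.IsDisjunctiveDominating Finset.univ :=
  fun v hv => absurd (Finset.mem_univ v) hv

/-- The disjunctive domination number of a finite graph: the minimum cardinality of a
disjunctive dominating set. -/
noncomputable def disjunctiveDominationNumber {V : Type*} [Fintype V] (G : SimpleGraph V) : ℕ :=
  sInf {k : ℕ | ∃ S : Finset V, G.IsDisjunctiveDominating S ∧ S.card = k}

theorem exists_isDisjunctiveDominating_card_eq {V : Type*} [Fintype V] (G : SimpleGraph V) :
    ∃ S : Finset V, G.IsDisjunctiveDominating S ∧ S.card = G.disjunctiveDominationNumber :=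
  Nat.sInf_mem (s := {k : ℕ | ∃ S : Finset V, G.IsDisjunctiveDominating S ∧ S.card = k})
    ⟨_, Finset.univ, G.isDisjunctiveDominating_univ, rfl⟩

/-- `G₁`, the house: the 5-cycle `0 1 2 3 4` with the chord `1 4`. -/
def exceptionalG1 : SimpleGraph (Fin 5) :=
  fromEdgeSet {s(0, 1), s(1, 2), s(2, 3), s(3, 4), s(4, 0), s(1, 4)}

/-- `G₂`: the 5-cycle `0 1 2 3 4` with the two disjoint chords `1 4` and `0 2`. -/
def exceptionalG2 : SimpleGraph (Fin 5) :=
  fromEdgeSet {s(0, 1), s(1, 2), s(2, 3), s(3, 4), s(4, 0), s(1, 4), s(0, 2)}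

/-- `G₃`: the complete bipartite graph `K_{2,3}`. -/
def exceptionalG3 : SimpleGraph (Fin 2 ⊕ Fin 3) :=
  completeBipartiteGraph (Fin 2) (Fin 3)

/-- `G₄`: the disjoint 4-cycles `0 1 2 3` and `4 5 6 7` joined by the edge `0 4`. -/
def exceptionalG4 : SimpleGraph (Fin 8) :=
  fromEdgeSet {s(0, 1), s(1, 2), s(2, 3), s(3, 0),
    s(4, 5), s(5, 6), s(6, 7), s(7, 4), s(0, 4)}

/-- `G₅`: the 4-cycle `0 1 2 3` and the 5-cycle `0 4 5 6 7`, sharing exactly the vertex `0`. -/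
def exceptionalG5 : SimpleGraph (Fin 8) :=
  fromEdgeSet {s(0, 1), s(1, 2), s(2, 3), s(3, 0),
    s(0, 4), s(4, 5), s(5, 6), s(6, 7), s(7, 0)}

/-- `G₆`: the graph `G₅` together with the edge `4 7`, which joins the two neighbours of the
shared vertex `0` on the 5-cycle. -/
def exceptionalG6 : SimpleGraph (Fin 8) :=
  fromEdgeSet {s(0, 1), s(1, 2), s(2, 3), s(3, 0),
    s(0, 4), s(4, 5), s(5, 6), s(6, 7), s(7, 0), s(4, 7)}

/-- `H` is isomorphic to a member of the family `{C₄, C₅, G₁, G₂, G₃, G₄, G₅, G₆}`. -/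
def IsExceptional {W : Type*} (H : SimpleGraph W) : Prop :=
  Nonempty (H ≃g cycleGraph 4) ∨ Nonempty (H ≃g cycleGraph 5) ∨
  Nonempty (H ≃g exceptionalG1) ∨ Nonempty (H ≃g exceptionalG2) ∨
  Nonempty (H ≃g exceptionalG3) ∨ Nonempty (H ≃g exceptionalG4) ∨
  Nonempty (H ≃g exceptionalG5) ∨ Nonempty (H ≃g exceptionalG6)

end SimpleGraph

set_option linter.unusedSectionVars false

/-! The induction runs on a stronger statement: the vertices of a set `S₀` are already paid for, and
the vertices of `U` are to be dominated by at most |U|/3 further ones (`Solve`). Two neighbours in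
`U` are demanded only of vertices without a neighbour in `S₀`, and closed exceptional pieces are
assumed solvable (`Good`). Distance two is relaxed to a walk of length two, so that domination
survives the addition of edges. Hence only the minimal exceptional graphs matter: C₄, C₅, K₂,₃, two
linked four-cycles, and C₄ and C₅ glued at a vertex. All but C₄ have order 2 modulo 3, and with one
adjacent outside vertex at hand such a set `A` needs only (|A| - 2)/3 vertices of its own.

Let a counterexample minimise |U| plus the number of edges (`Critical`). Deleting a set `R` that is
dominated by at most |R|/3 of its members must break a hypothesis (`Critical.remove`). It follows
that all degrees are at least two (`two_le_card_nb`), that an edge between two vertices of degree at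
least three is the exit of a pendant four-cycle (`exists_pendant`), and that three consecutive
vertices of degree two cannot be replaced by an edge between two distinct nonadjacent ends
(`not_path`).

The rest is discharging. The core vertices, of degree at least three and in no pendant four-cycle,
go into the dominating set. An item at a core vertex is a pendant four-cycle, or the rest of a
five-cycle whose other vertices have degree two; it has order 3t + 1 and is dominated by t of its
vertices and the core vertex. A core vertex has at most one item, and at most one degree-two
neighbour leading on to a large vertex, and not both (`not_item_item`, `not_item_mid`,
`not_mid_mid`). So each core vertex, with its item, owns three times as many vertices as it
contributes (`exists_block`), these blocks are disjoint (`eq_of_charged`), and the chosen vertices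
dominate `U` (`dominated_of_core`). This contradicts the choice of the counterexample. Finally, a
finite check shows that a component which is spanned by a minimal exceptional graph and cannot be
solved belongs to the family (`isExceptional_of_spans`). -/

namespace SimpleGraph

/-! ### Domination relative to a set of sources. -/

section Domination

variable {V : Type*} [DecidableEq V] {G H : SimpleGraph V}

/-- There is a walk of length two from `v` to `u`. -/
def Near2 (G : SimpleGraph V) (v u : V) : Prop := ∃ a, G.Adj v a ∧ G.Adj a u

/-- `v` lies in `S`, has a neighbour in `S`, or has two members of `S` within two steps. -/
def Dominated (G : SimpleGraph V) (S : Finset V) (v : V) : Prop :=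
  v ∈ S ∨ (∃ u ∈ S, G.Adj v u) ∨ ∃ u ∈ S, ∃ w ∈ S, u ≠ w ∧ G.Near2 v u ∧ G.Near2 v w

theorem Near2.mono {v u : V} (h : G.Near2 v u) (hGH : G ≤ H) : H.Near2 v u := by
  obtain ⟨a, h1, h2⟩ := h
  exact ⟨a, hGH h1, hGH h2⟩

theorem Dominated.mono {S T : Finset V} {v : V} (h : G.Dominated S v) (hST : S ⊆ T) :
    G.Dominated T v := by
  rcases h with h | ⟨u, hu, h⟩ | ⟨u, hu, w, hw, hne, h1, h2⟩
  · exact Or.inl (hST h)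
  · exact Or.inr (Or.inl ⟨u, hST hu, h⟩)
  · exact Or.inr (Or.inr ⟨u, hST hu, w, hST hw, hne, h1, h2⟩)

theorem Dominated.mono_graph {S : Finset V} {v : V} (h : G.Dominated S v) (hGH : G ≤ H) :
    H.Dominated S v := by
  rcases h with h | ⟨u, hu, h⟩ | ⟨u, hu, w, hw, hne, h1, h2⟩
  · exact Or.inl h
  · exact Or.inr (Or.inl ⟨u, hu, hGH h⟩)
  · exact Or.inr (Or.inr ⟨u, hu, w, hw, hne, h1.mono hGH, h2.mono hGH⟩)

theorem Dominated.of_mem {S : Finset V} {v : V} (h : v ∈ S) : G.Dominated S v := Or.inl h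

theorem Dominated.of_adj {S : Finset V} {u v : V} (hu : u ∈ S) (h : G.Adj v u) :
    G.Dominated S v := Or.inr (Or.inl ⟨u, hu, h⟩)

theorem Dominated.of_near {S : Finset V} {u v w : V} (hu : u ∈ S) (hw : w ∈ S) (hne : u ≠ w)
    (h1 : G.Near2 v u) (h2 : G.Near2 v w) : G.Dominated S v :=
  Or.inr (Or.inr ⟨u, hu, w, hw, hne, h1, h2⟩)

/-- The vertices of `U` can be dominated by at most `|U| / 3` vertices in addition to `S₀`. -/
def Solve (G : SimpleGraph V) (S₀ U : Finset V) : Prop :=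
  ∃ S : Finset V, 3 * S.card ≤ U.card ∧ ∀ v ∈ U, G.Dominated (S₀ ∪ S) v

theorem Solve.mono_graph {S₀ U : Finset V} (h : G.Solve S₀ U) (hGH : G ≤ H) : H.Solve S₀ U := by
  obtain ⟨S, h1, h2⟩ := h
  exact ⟨S, h1, fun v hv => (h2 v hv).mono_graph hGH⟩

theorem Solve.union {S₀ A B : Finset V} (hA : G.Solve S₀ A) (hB : G.Solve S₀ B)
    (hAB : Disjoint A B) : G.Solve S₀ (A ∪ B) := by
  obtain ⟨S, h1, h2⟩ := hA
  obtain ⟨T, h3, h4⟩ := hB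
  refine ⟨S ∪ T, ?_, fun v hv => ?_⟩
  · have := Finset.card_union_le S T
    rw [Finset.card_union_of_disjoint hAB]
    omega
  · rcases Finset.mem_union.1 hv with hv | hv
    · exact (h2 v hv).mono (Finset.union_subset_union_right Finset.subset_union_left)
    · exact (h4 v hv).mono (Finset.union_subset_union_right Finset.subset_union_right)

/-- `S₁` joins the sources, so what remains of `U` still profits from deleted vertices. For this
reason `U` shrinks while `G` is left alone. -/
theorem Solve.of_remove {S₀ S₁ R U : Finset V} (hR : R ⊆ U) (hc : 3 * S₁.card ≤ R.card)
    (hd : ∀ v ∈ R, G.Dominated (S₀ ∪ S₁) v) (h : G.Solve (S₀ ∪ S₁) (U \ R)) : G.Solve S₀ U := by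
  obtain ⟨S, h1, h2⟩ := h
  refine ⟨S₁ ∪ S, ?_, fun v hv => ?_⟩
  · have := Finset.card_union_le S₁ S
    have := Finset.card_sdiff_add_card_eq_card hR
    omega
  · rw [← Finset.union_assoc]
    by_cases hv' : v ∈ R
    · exact (hd v hv').mono Finset.subset_union_left
    · exact h2 v (Finset.mem_sdiff.2 ⟨hv, hv'⟩)

end Domination

/-! ### Small labelled graphs, given by edge lists, and their copies in `G`. -/

section Pattern

variable {V : Type*} [DecidableEq V] {G H : SimpleGraph V}

/-- Adjacency in the graph on `ℕ` with edge list `L`. -/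
def listAdj (L : List (ℕ × ℕ)) (i j : ℕ) : Bool := L.contains (i, j) || L.contains (j, i)

def listNear (L : List (ℕ × ℕ)) (i j : ℕ) : Bool :=
  L.any fun e => (e.1 == i && listAdj L e.2 j) || (e.2 == i && listAdj L e.1 j)

/-- The Boolean shadow of `Dominated`, evaluated by kernel computation in the finite checks. -/
def listDominated (L : List (ℕ × ℕ)) (S : List ℕ) (i : ℕ) : Bool :=
  S.contains i || S.any (listAdj L i) ||
    S.any fun u => listNear L i u && S.any fun w => u != w && listNear L i w

/-- `φ` maps the edges in the list `L` to edges of `G`. -/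
def ListHom (G : SimpleGraph V) (L : List (ℕ × ℕ)) (φ : ℕ → V) : Prop :=
  ∀ e ∈ L, G.Adj (φ e.1) (φ e.2)

theorem ListHom.adj {L : List (ℕ × ℕ)} {φ : ℕ → V} (h : G.ListHom L φ) {i j : ℕ}
    (hij : listAdj L i j = true) : G.Adj (φ i) (φ j) := by
  simp only [listAdj, Bool.or_eq_true, List.contains_iff_mem] at hij
  rcases hij with hij | hij
  · exact h _ hij
  · exact (h _ hij).symm

theorem ListHom.near {L : List (ℕ × ℕ)} {φ : ℕ → V} (h : G.ListHom L φ) {i j : ℕ}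
    (hij : listNear L i j = true) : G.Near2 (φ i) (φ j) := by
  simp only [listNear, List.any_eq_true, Bool.or_eq_true, Bool.and_eq_true, beq_iff_eq] at hij
  obtain ⟨e, he, ⟨rfl, h2⟩ | ⟨rfl, h2⟩⟩ := hij
  · exact ⟨_, h e he, h.adj h2⟩
  · exact ⟨_, (h e he).symm, h.adj h2⟩

/-- Edges and two-step walks survive a homomorphism; only the distinctness of two dominators at two
steps needs injectivity, and that on `S` alone. A finite check thus applies to every copy, whatever
further edges `G` has. -/
theorem ListHom.dominated {L : List (ℕ × ℕ)} {φ : ℕ → V} (h : G.ListHom L φ) {S : List ℕ}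
    {T : Finset V} (hT : ∀ i ∈ S, φ i ∈ T) (hinj : ∀ i ∈ S, ∀ j ∈ S, φ i = φ j → i = j) {i : ℕ}
    (hi : listDominated L S i = true) : G.Dominated T (φ i) := by
  simp only [listDominated, List.any_eq_true, Bool.or_eq_true, Bool.and_eq_true,
    List.contains_iff_mem, bne_iff_ne] at hi
  rcases hi with (hi | ⟨u, hu, hi⟩) | ⟨u, hu, h1, w, hw, hne, h2⟩
  · exact .of_mem (hT _ hi)
  · exact .of_adj (hT _ hu) (h.adj hi)
  · exact .of_near (hT _ hu) (hT _ hw) (fun e => hne (hinj _ hu _ hw e)) (h.near h1) (h.near h2)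

/-- The graph on `{0, …, n - 1}` with edge list `L`, for `b = (n, L)`, is isomorphic to a spanning
subgraph of the subgraph of `G` induced by `A`. -/
def Spans (G : SimpleGraph V) (b : ℕ × List (ℕ × ℕ)) (A : Finset V) : Prop :=
  ∃ φ : ℕ → V, (∀ i < b.1, ∀ j < b.1, φ i = φ j → i = j) ∧ A = (Finset.range b.1).image φ ∧
    G.ListHom b.2 φ

theorem Spans.mono {b : ℕ × List (ℕ × ℕ)} {A : Finset V} (h : G.Spans b A) (hGH : G ≤ H) :
    H.Spans b A := by
  obtain ⟨φ, h1, h2, h3⟩ := h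
  exact ⟨φ, h1, h2, fun e he => hGH (h3 e he)⟩

theorem Spans.card {b : ℕ × List (ℕ × ℕ)} {A : Finset V} (h : G.Spans b A) : A.card = b.1 := by
  obtain ⟨φ, h1, rfl, -⟩ := h
  rw [Finset.card_image_of_injOn, Finset.card_range]
  intro i hi j hj
  simp only [Finset.coe_range, Set.mem_Iio] at hi hj
  exact h1 i hi j hj

def fourCycle : ℕ × List (ℕ × ℕ) := (4, [(0, 1), (1, 2), (2, 3), (3, 0)])

def fiveCycle : ℕ × List (ℕ × ℕ) := (5, [(0, 1), (1, 2), (2, 3), (3, 4), (4, 0)])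

def bipartite23 : ℕ × List (ℕ × ℕ) := (5, [(0, 2), (0, 3), (0, 4), (1, 2), (1, 3), (1, 4)])

def linkedFourCycles : ℕ × List (ℕ × ℕ) :=
  (8, [(0, 1), (1, 2), (2, 3), (3, 0), (4, 5), (5, 6), (6, 7), (7, 4), (0, 4)])

def gluedCycles : ℕ × List (ℕ × ℕ) :=
  (8, [(0, 1), (1, 2), (2, 3), (3, 0), (0, 4), (4, 5), (5, 6), (6, 7), (7, 0)])

/-- The minimal exceptional graphs whose order is `2` modulo `3`. -/
def residueTwo : List (ℕ × List (ℕ × ℕ)) :=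
  [fiveCycle, bipartite23, linkedFourCycles, gluedCycles]

/-- `A` is spanned by a minimal exceptional graph of order `2` modulo `3`. -/
def SpansTwo (G : SimpleGraph V) (A : Finset V) : Prop := ∃ b ∈ residueTwo, G.Spans b A

/-- `A` is spanned by a minimal exceptional graph. -/
def SpansEx (G : SimpleGraph V) (A : Finset V) : Prop := G.Spans fourCycle A ∨ G.SpansTwo A

theorem SpansTwo.mono {A : Finset V} (h : G.SpansTwo A) (hGH : G ≤ H) : H.SpansTwo A := by
  obtain ⟨b, hb, h⟩ := h
  exact ⟨b, hb, h.mono hGH⟩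

theorem SpansEx.mono {A : Finset V} (h : G.SpansEx A) (hGH : G ≤ H) : H.SpansEx A :=
  h.imp (·.mono hGH) (·.mono hGH)

theorem Spans.nonempty {b : ℕ × List (ℕ × ℕ)} {A : Finset V} (h : G.Spans b A) (hb : 0 < b.1) :
    A.Nonempty := by
  rw [← Finset.card_pos, h.card]
  exact hb

theorem SpansEx.nonempty {A : Finset V} (h : G.SpansEx A) : A.Nonempty := by
  rcases h with h | ⟨b, hb, h⟩
  · exact h.nonempty (by decide)
  · exact h.nonempty ((by decide : ∀ b ∈ residueTwo, 0 < b.1) b hb)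

/-- A candidate list of index sets of cardinality at most `n / 3`, for `n ∈ {4, 5, 8}`. -/
def smallSets (n : ℕ) : List (List ℕ) :=
  if n = 8 then (List.range n).flatMap fun i => (List.range n).map fun j => [i, j]
  else (List.range n).map fun i => [i]

/-- Extension of a map on `{0, …, n - 1}` by a list of further values. -/
def extend (n : ℕ) (φ : ℕ → V) (l : ℕ → V) (i : ℕ) : V := if i < n then φ i else l (i - n)

theorem extend_lt {n : ℕ} {φ l : ℕ → V} {i : ℕ} (h : i < n) : extend n φ l i = φ i := if_pos h

theorem extend_add {n : ℕ} {φ l : ℕ → V} (i : ℕ) : extend n φ l (n + i) = l i := by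
  simp [extend]

end Pattern

end SimpleGraph

namespace SimpleGraph

/-! ### Dominating exceptional graphs with outside help, and enlarging them by three vertices. -/

section Exceptional

variable {V : Type*} [DecidableEq V] {G H : SimpleGraph V}

theorem extend_injective {n m : ℕ} {φ l : ℕ → V} (hφ : ∀ i < n, ∀ j < n, φ i = φ j → i = j)
    (hl : ∀ i < m, ∀ j < m, l i = l j → i = j) (hd : ∀ i < m, l i ∉ (Finset.range n).image φ) :
    ∀ i < n + m, ∀ j < n + m, extend n φ l i = extend n φ l j → i = j := by
  intro i hi j hj hij
  unfold extend at hij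
  split_ifs at hij with h1 h2 h2
  · exact hφ i h1 j h2 hij
  · exact absurd (hij ▸ Finset.mem_image_of_mem φ (Finset.mem_range.2 h1)) (hd _ (by omega))
  · exact absurd (hij ▸ Finset.mem_image_of_mem φ (Finset.mem_range.2 h2)) (hd _ (by omega))
  · have := hl _ (by omega) _ (by omega) hij
    omega

theorem ListHom.extend {n : ℕ} {L : List (ℕ × ℕ)} {φ : ℕ → V} (h : G.ListHom L φ)
    (hL : ∀ e ∈ L, e.1 < n ∧ e.2 < n) (l : ℕ → V) : G.ListHom L (extend n φ l) := by
  intro e he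
  rw [extend_lt (hL e he).1, extend_lt (hL e he).2]
  exact h e he

theorem ListHom.cons {L : List (ℕ × ℕ)} {φ : ℕ → V} (h : G.ListHom L φ) {i j : ℕ}
    (hij : G.Adj (φ i) (φ j)) : G.ListHom ((i, j) :: L) φ := by
  intro e he
  rcases List.mem_cons.1 he with rfl | he
  exacts [hij, h e he]

/-- Label 4 is a source and 5 the midpoint of a walk from `i` to it. The vertex opposite `i` serves
as `o`: it handles itself and its neighbours, and shares `i` with the source. -/
theorem fourCycle_check : ∀ i < 4, ∃ o < 4, ∀ j < 4,
    listDominated ((i, 4) :: fourCycle.2) [4, o] j = true ∧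
    listDominated ((i, 5) :: (5, 4) :: fourCycle.2) [4, o] j = true := by decide +kernel

theorem Spans.solve_fourCycle {A S₀ : Finset V} (h : G.Spans fourCycle A) {x s : V} (hx : x ∈ A)
    (hs : s ∈ S₀) (hsA : s ∉ A) (hxs : G.Adj x s ∨ G.Near2 x s) : G.Solve S₀ A := by
  have hcard := h.card
  obtain ⟨φ, hφ, rfl, hL⟩ := h
  obtain ⟨i, hi, rfl⟩ := Finset.mem_image.1 hx
  have hi := Finset.mem_range.1 hi
  replace hφ : ∀ i < 4, ∀ j < 4, φ i = φ j → i = j := hφ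
  replace hi : i < 4 := hi
  have hsA' : ∀ x < 4, ¬ φ x = s := by
    intro x hx e
    exact hsA (e ▸ Finset.mem_image_of_mem φ (Finset.mem_range.2 hx))
  obtain ⟨o, ho, hdom⟩ := fourCycle_check i hi
  refine ⟨{φ o}, by rw [hcard, Finset.card_singleton]; decide, ?_⟩
  have key : ∀ y : V, ∀ L, G.ListHom L (SimpleGraph.extend 4 φ fun k => if k = 0 then s else y) →
      ∀ j < 4, listDominated L [4, o] j = true → G.Dominated (S₀ ∪ {φ o}) (φ j) := by
    intro y L hL j hj hd
    -- Only the five labels up to the source need be injective: the midpoint `y` is not a dominator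
    -- and may lie on the cycle.
    have hinj := extend_injective (n := 4) (m := 1) (l := fun k => if k = 0 then s else y) hφ
      (by intro i hi j hj _; omega) (by intro i hi; obtain rfl : i = 0 := by omega
                                        simpa using hsA')
    rw [← extend_lt (φ := φ) (l := fun k => if k = 0 then s else y) hj]
    refine hL.dominated ?_ ?_ hd
    · intro k hk
      simp only [List.mem_cons, List.not_mem_nil, or_false] at hk
      rcases hk with rfl | rfl
      · simp [SimpleGraph.extend, hs]
      · simp [SimpleGraph.extend, ho]
    · intro k hk l hl hkl
      have hlt : ∀ k ∈ [4, o], k < 4 + 1 := by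
        intro k hk
        simp only [List.mem_cons, List.not_mem_nil, or_false] at hk
        omega
      exact hinj k (hlt k hk) l (hlt l hl) hkl
  intro v hv
  obtain ⟨j, hj, rfl⟩ := Finset.mem_image.1 hv
  have hj := Finset.mem_range.1 hj
  rcases hxs with hxs | ⟨y, h1, h2⟩
  · refine key s _ ?_ j hj (hdom j hj).1
    refine ListHom.cons (hL.extend (n := 4) (by decide) _) ?_
    rw [extend_lt hi]
    simpa [SimpleGraph.extend] using hxs
  · refine key y _ ?_ j hj (hdom j hj).2
    refine ListHom.cons (ListHom.cons (hL.extend (n := 4) (by decide) _) ?_) ?_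
    · simpa [SimpleGraph.extend] using h2
    · rw [extend_lt hi]
      simpa [SimpleGraph.extend] using h1

theorem residueTwo_lt : ∀ b ∈ fourCycle :: residueTwo, ∀ e ∈ b.2, e.1 < b.1 ∧ e.2 < b.1 := by
  decide

theorem smallSets_card : ∀ b ∈ fourCycle :: residueTwo, ∀ S ∈ smallSets b.1,
    3 * S.length ≤ b.1 ∧ ∀ i ∈ S, i < b.1 := by
  decide +kernel

/-- Orders 5 and 8 leave two vertices of slack over 3 · 1 and 3 · 2; removing one more vertex
together with such a set pays for putting that vertex into the dominating set. -/
theorem smallSets_card_two : ∀ b ∈ residueTwo, ∀ S ∈ smallSets b.1, 3 * S.length + 2 ≤ b.1 := by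
  decide +kernel

theorem listDominated_extend {n m : ℕ} {φ l : ℕ → V} (hφ : ∀ i < n, ∀ j < n, φ i = φ j → i = j)
    (hl : ∀ i < m, ∀ j < m, l i = l j → i = j) (hd : ∀ i < m, l i ∉ (Finset.range n).image φ)
    {L : List (ℕ × ℕ)} (hL : G.ListHom L (extend n φ l)) {E S : List ℕ}
    (hS : ∀ i ∈ S, i < n) (hE : ∀ i ∈ E, i < m) {j : ℕ}
    (h : listDominated L (E.map (n + ·) ++ S) j = true) :
    G.Dominated ((E.map l).toFinset ∪ (S.map φ).toFinset) (extend n φ l j) := by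
  refine hL.dominated ?_ ?_ h
  · intro i hi
    simp only [List.mem_append, List.mem_map] at hi
    rcases hi with ⟨a, ha, rfl⟩ | hi
    · rw [extend_add]
      simp only [Finset.mem_union, List.mem_toFinset, List.mem_map]
      exact Or.inl ⟨a, ha, rfl⟩
    · rw [extend_lt (hS i hi)]
      simp only [Finset.mem_union, List.mem_toFinset, List.mem_map]
      exact Or.inr ⟨i, hi, rfl⟩
  · have hlt : ∀ i ∈ E.map (n + ·) ++ S, i < n + m := by
      intro i hi
      simp only [List.mem_append, List.mem_map] at hi
      rcases hi with ⟨a, ha, rfl⟩ | hi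
      · have := hE a ha
        omega
      · have := hS i hi
        omega
    exact fun i hi j hj hij => extend_injective hφ hl hd i (hlt i hi) j (hlt j hj) hij

theorem card_map_le (S : List ℕ) (φ : ℕ → V) : (S.map φ).toFinset.card ≤ S.length := by
  simpa using (S.map φ).toFinset_card_le

theorem map_subset {n : ℕ} {S : List ℕ} (hS : ∀ i ∈ S, i < n) (φ : ℕ → V) :
    (S.map φ).toFinset ⊆ (Finset.range n).image φ := by
  intro v hv
  simp only [List.mem_toFinset, List.mem_map] at hv
  obtain ⟨i, hi, rfl⟩ := hv
  exact Finset.mem_image_of_mem φ (Finset.mem_range.2 (hS i hi))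

/-- The label `b.1 + 0`, in the form expected by `extend_add`, is an outside source attached at `i`.
The condition on `k` serves to dominate a second outside vertex attached there. -/
theorem residueTwo_check : ∀ b ∈ residueTwo, ∀ i < b.1, ∀ k < b.1, i ≠ k →
    listAdj b.2 i k = true ∨ ∃ S ∈ smallSets b.1, (S.contains k || S.any (listAdj b.2 k)) = true ∧
      ∀ j < b.1, listDominated ((i, b.1 + 0) :: b.2) ([0].map (b.1 + ·) ++ S) j = true := by
  decide +kernel

theorem residueTwo_check' : ∀ b ∈ residueTwo, ∀ i < b.1, ∃ S ∈ smallSets b.1,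
      ∀ j < b.1, listDominated ((i, b.1 + 0) :: b.2) ([0].map (b.1 + ·) ++ S) j = true := by
  decide +kernel

theorem SpansTwo.exists_of_adj_of_mem {A : Finset V} (h : G.SpansTwo A) {x y s : V} (hx : x ∈ A)
    (hy : y ∈ A) (hs : s ∉ A) (hxs : G.Adj x s) (hxy : x ≠ y) :
    G.Adj x y ∨ ∃ S ⊆ A, 3 * S.card + 2 ≤ A.card ∧ (y ∈ S ∨ ∃ u ∈ S, G.Adj y u) ∧
      ∀ a ∈ A, G.Dominated (insert s S) a := by
  obtain ⟨b, hb, h⟩ := h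
  have hcard := h.card
  obtain ⟨φ, hφ, rfl, hL⟩ := h
  obtain ⟨i, hi, rfl⟩ := Finset.mem_image.1 hx
  obtain ⟨k, hk, rfl⟩ := Finset.mem_image.1 hy
  have hi := Finset.mem_range.1 hi
  have hk := Finset.mem_range.1 hk
  rcases residueTwo_check b hb i hi k hk (fun e => hxy (e ▸ rfl)) with h | ⟨S, hS, hkS, hdom⟩
  · exact Or.inl (hL.adj h)
  have hS' := (smallSets_card b (List.mem_cons_of_mem _ hb) S hS).2
  refine Or.inr ⟨(S.map φ).toFinset, map_subset hS' φ, ?_, ?_, ?_⟩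
  · have := card_map_le S φ
    have := smallSets_card_two b hb S hS
    omega
  · simp only [List.mem_toFinset, List.mem_map]
    simp only [Bool.or_eq_true, List.any_eq_true, List.contains_iff_mem] at hkS
    rcases hkS with h | ⟨u, hu, h⟩
    · exact Or.inl ⟨k, h, rfl⟩
    · exact Or.inr ⟨φ u, ⟨u, hu, rfl⟩, hL.adj h⟩
  · intro v hv
    obtain ⟨j, hj, rfl⟩ := Finset.mem_image.1 hv
    have hj := Finset.mem_range.1 hj
    have := listDominated_extend (G := G) (m := 1) (l := fun _ => s) hφ
      (by intro i hi j hj _; omega) (fun _ _ => hs)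
      (ListHom.cons (hL.extend (residueTwo_lt b (List.mem_cons_of_mem _ hb)) _)
        (by rw [extend_lt hi, extend_add]; exact hxs)) hS' (by simp) (hdom j hj)
    rw [extend_lt hj] at this
    simpa using this

theorem SpansTwo.exists_of_adj {A : Finset V} (h : G.SpansTwo A) {x s : V} (hx : x ∈ A)
    (hs : s ∉ A) (hxs : G.Adj x s) :
    ∃ S ⊆ A, 3 * S.card + 2 ≤ A.card ∧ ∀ a ∈ A, G.Dominated (insert s S) a := by
  obtain ⟨b, hb, h⟩ := h
  have hcard := h.card
  obtain ⟨φ, hφ, rfl, hL⟩ := h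
  obtain ⟨i, hi, rfl⟩ := Finset.mem_image.1 hx
  have hi := Finset.mem_range.1 hi
  obtain ⟨S, hS, hdom⟩ := residueTwo_check' b hb i hi
  have hS' := (smallSets_card b (List.mem_cons_of_mem _ hb) S hS).2
  refine ⟨(S.map φ).toFinset, map_subset hS' φ, ?_, ?_⟩
  · have := card_map_le S φ
    have := smallSets_card_two b hb S hS
    omega
  · intro v hv
    obtain ⟨j, hj, rfl⟩ := Finset.mem_image.1 hv
    have hj := Finset.mem_range.1 hj
    have := listDominated_extend (G := G) (m := 1) (l := fun _ => s) hφ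
      (by intro i hi j hj _; omega) (fun _ _ => hs)
      (ListHom.cons (hL.extend (residueTwo_lt b (List.mem_cons_of_mem _ hb)) _)
        (by rw [extend_lt hi, extend_add]; exact hxs)) hS' (by simp) (hdom j hj)
    rw [extend_lt hj] at this
    simpa using this

/-- With no outside source, one vertex beyond the allowance suffices, and it can be prescribed; the
cost is (|A| + 1)/3, affordable when at least one further vertex is deleted along with `A`. -/
theorem residueTwo_mem_check : ∀ b ∈ residueTwo, ∀ i < b.1, ∃ S ∈ smallSets b.1,
    ∀ j < b.1, listDominated b.2 (i :: S) j = true := by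
  decide +kernel

theorem SpansTwo.exists_mem {A : Finset V} (h : G.SpansTwo A) {x : V} (hx : x ∈ A) :
    ∃ S ⊆ A, x ∈ S ∧ 3 * S.card ≤ A.card + 1 ∧ ∀ a ∈ A, G.Dominated S a := by
  obtain ⟨b, hb, h⟩ := h
  have hcard := h.card
  obtain ⟨φ, hφ, rfl, hL⟩ := h
  obtain ⟨i, hi, rfl⟩ := Finset.mem_image.1 hx
  have hi := Finset.mem_range.1 hi
  obtain ⟨S, hS, hdom⟩ := residueTwo_mem_check b hb i hi
  have hS' : ∀ k ∈ i :: S, k < b.1 := by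
    intro k hk
    rcases List.mem_cons.1 hk with rfl | hk
    exacts [hi, (smallSets_card b (List.mem_cons_of_mem _ hb) S hS).2 k hk]
  refine ⟨((i :: S).map φ).toFinset, map_subset hS' φ, by simp, ?_, ?_⟩
  · have := card_map_le (i :: S) φ
    have := smallSets_card_two b hb S hS
    rw [List.length_cons] at *
    omega
  · intro v hv
    obtain ⟨j, hj, rfl⟩ := Finset.mem_image.1 hv
    have hj := Finset.mem_range.1 hj
    refine hL.dominated ?_ (fun k hk l hl => hφ k (hS' k hk) l (hS' l hl)) (hdom j hj)
    intro k hk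
    exact List.mem_toFinset.2 (List.mem_map_of_mem hk)

/-- Delete the edge `ij` from the list. -/
def listDelete (L : List (ℕ × ℕ)) (i j : ℕ) : List (ℕ × ℕ) :=
  L.filter fun e => !(e == (i, j) || e == (j, i))

/-- Add a path of length four from `i` to `j` with interior `n, n + 1, n + 2`. -/
def listPath (L : List (ℕ × ℕ)) (n i j : ℕ) : List (ℕ × ℕ) :=
  (i, n + 0) :: (n + 0, n + 1) :: (n + 1, n + 2) :: (j, n + 2) :: L

/-- Three new vertices pay for one more dominator, taken on the new path. If `ij` is not an edge,
nothing is deleted and a path is merely added. -/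
theorem path_check : ∀ b ∈ fourCycle :: residueTwo, ∀ i < b.1, ∀ j < b.1, i ≠ j →
    ∃ S ∈ smallSets b.1, ∃ m < 3, ∀ k < b.1 + 3,
      listDominated (listPath (listDelete b.2 i j) b.1 i j) ([m].map (b.1 + ·) ++ S) k = true := by
  decide +kernel

/-- The five-cycle must be excluded: with a four-cycle attached it becomes `gluedCycles`, which is
exceptional again. -/
theorem cycle_check : ∀ b ∈ residueTwo, b ≠ fiveCycle → ∀ i < b.1,
    ∃ S ∈ smallSets b.1, ∃ m < 3, ∀ k < b.1 + 3,
      listDominated (listPath b.2 b.1 i i) ([m].map (b.1 + ·) ++ S) k = true := by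
  decide +kernel

theorem Spans.of_card_le {b : ℕ × List (ℕ × ℕ)} {A : Finset V} {φ : ℕ → V}
    (hφ : ∀ i < b.1, ∀ j < b.1, φ i = φ j → i = j) (hA : ∀ i < b.1, φ i ∈ A) (hc : A.card ≤ b.1)
    (hL : G.ListHom b.2 φ) : G.Spans b A := by
  refine ⟨φ, hφ, (Finset.eq_of_subset_of_card_le ?_ ?_).symm, hL⟩
  · intro v hv
    obtain ⟨i, hi, rfl⟩ := Finset.mem_image.1 hv
    exact hA i (Finset.mem_range.1 hi)
  · rw [Finset.card_image_of_injOn, Finset.card_range]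
    · exact hc
    · intro i hi j hj
      simp only [Finset.coe_range, Set.mem_Iio] at hi hj
      exact hφ i hi j hj

/-- The map `0 ↦ a, 1 ↦ b, 2 ↦ c`. -/
def triple (a b c : V) (k : ℕ) : V := if k = 0 then a else if k = 1 then b else c

theorem triple_injective {a b c : V} (hab : a ≠ b) (hac : a ≠ c) (hbc : b ≠ c) :
    ∀ i < 3, ∀ j < 3, triple a b c i = triple a b c j → i = j := by
  intro i hi j hj h
  interval_cases i <;> interval_cases j <;> simp_all [triple, eq_comm]

theorem ListHom.listPath {n : ℕ} {φ : ℕ → V} {L : List (ℕ × ℕ)} (hL : G.ListHom L φ)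
    (hlt : ∀ e ∈ L, e.1 < n ∧ e.2 < n) {i j : ℕ} (hi : i < n) (hj : j < n) {a b c : V}
    (hia : G.Adj (φ i) a) (hab : G.Adj a b) (hbc : G.Adj b c) (hcj : G.Adj c (φ j)) :
    G.ListHom (listPath L n i j) (SimpleGraph.extend n φ (triple a b c)) := by
  unfold SimpleGraph.listPath
  refine (((hL.extend hlt _).cons ?_).cons ?_).cons ?_ |>.cons ?_ <;>
    simp only [extend_add, extend_lt hi, extend_lt hj, triple]
  exacts [hcj.symm, hbc, hab, hia]

/-- Transfers `path_check` and `cycle_check` to `G`; the case `i = j` is the attached four-cycle. -/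
theorem solve_listPath {b : ℕ × List (ℕ × ℕ)} (hb : b ∈ fourCycle :: residueTwo) {φ : ℕ → V}
    (hφ : ∀ i < b.1, ∀ j < b.1, φ i = φ j → i = j) {L : List (ℕ × ℕ)} (hL : G.ListHom L φ)
    (hlt : ∀ e ∈ L, e.1 < b.1 ∧ e.2 < b.1) {i j : ℕ} (hi : i < b.1) (hj : j < b.1)
    {x y z : V} {A S₀ : Finset V} (hA : A = (Finset.range b.1).image φ) (hcard : A.card = b.1)
    (hx : x ∉ A) (hy : y ∉ A) (hz : z ∉ A) (hxy : x ≠ y) (hxz : x ≠ z)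
    (hyz : y ≠ z) (hix : G.Adj (φ i) x) (hxy' : G.Adj x y) (hyz' : G.Adj y z)
    (hzj : G.Adj z (φ j))
    (hcheck : ∃ S ∈ smallSets b.1, ∃ m < 3, ∀ k < b.1 + 3,
      listDominated (listPath L b.1 i j) ([m].map (b.1 + ·) ++ S) k = true) :
    G.Solve S₀ (A ∪ {x, y, z}) := by
  obtain ⟨S, hS, m, hm, hdom⟩ := hcheck
  obtain ⟨hS1, hS2⟩ := smallSets_card b hb S hS
  have hinj := triple_injective hxy hxz hyz
  have hd : ∀ k < b.1 + 3, G.Dominated (([m].map (triple x y z)).toFinset ∪ (S.map φ).toFinset)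
      (SimpleGraph.extend b.1 φ (triple x y z) k) := by
    intro k hk
    refine listDominated_extend hφ hinj ?_ (hL.listPath hlt hi hj hix hxy' hyz' hzj) hS2
      (by simpa using hm) (hdom k hk)
    rw [← hA]
    intro k hk
    interval_cases k <;> simpa [triple]
  refine ⟨([m].map (triple x y z)).toFinset ∪ (S.map φ).toFinset, ?_, ?_⟩
  · have h1 := Finset.card_union_le ([m].map (triple x y z)).toFinset (S.map φ).toFinset
    have h2 := card_map_le S φ
    have h3 := card_map_le [m] (triple x y z)
    rw [List.length_singleton] at h3
    have h4 : (A ∪ {x, y, z}).card = b.1 + 3 := by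
      rw [Finset.card_union_of_disjoint, hcard, Finset.card_eq_three.2 ⟨x, y, z, hxy, hxz, hyz, rfl⟩]
      simp [hx, hy, hz]
    omega
  · intro v hv
    refine Dominated.mono ?_ Finset.subset_union_right
    simp only [Finset.mem_union, Finset.mem_insert, Finset.mem_singleton] at hv
    rcases hv with hv | rfl | rfl | rfl
    · rw [hA] at hv
      obtain ⟨k, hk, rfl⟩ := Finset.mem_image.1 hv
      have hk := Finset.mem_range.1 hk
      have := hd k (by omega)
      rwa [extend_lt hk] at this
    · have := hd (b.1 + 0) (by omega)
      rw [extend_add] at this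
      exact this
    · have := hd (b.1 + 1) (by omega)
      rw [extend_add] at this
      exact this
    · have := hd (b.1 + 2) (by omega)
      rw [extend_add] at this
      exact this

theorem SpansEx.exists_spans {A : Finset V} (h : G.SpansEx A) :
    ∃ b ∈ fourCycle :: residueTwo, G.Spans b A := by
  rcases h with h | ⟨b, hb, h⟩
  · exact ⟨_, List.mem_cons_self, h⟩
  · exact ⟨b, List.mem_cons_of_mem _ hb, h⟩

/-- Replacing an edge (or non-edge) `uv` of an exceptional graph by a path of length four. -/
theorem SpansEx.solve_path {A S₀ : Finset V} (h : H.SpansEx A) {u v x y z : V}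
    (hHG : ∀ p q, H.Adj p q → G.Adj p q ∨ (p = u ∧ q = v) ∨ (p = v ∧ q = u))
    (hu : u ∈ A) (hv : v ∈ A) (huv : u ≠ v) (hx : x ∉ A) (hy : y ∉ A) (hz : z ∉ A) (hxy : x ≠ y)
    (hxz : x ≠ z) (hyz : y ≠ z) (hux : G.Adj u x) (hxy' : G.Adj x y) (hyz' : G.Adj y z)
    (hzv : G.Adj z v) : G.Solve S₀ (A ∪ {x, y, z}) := by
  obtain ⟨b, hb, h⟩ := h.exists_spans
  have hcard := h.card
  obtain ⟨φ, hφ, hA, hL⟩ := h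
  rw [hA] at hu hv
  obtain ⟨i, hi, rfl⟩ := Finset.mem_image.1 hu
  obtain ⟨j, hj, rfl⟩ := Finset.mem_image.1 hv
  have hi := Finset.mem_range.1 hi
  have hj := Finset.mem_range.1 hj
  have hlt := residueTwo_lt b hb
  refine solve_listPath (L := listDelete b.2 i j) hb hφ ?_ ?_ hi hj hA hcard hx hy hz hxy hxz hyz
    hux hxy' hyz' hzv (path_check b hb i hi j hj fun e => huv (e ▸ rfl))
  · intro e he
    simp only [listDelete, List.mem_filter, Bool.not_eq_true', Bool.or_eq_false_iff,
      beq_eq_false_iff_ne] at he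
    obtain ⟨he, h1, h2⟩ := he
    rcases hHG _ _ (hL e he) with h | ⟨h3, h4⟩ | ⟨h3, h4⟩
    · exact h
    · exact absurd (Prod.ext (hφ _ (hlt e he).1 _ hi h3) (hφ _ (hlt e he).2 _ hj h4)) h1
    · exact absurd (Prod.ext (hφ _ (hlt e he).1 _ hj h3) (hφ _ (hlt e he).2 _ hi h4)) h2
  · intro e he
    exact hlt e (List.mem_of_mem_filter he)

/-- The relabelling that exhibits a five-cycle with a four-cycle attached at `i`. -/
def glueLabel (i k : ℕ) : ℕ := if k = 0 then i else if k < 4 then k + 4 else (i + k - 3) % 5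

/-- Label 0 is the shared vertex, 1, 2, 3 go to the new vertices 5, 6, 7, and 4 to 7 run round the
five-cycle from the successor of `i`. -/
theorem glueLabel_check : ∀ i < 5,
    (∀ e ∈ gluedCycles.2,
      listAdj (listPath fiveCycle.2 5 i i) (glueLabel i e.1) (glueLabel i e.2) = true) ∧
    (∀ k < 8, glueLabel i k < 8) ∧
    ∀ k < 8, ∀ l < 8, glueLabel i k = glueLabel i l → k = l := by
  decide +kernel

/-- Attaching a four-cycle at a vertex. -/
theorem SpansTwo.solve_cycle {A S₀ : Finset V} (h : G.SpansTwo A) {v x y z : V} (hv : v ∈ A)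
    (hx : x ∉ A) (hy : y ∉ A) (hz : z ∉ A) (hxy : x ≠ y) (hxz : x ≠ z) (hyz : y ≠ z)
    (hvx : G.Adj v x) (hxy' : G.Adj x y) (hyz' : G.Adj y z) (hzv : G.Adj z v) :
    G.Solve S₀ (A ∪ {x, y, z}) ∨ G.SpansTwo (A ∪ {x, y, z}) := by
  obtain ⟨b, hb, h⟩ := h
  have hcard := h.card
  obtain ⟨φ, hφ, hA, hL⟩ := h
  have hv' := hv
  rw [hA] at hv'
  obtain ⟨i, hi, rfl⟩ := Finset.mem_image.1 hv'
  have hi := Finset.mem_range.1 hi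
  have hb' := List.mem_cons_of_mem fourCycle hb
  have hlt := residueTwo_lt b hb'
  by_cases hb5 : b = fiveCycle
  · subst hb5
    right
    obtain ⟨h1, h2, h3⟩ := glueLabel_check i hi
    have hinj := extend_injective hφ (triple_injective hxy hxz hyz) (by
      rw [← hA]
      intro k hk
      interval_cases k <;> simpa [triple])
    refine ⟨gluedCycles, by decide, Spans.of_card_le
      (φ := fun k => SimpleGraph.extend 5 φ (triple x y z) (glueLabel i k)) ?_ ?_ ?_ ?_⟩
    · intro k hk l hl hkl
      exact h3 k hk l hl (hinj _ (h2 k hk) _ (h2 l hl) hkl)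
    · intro k hk
      have := h2 k hk
      by_cases hk5 : glueLabel i k < 5
      · rw [extend_lt hk5, hA]
        exact Finset.mem_union_left _ (Finset.mem_image_of_mem φ (Finset.mem_range.2 hk5))
      · obtain ⟨m, hm⟩ := Nat.exists_eq_add_of_le (not_lt.1 hk5)
        rw [hm, extend_add]
        have : m < 3 := by omega
        interval_cases m <;> simp [triple]
    · have := Finset.card_union_le A {x, y, z}
      have h4 : ({x, y, z} : Finset V).card ≤ 3 := Finset.card_le_three
      have h5 : fiveCycle.1 = 5 := rfl
      have h6 : gluedCycles.1 = 8 := rfl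
      omega
    · intro e he
      exact (hL.listPath hlt hi hi hvx hxy' hyz' hzv).adj (h1 e he)
  · left
    exact solve_listPath hb' hφ hL hlt hi hi hA hcard hx hy hz hxy hxz hyz hvx hxy' hyz' hzv
      (cycle_check b hb hb5 i hi)

end Exceptional
end SimpleGraph

namespace SimpleGraph

/-! ### Minimal counterexamples and the deletion reduction. -/

section Critical

variable {V : Type*} [DecidableEq V] {G H : SimpleGraph V} {S₀ S₁ U R A : Finset V}

/-- No edge of `G` inside `U` leaves `A`. -/
def ClosedIn (G : SimpleGraph V) (U A : Finset V) : Prop := ∀ a ∈ A, ∀ b ∈ U, G.Adj a b → b ∈ A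

open Classical in
/-- The neighbours of `v` in `U`. -/
noncomputable def nb (G : SimpleGraph V) (U : Finset V) (v : V) : Finset V := U.filter (G.Adj v)

theorem mem_nb {v u : V} : u ∈ G.nb U v ↔ u ∈ U ∧ G.Adj v u := by simp [nb]

theorem nb_sdiff (v : V) : G.nb (U \ R) v = G.nb U v \ R := by
  ext u
  simp only [mem_nb, Finset.mem_sdiff]
  tauto

theorem card_nb_sdiff {v : V} {k : ℕ} (h : (G.nb U v ∩ R).card ≤ k) :
    (G.nb U v).card ≤ (G.nb (U \ R) v).card + k := by
  rw [nb_sdiff]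
  have := Finset.card_sdiff_add_card_inter (G.nb U v) R
  omega

/-- The hypotheses under which `Solve` is proved by induction: vertices without a neighbour in
`S₀` have two neighbours in `U`, and exceptional components can be solved. -/
structure Good (G : SimpleGraph V) (S₀ U : Finset V) : Prop where
  disj : Disjoint S₀ U
  deg : ∀ v ∈ U, (∃ s ∈ S₀, G.Adj v s) ∨ 2 ≤ (G.nb U v).card
  ex : ∀ A ⊆ U, G.ClosedIn U A → G.SpansEx A → G.Solve S₀ A

/-- A minimal counterexample. -/
structure Critical (G : SimpleGraph V) (S₀ U : Finset V) : Prop where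
  good : G.Good S₀ U
  conn : ∀ A ⊆ U, A.Nonempty → G.ClosedIn U A → A = U
  unsolved : ¬ G.Solve S₀ U
  -- The edges are those of the whole graph on `V`. Thus deletions in `U` and deletions of an edge
  -- both lower the measure, and so does exchanging three vertices of `U` for one edge.
  ih : ∀ (H : SimpleGraph V) (T₀ W : Finset V),
    W.card + H.edgeSet.ncard < U.card + G.edgeSet.ncard → H.Good T₀ W → H.Solve T₀ W

/-- An exceptional piece is an obstacle only as long as no source is adjacent to it. -/
theorem SpansEx.solve_of_adj (h : G.SpansEx A) {x s : V} (hx : x ∈ A) (hs : s ∈ S₀) (hsA : s ∉ A)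
    (hxs : G.Adj x s) : G.Solve S₀ A := by
  rcases h with h | h
  · exact h.solve_fourCycle hx hs hsA (Or.inl hxs)
  · obtain ⟨S, -, h2, h3⟩ := h.exists_of_adj hx hsA hxs
    refine ⟨S, by omega, fun v hv => (h3 v hv).mono ?_⟩
    exact Finset.insert_subset (Finset.mem_union_left _ hs) Finset.subset_union_right

namespace Critical

theorem not_spansEx (hC : G.Critical S₀ U) : ¬ G.SpansEx U := fun h =>
  hC.unsolved (hC.good.ex U subset_rfl (fun _ _ _ hb _ => hb) h)

theorem notMem (hC : G.Critical S₀ U) {v : V} (hv : v ∈ U) : v ∉ S₀ := fun h =>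
  Finset.disjoint_left.1 hC.good.disj h hv

/-- A nonempty proper subset of `U` has an edge to its complement. -/
theorem exists_exit (hC : G.Critical S₀ U) (hA : A ⊆ U) (hne : A.Nonempty) (hAU : A ≠ U) :
    ∃ a ∈ A, ∃ b ∈ U, b ∉ A ∧ G.Adj a b := by
  by_contra! h
  refine hAU (hC.conn A hA hne fun a ha b hb hab => ?_)
  by_contra hbA
  exact h a ha b hb hbA hab

/-- The general reduction: delete `R`, having put `S₁` into the dominating set. -/
theorem remove (hC : G.Critical S₀ U) (hR : R ⊆ U) (hne : R.Nonempty) (hS : S₁ ⊆ R)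
    (hc : 3 * S₁.card ≤ R.card) (hd : ∀ v ∈ R, G.Dominated (S₀ ∪ S₁) v)
    (hdeg : ∀ w ∈ U, w ∉ R → (∀ s ∈ S₁, ¬ G.Adj w s) → (∃ s ∈ S₀, G.Adj w s) ∨
      2 ≤ (G.nb (U \ R) w).card)
    (hA : ∀ A ⊆ U, Disjoint A R → G.ClosedIn (U \ R) A → G.SpansEx A →
      (∀ a ∈ A, ∀ s ∈ S₁, ¬ G.Adj a s) → G.Solve (S₀ ∪ S₁) A) : False := by
  refine hC.unsolved (.of_remove hR hc hd (hC.ih _ _ _ ?_ ⟨?_, ?_, ?_⟩))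
  · have := Finset.card_sdiff_add_card_eq_card hR
    have := hne.card_pos
    omega
  · rw [Finset.disjoint_union_left]
    refine ⟨hC.good.disj.mono_right Finset.sdiff_subset, ?_⟩
    exact Finset.disjoint_sdiff.mono_left hS
  · intro w hw
    obtain ⟨hw, hwR⟩ := Finset.mem_sdiff.1 hw
    by_cases h : ∃ s ∈ S₁, G.Adj w s
    · obtain ⟨s, hs, hws⟩ := h
      exact Or.inl ⟨s, Finset.mem_union_right _ hs, hws⟩
    · push Not at h
      refine (hdeg w hw hwR h).imp_left ?_
      rintro ⟨s, hs, hws⟩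
      exact ⟨s, Finset.mem_union_left _ hs, hws⟩
  · intro A hAU hcl hex
    have hAR : Disjoint A R := Finset.disjoint_of_subset_left hAU Finset.sdiff_disjoint
    by_cases h : ∃ a ∈ A, ∃ s ∈ S₁, G.Adj a s
    · obtain ⟨a, ha, s, hs, has⟩ := h
      exact hex.solve_of_adj ha (Finset.mem_union_right _ hs)
        (Finset.disjoint_right.1 hAR (hS hs)) has
    · push Not at h
      exact hA A (hAU.trans Finset.sdiff_subset) hAR hcl hex h

/-- In the setting of `remove`, a nonempty closed set has an edge to `R`. -/
theorem exists_adj_of_closedIn (hC : G.Critical S₀ U) (hne : R.Nonempty) (hR : R ⊆ U)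
    (hA : A ⊆ U) (hAR : Disjoint A R) (hcl : G.ClosedIn (U \ R) A) (hA' : A.Nonempty) :
    ∃ a ∈ A, ∃ r ∈ R, G.Adj a r := by
  obtain ⟨a, ha, b, hb, hbA, hab⟩ := hC.exists_exit hA hA' (by
    rintro rfl
    obtain ⟨r, hr⟩ := hne
    exact Finset.disjoint_right.1 hAR hr (hR hr))
  refine ⟨a, ha, b, ?_, hab⟩
  by_contra hbR
  exact hbA (hcl a ha b (Finset.mem_sdiff.2 ⟨hb, hbR⟩) hab)

theorem two_le_card_nb_sdiff (hC : G.Critical S₀ U) {w : V} (hw : w ∈ U)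
    (h : ∀ r ∈ R, ¬ G.Adj w r) : (∃ s ∈ S₀, G.Adj w s) ∨ 2 ≤ (G.nb (U \ R) w).card := by
  rw [nb_sdiff, Finset.sdiff_eq_self_of_disjoint]
  · exact hC.good.deg w hw
  · exact Finset.disjoint_left.2 fun u hu hur => h u hur (mem_nb.1 hu).2

/-- The reduction when all vertices outside `R` with a neighbour in `R` have one in `S₁`. -/
theorem remove_of_exit (hC : G.Critical S₀ U) (hR : R ⊆ U) (hne : R.Nonempty) (hS : S₁ ⊆ R)
    (hc : 3 * S₁.card ≤ R.card) (hd : ∀ v ∈ R, G.Dominated (S₀ ∪ S₁) v)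
    (hexit : ∀ w ∈ U, w ∉ R → ∀ r ∈ R, G.Adj w r → ∃ s ∈ S₁, G.Adj w s) : False := by
  refine hC.remove hR hne hS hc hd (fun w hw hwR h => ?_) fun A hAU hAR hcl hex h => ?_
  · refine hC.two_le_card_nb_sdiff hw fun r hr hwr => ?_
    obtain ⟨s, hs, hws⟩ := hexit w hw hwR r hr hwr
    exact h s hs hws
  · exfalso
    obtain ⟨a, ha, r, hr, har⟩ := hC.exists_adj_of_closedIn hne hR hAU hAR hcl hex.nonempty
    obtain ⟨s, hs, has⟩ := hexit a (hAU ha) (Finset.disjoint_left.1 hAR ha) r hr har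
    exact h a ha s hs has

/-- In a minimal counterexample all degrees are at least two. -/
theorem two_le_card_nb (hC : G.Critical S₀ U) {t : V} (ht : t ∈ U) : 2 ≤ (G.nb U t).card := by
  by_contra! hlt
  obtain ⟨s, hs, hts⟩ := (hC.good.deg t ht).resolve_right (by omega)
  have htd : G.Dominated S₀ t := .of_adj hs hts
  have hne : G.nb U t ≠ ∅ := by
    intro h0
    have : ({t} : Finset V) = U := hC.conn {t} (by simpa using ht) (by simp) (by
      intro a ha b hb hab
      rw [Finset.mem_singleton.1 ha] at hab
      have : b ∈ G.nb U t := mem_nb.2 ⟨hb, hab⟩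
      simp [h0] at this)
    refine hC.unsolved ⟨∅, by simp, fun v hv => ?_⟩
    rw [← this, Finset.mem_singleton] at hv
    simpa [hv] using htd
  obtain ⟨f, hf⟩ := Finset.card_eq_one.1 (show (G.nb U t).card = 1 by
    have := Finset.card_pos.2 (Finset.nonempty_iff_ne_empty.2 hne)
    omega)
  have hft : ∀ b ∈ U, G.Adj t b → b = f := by
    intro b hb hab
    have : b ∈ G.nb U t := mem_nb.2 ⟨hb, hab⟩
    simpa [hf] using this
  obtain ⟨hfU, htf⟩ : f ∈ U ∧ G.Adj t f := mem_nb.1 (by simp [hf])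
  -- As `t` is dominated by `S₀`, it can be deleted free of charge unless this spoils the degree
  -- condition at its only neighbour `f`.
  have hremove : ((∃ s ∈ S₀, G.Adj f s) ∨ 3 ≤ (G.nb U f).card) → False := by
    intro h3
    refine hC.remove (R := {t}) (S₁ := ∅) (by simpa using ht) (by simp) (by simp) (by simp)
      (by simpa using htd) ?_ ?_
    · intro w hw hwt _
      by_cases hwf : w = f
      · subst hwf
        rcases h3 with h3 | h3
        · exact Or.inl h3
        · have := card_nb_sdiff (G := G) (U := U) (R := {t}) (v := w) (k := 1)
            ((Finset.card_le_card Finset.inter_subset_right).trans (by simp))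
          exact Or.inr (by omega)
      · refine hC.two_le_card_nb_sdiff hw fun r hr hwr => hwf ?_
        rw [Finset.mem_singleton.1 hr] at hwr
        exact hft w hw hwr.symm
    · intro A hAU hAR hcl hex _
      rw [Finset.union_empty]
      obtain ⟨a, ha, r, hr, har⟩ := hC.exists_adj_of_closedIn (by simp) (by simpa using ht) hAU hAR
        hcl hex.nonempty
      obtain rfl := Finset.mem_singleton.1 hr
      obtain rfl := hft a (hAU ha) har.symm
      have htA : r ∉ A := by simpa using hAR
      have hU : insert r A = U := by
        refine hC.conn _ (Finset.insert_subset ht hAU) (by simp) ?_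
        intro p hp q hq hpq
        rcases Finset.mem_insert.1 hp with rfl | hp
        · rw [hft q hq hpq]
          exact Finset.mem_insert_of_mem ha
        · by_cases hqr : q = r
          · simp [hqr]
          · exact Finset.mem_insert_of_mem (hcl p hp q (by simp [hq, hqr]) hpq)
      have hcard : U.card = A.card + 1 := by rw [← hU, Finset.card_insert_of_notMem htA]
      -- A four-cycle is helped by `s`, two steps away through `t`. Otherwise |A| is 2 modulo 3 and
      -- `U` has one more vertex, which pays for taking `t` itself.
      rcases hex with h | h
      · exact h.solve_fourCycle ha hs
          (fun h => hC.notMem (hAU h) hs) (Or.inr ⟨r, har, hts⟩)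
      · obtain ⟨S, hSA, h2, h3⟩ := h.exists_of_adj ha htA har
        refine absurd ⟨insert r S, ?_, fun v hv => ?_⟩ hC.unsolved
        · have := Finset.card_insert_le r S
          omega
        · rw [← hU] at hv
          rcases Finset.mem_insert.1 hv with rfl | hv
          · exact .of_mem (by simp)
          · exact (h3 v hv).mono Finset.subset_union_right
  by_cases hfT : ∃ s ∈ S₀, G.Adj f s
  · exact hremove (Or.inl hfT)
  have hf2 := (hC.good.deg f hfU).resolve_left hfT
  by_cases hf3 : 3 ≤ (G.nb U f).card
  · exact hremove (Or.inr hf3)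
  obtain ⟨g, hgt, hg⟩ : ∃ g, t ≠ g ∧ G.nb U f = {t, g} := by
    obtain ⟨x, y, hxy, h⟩ := Finset.card_eq_two.1 (show (G.nb U f).card = 2 by omega)
    have : t ∈ G.nb U f := mem_nb.2 ⟨ht, htf.symm⟩
    rw [h] at this
    simp only [Finset.mem_insert, Finset.mem_singleton] at this
    rcases this with rfl | rfl
    · exact ⟨y, hxy, h⟩
    · exact ⟨x, hxy.symm, by rw [h, Finset.pair_comm]⟩
  obtain ⟨hgU, hfg⟩ : g ∈ U ∧ G.Adj f g := mem_nb.1 (by simp [hg])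
  -- Now `f` has only the neighbours `t` and `g`, so every exit from these three vertices is at `g`.
  refine hC.remove_of_exit (R := {t, f, g}) (S₁ := {g}) ?_ (by simp) (by simp) ?_ ?_ ?_
  · simp [Finset.insert_subset_iff, ht, hfU, hgU]
  · rw [Finset.card_eq_three.2 ⟨t, f, g, htf.ne, hgt, hfg.ne, rfl⟩]
    simp
  · intro v hv
    simp only [Finset.mem_insert, Finset.mem_singleton] at hv
    rcases hv with rfl | rfl | rfl
    · exact htd.mono Finset.subset_union_left
    · exact .of_adj (u := g) (by simp) hfg
    · exact .of_mem (by simp)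
  · intro w hw hwR r hr hwr
    simp only [Finset.mem_insert, Finset.mem_singleton, not_or] at hr hwR
    rcases hr with rfl | rfl | rfl
    · exact absurd (hft w hw hwr.symm) hwR.2.1
    · have : w ∈ G.nb U r := mem_nb.2 ⟨hw, hwr.symm⟩
      rw [hg] at this
      simp only [Finset.mem_insert, Finset.mem_singleton] at this
      tauto
    · exact ⟨r, by simp, hwr⟩

end Critical

end Critical
end SimpleGraph

namespace SimpleGraph

/-! ### Single exits, attached four-cycles and edges between large vertices. -/

section Reductions

variable {V : Type*} [DecidableEq V] {G H : SimpleGraph V} {S₀ S₁ U R A X Y : Finset V}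

theorem Spans.of_list {b : ℕ × List (ℕ × ℕ)} (l : List V) (d : V) (hl : l.length = b.1)
    (hn : l.Nodup) (hlt : ∀ e ∈ b.2, G.Adj (l.getD e.1 d) (l.getD e.2 d)) :
    G.Spans b l.toFinset := by
  refine ⟨fun k => l.getD k d, ?_, ?_, hlt⟩
  · intro i hi j hj hij
    rw [← hl] at hi hj
    simp only [List.getD_eq_getElem _ _ hi, List.getD_eq_getElem _ _ hj] at hij
    exact (hn.getElem_inj_iff).1 hij
  · ext v
    simp only [List.mem_toFinset, Finset.mem_image, Finset.mem_range]
    rw [List.mem_iff_getElem]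
    constructor
    · rintro ⟨i, hi, rfl⟩
      exact ⟨i, hl ▸ hi, List.getD_eq_getElem _ _ hi⟩
    · rintro ⟨i, hi, rfl⟩
      rw [← hl] at hi
      exact ⟨i, hi, (List.getD_eq_getElem _ _ hi).symm⟩

theorem spans_fourCycle {a b c d : V} (hac : a ≠ c) (hbd : b ≠ d) (hab : G.Adj a b)
    (hbc : G.Adj b c) (hcd : G.Adj c d) (hda : G.Adj d a) :
    G.Spans fourCycle {a, b, c, d} := by
  have := Spans.of_list (G := G) (b := fourCycle) [a, b, c, d] a rfl
    (by simp [hac, hbd, hab.ne, hbc.ne, hcd.ne, hda.ne.symm])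
    (by simp [fourCycle, hab, hbc, hcd, hda])
  simpa using this

theorem Spans.exists_cycle (h : G.Spans fourCycle X) {x : V} (hx : x ∈ X) :
    ∃ b c d, x ≠ c ∧ b ≠ d ∧ G.Adj x b ∧ G.Adj b c ∧ G.Adj c d ∧ G.Adj d x ∧
      X = {x, b, c, d} := by
  obtain ⟨φ, hφ, rfl, hL⟩ := h
  obtain ⟨i, hi, rfl⟩ := Finset.mem_image.1 hx
  have h1 : G.Adj (φ 0) (φ 1) := hL (0, 1) (by decide)
  have h2 : G.Adj (φ 1) (φ 2) := hL (1, 2) (by decide)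
  have h3 : G.Adj (φ 2) (φ 3) := hL (2, 3) (by decide)
  have h4 : G.Adj (φ 3) (φ 0) := hL (3, 0) (by decide)
  have h5 : φ 0 ≠ φ 2 := fun e => absurd (hφ 0 (by decide) 2 (by decide) e) (by decide)
  have h6 : φ 1 ≠ φ 3 := fun e => absurd (hφ 1 (by decide) 3 (by decide) e) (by decide)
  have hX : (Finset.range fourCycle.1).image φ = {φ 0, φ 1, φ 2, φ 3} := by
    change (Finset.range 4).image φ = _
    ext v
    simp only [Finset.mem_image, Finset.mem_range, Finset.mem_insert, Finset.mem_singleton]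
    constructor
    · rintro ⟨k, hk, rfl⟩
      interval_cases k <;> simp
    · rintro (rfl | rfl | rfl | rfl)
      exacts [⟨0, by simp⟩, ⟨1, by simp⟩, ⟨2, by simp⟩, ⟨3, by simp⟩]
  rw [hX]
  have hi : i < 4 := Finset.mem_range.1 hi
  interval_cases i
  · exact ⟨_, _, _, h5, h6, h1, h2, h3, h4, rfl⟩
  · exact ⟨_, _, _, h6, h5.symm, h2, h3, h4, h1, by ext; simp; tauto⟩
  · exact ⟨_, _, _, h5.symm, h6.symm, h3, h4, h1, h2, by ext; simp; tauto⟩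
  · exact ⟨_, _, _, h6.symm, h5, h4, h1, h2, h3, by ext; simp; tauto⟩

/-- `f` is a vertex of `U` whose neighbours in `U` are precisely `v` and `g`. -/
structure Mid (G : SimpleGraph V) (U : Finset V) (v f g : V) : Prop where
  mem : f ∈ U
  ne : v ≠ g
  nb_eq : G.nb U f = {v, g}

namespace Mid

variable {v f g : V}

theorem symm (h : G.Mid U v f g) : G.Mid U g f v :=
  ⟨h.mem, h.ne.symm, by rw [h.nb_eq, Finset.pair_comm]⟩

theorem card (h : G.Mid U v f g) : (G.nb U f).card = 2 := by
  rw [h.nb_eq, Finset.card_pair h.ne]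

theorem mem_pair (h : G.Mid U v f g) : v ∈ U ∧ G.Adj f v := by
  rw [← mem_nb, h.nb_eq]
  simp

theorem left_mem (h : G.Mid U v f g) : v ∈ U := h.mem_pair.1

theorem adj_left (h : G.Mid U v f g) : G.Adj f v := h.mem_pair.2

theorem right_mem (h : G.Mid U v f g) : g ∈ U := h.symm.left_mem

theorem adj_right (h : G.Mid U v f g) : G.Adj f g := h.symm.adj_left

theorem eq_or (h : G.Mid U v f g) {q : V} (hq : q ∈ U) (hfq : G.Adj f q) : q = v ∨ q = g := by
  have : q ∈ G.nb U f := mem_nb.2 ⟨hq, hfq⟩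
  simpa [h.nb_eq] using this

end Mid

theorem exists_mid {f v : V} (hf : f ∈ U) (hv : v ∈ U) (hfv : G.Adj f v)
    (h : (G.nb U f).card = 2) : ∃ g, G.Mid U v f g := by
  obtain ⟨x, y, hxy, h⟩ := Finset.card_eq_two.1 h
  have : v ∈ G.nb U f := mem_nb.2 ⟨hv, hfv⟩
  rw [h] at this
  simp only [Finset.mem_insert, Finset.mem_singleton] at this
  rcases this with rfl | rfl
  · exact ⟨y, hf, hxy, h⟩
  · exact ⟨x, hf, hxy.symm, by rw [h, Finset.pair_comm]⟩

/-- `X` is spanned by a four-cycle and `xw` is the only edge that leaves `X`. -/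
structure Pendant (G : SimpleGraph V) (U X : Finset V) (x w : V) : Prop where
  sub : X ⊆ U
  spans : G.Spans fourCycle X
  mem : x ∈ X
  memU : w ∈ U
  notMem : w ∉ X
  adj : G.Adj x w
  exit : ∀ p ∈ X, ∀ q ∈ U, q ∉ X → G.Adj p q → p = x ∧ q = w

namespace Critical

variable {a b c u v f g x w : V}

/-- No set of the second type has all its exits at one vertex. -/
theorem not_spansTwo (hC : G.Critical S₀ U) (hX : X ⊆ U) (h : G.SpansTwo X) (hx : x ∈ X)
    (hw : w ∈ U) (hwX : w ∉ X) (hxw : G.Adj x w)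
    (hexit : ∀ p ∈ X, ∀ q ∈ U, q ∉ X → G.Adj p q → q = w) : False := by
  obtain ⟨S, hS, h1, h2⟩ := h.exists_of_adj hx hwX hxw
  -- Adding the exit `w` makes the order divisible by 3, and every edge out of the enlarged set
  -- starts at `w`.
  refine hC.remove_of_exit (R := insert w X) (S₁ := insert w S) (Finset.insert_subset hw hX)
    (by simp) (Finset.insert_subset_insert _ hS) ?_ ?_ ?_
  · rw [Finset.card_insert_of_notMem hwX]
    have := Finset.card_insert_le w S
    omega
  · intro p hp
    rcases Finset.mem_insert.1 hp with rfl | hp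
    · exact .of_mem (by simp)
    · exact (h2 p hp).mono Finset.subset_union_right
  · intro p hp hpR r hr hpr
    simp only [Finset.mem_insert, not_or] at hpR hr
    rcases hr with rfl | hr
    · exact ⟨r, by simp, hpr⟩
    · exact absurd (hexit r hr p hp hpR.2 hpr.symm) hpR.1

theorem not_triangle (hC : G.Critical S₀ U) (hf : G.Mid U v f g) (hg : G.Mid U f g v) : False := by
  refine hC.remove_of_exit (R := {v, f, g}) (S₁ := {v}) ?_ (by simp) (by simp) ?_ ?_ ?_
  · simp [Finset.insert_subset_iff, hf.mem, hf.left_mem, hf.right_mem]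
  · rw [Finset.card_eq_three.2 ⟨v, f, g, hf.adj_left.ne.symm, hf.ne, hf.adj_right.ne, rfl⟩]
    simp
  · intro p hp
    simp only [Finset.mem_insert, Finset.mem_singleton] at hp
    rcases hp with rfl | rfl | rfl
    · exact .of_mem (by simp)
    · exact .of_adj (u := v) (by simp) hf.adj_left
    · exact .of_adj (u := v) (by simp) hg.adj_right
  · intro p hp hpR r hr hpr
    simp only [Finset.mem_insert, Finset.mem_singleton, not_or] at hpR hr
    rcases hr with rfl | rfl | rfl
    · exact ⟨r, by simp, hpr⟩
    · have := hf.eq_or hp hpr.symm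
      tauto
    · have := hg.eq_or hp hpr.symm
      tauto

/-- Deleting `a`, `b`, `c` at the price of `b` leaves `u` two neighbours. An exceptional remainder
contains `u` and fills the rest of `U`. A four-cycle is helped by `b`, two steps from `u`; any other
is an exceptional graph with a four-cycle attached, hence solvable or exceptional itself. -/
theorem not_cycle_of_four_le (hC : G.Critical S₀ U) (ha : G.Mid U u a b) (hb : G.Mid U a b c)
    (hc : G.Mid U b c u) (hu : 4 ≤ (G.nb U u).card) : False := by
  have hab := ha.adj_right
  have hbc := hb.adj_right
  have hcu := hc.adj_right
  have hua := ha.adj_left.symm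
  have hR : ∀ w ∈ U, w ∉ ({a, b, c} : Finset V) → ∀ r ∈ ({a, b, c} : Finset V), G.Adj w r →
      w = u := by
    intro w hw hwR r hr hwr
    simp only [Finset.mem_insert, Finset.mem_singleton, not_or] at hwR hr
    rcases hr with rfl | rfl | rfl
    · have := ha.eq_or hw hwr.symm
      tauto
    · have := hb.eq_or hw hwr.symm
      tauto
    · have := hc.eq_or hw hwr.symm
      tauto
  have hRU : ({a, b, c} : Finset V) ⊆ U := by
    simp [Finset.insert_subset_iff, ha.mem, hb.mem, hc.mem]
  have huR : u ∉ ({a, b, c} : Finset V) := by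
    simp [hua.ne, ha.ne, hcu.ne.symm]
  refine hC.remove (R := {a, b, c}) (S₁ := {b}) hRU (by simp) (by simp) ?_ ?_ ?_ ?_
  · rw [Finset.card_eq_three.2 ⟨a, b, c, hab.ne, hb.ne, hbc.ne, rfl⟩]
    simp
  · intro p hp
    simp only [Finset.mem_insert, Finset.mem_singleton] at hp
    rcases hp with rfl | rfl | rfl
    · exact .of_adj (u := b) (by simp) hab
    · exact .of_mem (by simp)
    · exact .of_adj (u := b) (by simp) hbc.symm
  · intro w hw hwR _
    by_cases hwu : w = u
    · subst hwu
      have := card_nb_sdiff (G := G) (U := U) (R := {a, b, c}) (v := w) (k := 2) (by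
        have : G.nb U w ∩ {a, b, c} ⊆ {a, c} := by
          intro q hq
          simp only [Finset.mem_inter, mem_nb, Finset.mem_insert, Finset.mem_singleton] at hq ⊢
          obtain ⟨⟨hq, hwq⟩, rfl | rfl | rfl⟩ := hq
          · simp
          · exfalso
            have := hb.eq_or hw hwq.symm
            rcases hb.eq_or hw hwq.symm with h | h
            · exact hua.ne h
            · exact hcu.ne h.symm
          · simp
        exact (Finset.card_le_card this).trans Finset.card_le_two)
      exact Or.inr (by omega)
    · exact hC.two_le_card_nb_sdiff hw fun r hr hwr => hwu (hR w hw hwR r hr hwr)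
  · intro A hAU hAR hcl hex _
    obtain ⟨u', hu'A, r, hr, har⟩ := hC.exists_adj_of_closedIn (by simp) hRU hAU hAR hcl
      hex.nonempty
    obtain rfl := hR _ (hAU hu'A) (Finset.disjoint_left.1 hAR hu'A) r hr har
    have hU : A ∪ {a, b, c} = U := by
      refine hC.conn _ (Finset.union_subset hAU hRU) (by simp) ?_
      intro p hp q hq hpq
      by_cases hqR : q ∈ ({a, b, c} : Finset V)
      · exact Finset.mem_union_right _ hqR
      refine Finset.mem_union_left _ ?_
      rcases Finset.mem_union.1 hp with hp | hp
      · exact hcl p hp q (Finset.mem_sdiff.2 ⟨hq, hqR⟩) hpq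
      · rw [hR q hq hqR p hp hpq.symm]
        exact hu'A
    have hnA : ∀ r ∈ ({a, b, c} : Finset V), r ∉ A := fun r hr => Finset.disjoint_right.1 hAR hr
    rcases hex with h | h
    · exact h.solve_fourCycle hu'A (s := b) (by simp) (hnA b (by simp)) (Or.inr ⟨a, hua, hab⟩)
    · exfalso
      rcases h.solve_cycle (S₀ := S₀) hu'A (hnA a (by simp)) (hnA b (by simp)) (hnA c (by simp))
        hab.ne hb.ne hbc.ne hua hab hbc hcu with h | h
      · exact hC.unsolved (hU ▸ h)
      · exact hC.not_spansEx (hU ▸ Or.inr h)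

/-- A four-cycle with three vertices of degree two is pendant. -/
theorem exists_pendant_of_cycle (hC : G.Critical S₀ U) (ha : G.Mid U u a b) (hb : G.Mid U a b c)
    (hc : G.Mid U b c u) : (G.nb U u).card = 3 ∧ ∃ w, G.Pendant U {u, a, b, c} u w := by
  have hab := ha.adj_right
  have hbc := hb.adj_right
  have hcu := hc.adj_right
  have hua := ha.adj_left.symm
  have hsp := spans_fourCycle ha.ne hb.ne hua hab hbc hcu
  have hsub : ({u, a, b, c} : Finset V) ⊆ U := by
    simp [Finset.insert_subset_iff, ha.mem, hb.mem, hc.mem, ha.left_mem]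
  have h2 := hC.two_le_card_nb ha.left_mem
  have hac : ({a, c} : Finset V) ⊆ G.nb U u := by
    simp [Finset.insert_subset_iff, mem_nb, hua, hcu.symm, ha.mem, hc.mem]
  have hcard := Finset.card_sdiff_add_card_eq_card hac
  rw [Finset.card_pair hb.ne] at hcard
  have hexit : ∀ p ∈ ({u, a, b, c} : Finset V), ∀ q ∈ U, q ∉ ({u, a, b, c} : Finset V) →
      G.Adj p q → p = u ∧ q ∈ G.nb U u \ {a, c} := by
    intro p hp q hq hqR hpq
    simp only [Finset.mem_insert, Finset.mem_singleton, not_or] at hqR hp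
    rcases hp with rfl | rfl | rfl | rfl
    · simp [mem_nb, hq, hpq, hqR]
    · have := ha.eq_or hq hpq
      tauto
    · have := hb.eq_or hq hpq
      tauto
    · have := hc.eq_or hq hpq
      tauto
  have h3 : (G.nb U u).card ≠ 2 := by
    intro h
    have h0 : G.nb U u \ {a, c} = ∅ := Finset.card_eq_zero.1 (by omega)
    refine hC.not_spansEx (Or.inl ?_)
    rwa [← hC.conn {u, a, b, c} hsub (by simp)]
    intro p hp q hq hpq
    by_contra hqR
    simpa [h0] using (hexit p hp q hq hqR hpq).2
  have h4 : ¬ 4 ≤ (G.nb U u).card := hC.not_cycle_of_four_le ha hb hc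
  refine ⟨by omega, ?_⟩
  obtain ⟨w, hw⟩ := Finset.card_eq_one.1 (show (G.nb U u \ {a, c}).card = 1 by omega)
  have hw' : w ∈ G.nb U u \ {a, c} := by simp [hw]
  simp only [Finset.mem_sdiff, mem_nb, Finset.mem_insert, Finset.mem_singleton, not_or] at hw'
  refine ⟨w, hsub, hsp, by simp, hw'.1.1, ?_, hw'.1.2, ?_⟩
  · simp only [Finset.mem_insert, Finset.mem_singleton, not_or]
    refine ⟨hw'.1.2.ne.symm, hw'.2.1, ?_, hw'.2.2⟩
    rintro rfl
    rcases hb.eq_or ha.left_mem hw'.1.2.symm with h | h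
    · exact hua.ne h
    · exact hcu.ne h.symm
  · intro p hp q hq hqR hpq
    have := hexit p hp q hq hqR hpq
    rw [hw, Finset.mem_singleton] at this
    exact this

/-- An edge between two vertices of degree at least three is the exit of a pendant four-cycle. -/
theorem exists_pendant [Finite V] (hC : G.Critical S₀ U) (ha : a ∈ U) (hb : b ∈ U) (hab : G.Adj a b)
    (ha3 : 3 ≤ (G.nb U a).card) (hb3 : 3 ≤ (G.nb U b).card) :
    ∃ X, G.Pendant U X a b ∨ G.Pendant U X b a := by
  by_contra! hno
  set G' := G.deleteEdges {s(a, b)} with hG'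
  have hle : G' ≤ G := G.deleteEdges_le _
  have hadj : ∀ p q, G.Adj p q → (p = a ∧ q = b) ∨ (p = b ∧ q = a) ∨ G'.Adj p q := by
    intro p q hpq
    rw [hG', deleteEdges_adj]
    simp only [Set.mem_singleton_iff, Sym2.eq_iff]
    tauto
  -- The edge `ab` can be deleted, as each end keeps two neighbours, unless this creates an
  -- exceptional component; a solution would carry over to `G`.
  refine hC.unsolved ((hC.ih G' S₀ U ?_ ⟨hC.good.disj, ?_, ?_⟩).mono_graph hle)
  · refine Nat.add_lt_add_left (Set.ncard_lt_ncard ?_ (Set.toFinite _)) _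
    rw [Set.ssubset_iff_of_subset (edgeSet_subset_edgeSet.2 hle)]
    exact ⟨s(a, b), hab, by simp [hG']⟩
  · intro v hv
    right
    have key : ∀ x, (∀ q, G.Adj v q → q ≠ x → G'.Adj v q) →
        (G.nb U v).card ≤ (G'.nb U v).card + 1 := by
      intro x hx
      rw [← Nat.sub_le_iff_le_add]
      refine (Finset.pred_card_le_card_erase (a := x)).trans (Finset.card_le_card ?_)
      intro q hq
      rw [Finset.mem_erase, mem_nb] at hq
      exact mem_nb.2 ⟨hq.2.1, hx q hq.2.2 hq.1⟩
    by_cases hva : v = a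
    · subst hva
      have := key b fun q h1 h2 => by
        have := hadj _ _ h1
        have := hab.ne
        tauto
      omega
    by_cases hvb : v = b
    · subst hvb
      have := key a fun q h1 h2 => by
        have := hadj _ _ h1
        have := hab.ne
        tauto
      omega
    · refine (hC.two_le_card_nb hv).trans (Finset.card_le_card fun q hq => ?_)
      rw [mem_nb] at hq ⊢
      refine ⟨hq.1, ?_⟩
      have := hadj _ _ hq.2
      tauto
  · intro A hAU hcl hex
    exfalso
    have hexG := hex.mono hle
    have hAne : A ≠ U := by
      rintro rfl
      exact hC.not_spansEx hexG
    have hexit : ∀ p ∈ A, ∀ q ∈ U, q ∉ A → G.Adj p q → (p = a ∧ q = b) ∨ (p = b ∧ q = a) := by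
      intro p hp q hq hqA hpq
      rcases hadj p q hpq with h | h | h
      · exact Or.inl h
      · exact Or.inr h
      · exact absurd (hcl p hp q hq h) hqA
    obtain ⟨p, hp, q, hq, hqA, hpq⟩ := hC.exists_exit hAU hexG.nonempty hAne
    -- Only `ab` can leave `A`, so there is a single exit; this is ruled out unless `A` is spanned
    -- by a four-cycle.
    have hone : ∀ p' ∈ A, ∀ q' ∈ U, q' ∉ A → G.Adj p' q' → p' = p ∧ q' = q := by
      intro p' hp' q' hq' hqA' hpq'
      rcases hexit p hp q hq hqA hpq with ⟨rfl, rfl⟩ | ⟨rfl, rfl⟩ <;>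
      rcases hexit p' hp' q' hq' hqA' hpq' with ⟨rfl, rfl⟩ | ⟨rfl, rfl⟩ <;> simp_all
    rcases hexG with h4 | h2
    · have hP : G.Pendant U A p q := ⟨hAU, h4, hp, hq, hqA, hpq, hone⟩
      rcases hexit p hp q hq hqA hpq with ⟨rfl, rfl⟩ | ⟨rfl, rfl⟩
      · exact (hno A).1 hP
      · exact (hno A).2 hP
    · exact hC.not_spansTwo hAU h2 hp hq hqA hpq fun p' hp' q' hq' hqA' hpq' =>
        (hone p' hp' q' hq' hqA' hpq').2

end Critical

end Reductions
end SimpleGraph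

namespace SimpleGraph

/-! ### Replacing a path of length four by an edge. -/

section Shortening

variable {V : Type*} [DecidableEq V] {G H : SimpleGraph V} {S₀ S U : Finset V} {u v a b c : V}

/-- Replace the path `u a b c v` by the edge `uv`. -/
def shortcut (G : SimpleGraph V) (u v : V) (huv : u ≠ v) (K : Finset V) : SimpleGraph V where
  Adj p q := (G.Adj p q ∧ p ∉ K ∧ q ∉ K) ∨ (p = u ∧ q = v) ∨ (p = v ∧ q = u)
  symm := ⟨fun p q h => by
    rcases h with h | h | h
    · exact Or.inl ⟨h.1.symm, h.2.2, h.2.1⟩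
    · exact Or.inr (Or.inr h.symm)
    · exact Or.inr (Or.inl h.symm)⟩
  loopless := ⟨fun p h => by
    rcases h with h | ⟨rfl, h⟩ | ⟨rfl, h⟩
    · exact G.loopless.irrefl p h.1
    · exact huv h
    · exact huv h.symm⟩

theorem shortcut_comm {huv : u ≠ v} {K : Finset V} :
    G.shortcut u v huv K = G.shortcut v u huv.symm K := by
  ext p q
  simp only [shortcut]
  tauto

/-- With `u` in `S`, the new vertex `c` takes over the role that `u` had for `v`: a walk `p v u`
through the new edge becomes `p v c`. Of the path, `u` dominates `a`, and `c` the rest. -/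
theorem lift_of_mem (huv : u ≠ v) (hua : G.Adj u a) (hbc : G.Adj b c) (hcv : G.Adj c v)
    (hu : u ∉ ({a, b, c} : Finset V)) (hv : v ∉ ({a, b, c} : Finset V)) (huS : u ∈ S)
    (hS : ∀ p ∈ U \ {a, b, c}, (G.shortcut u v huv {a, b, c}).Dominated S p) :
    ∀ p ∈ U, G.Dominated (insert c S) p := by
  intro p hp
  by_cases hpK : p ∈ ({a, b, c} : Finset V)
  · simp only [Finset.mem_insert, Finset.mem_singleton] at hpK
    rcases hpK with rfl | rfl | rfl
    · exact .of_adj (Finset.mem_insert_of_mem huS) hua.symm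
    · exact .of_adj (Finset.mem_insert_self _ _) hbc
    · exact .of_mem (Finset.mem_insert_self _ _)
  have hnear : ∀ q ∈ S, (G.shortcut u v huv {a, b, c}).Near2 p q → G.Dominated (insert c S) p ∨
      q ∉ ({a, b, c} : Finset V) ∧ (G.Near2 p q ∨ q = u ∧ G.Near2 p c) := by
    rintro q hq ⟨m, h1, h2⟩
    by_cases hpu : p = u
    · exact Or.inl (.of_mem (Finset.mem_insert_of_mem (hpu ▸ huS)))
    by_cases hpv : p = v
    · exact Or.inl (.of_adj (Finset.mem_insert_self _ _) (hpv ▸ hcv.symm))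
    have hpm : G.Adj p m := by
      rcases h1 with h | h | h
      exacts [h.1, absurd h.1 hpu, absurd h.1 hpv]
    rcases h2 with ⟨hmq, -, hqK⟩ | ⟨h, -⟩ | ⟨h1, h2⟩
    · exact Or.inr ⟨hqK, Or.inl ⟨m, hpm, hmq⟩⟩
    · exact Or.inl (.of_adj (Finset.mem_insert_of_mem huS) (h ▸ hpm))
    · exact Or.inr ⟨h2 ▸ hu, Or.inr ⟨h2, m, hpm, h1 ▸ hcv.symm⟩⟩
  rcases hS p (Finset.mem_sdiff.2 ⟨hp, hpK⟩) with h | ⟨q, hq, h⟩ | ⟨q, hq, r, hr, hne, h1, h2⟩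
  · exact .of_mem (Finset.mem_insert_of_mem h)
  · rcases h with ⟨h, -, -⟩ | ⟨rfl, rfl⟩ | ⟨rfl, rfl⟩
    · exact .of_adj (Finset.mem_insert_of_mem hq) h
    · exact .of_mem (Finset.mem_insert_of_mem huS)
    · exact .of_adj (Finset.mem_insert_self _ _) hcv.symm
  · rcases hnear q hq h1 with h | ⟨hqK, hq'⟩
    · exact h
    rcases hnear r hr h2 with h | ⟨hrK, hr'⟩
    · exact h
    -- `S` may contain vertices of the removed path, but these are isolated in the shortened graph
    -- and never serve as dominators there.
    have hqc : q ≠ c := by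
      rintro rfl
      simp at hqK
    have hrc : r ≠ c := by
      rintro rfl
      simp at hrK
    rcases hq' with hq' | ⟨rfl, hq'⟩
    · rcases hr' with hr' | ⟨rfl, hr'⟩
      · exact .of_near (Finset.mem_insert_of_mem hq) (Finset.mem_insert_of_mem hr) hne hq' hr'
      · exact .of_near (Finset.mem_insert_of_mem hq) (Finset.mem_insert_self _ _) hqc hq' hr'
    · rcases hr' with hr' | ⟨rfl, hr'⟩
      · exact .of_near (Finset.mem_insert_self _ _) (Finset.mem_insert_of_mem hr) hrc.symm hq' hr'
      · exact absurd rfl hne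

/-- Outside the ends of the path, domination is not affected when the ends are not in `S`. -/
theorem lift_other {huv : u ≠ v} {K : Finset V} (huS : u ∉ S) (hvS : v ∉ S) {p : V} (hpu : p ≠ u)
    (hpv : p ≠ v) (h : (G.shortcut u v huv K).Dominated S p) : G.Dominated S p := by
  have hadj : ∀ q ∈ S, ∀ m, (G.shortcut u v huv K).Adj m q → G.Adj m q := by
    rintro q hq m (h | ⟨rfl, rfl⟩ | ⟨rfl, rfl⟩)
    · exact h.1
    · exact absurd hq hvS
    · exact absurd hq huS
  have hp : ∀ q, (G.shortcut u v huv K).Adj p q → G.Adj p q := by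
    rintro q (h | ⟨rfl, rfl⟩ | ⟨rfl, rfl⟩)
    · exact h.1
    · exact absurd rfl hpu
    · exact absurd rfl hpv
  rcases h with h | ⟨q, hq, h⟩ | ⟨q, hq, r, hr, hne, ⟨m, h1, h2⟩, n, h3, h4⟩
  · exact .of_mem h
  · exact .of_adj hq (hp q h)
  · exact .of_near hq hr hne ⟨m, hp m h1, hadj q hq m h2⟩ ⟨n, hp n h3, hadj r hr n h4⟩

/-- The new vertex `a` covers `u` and `b`, while `z` covers `v`. The vertex `c` is two steps from
both `a` and `z`. -/
theorem lift_of_adj {huv : u ≠ v} (hua : G.Adj u a) (hab : G.Adj a b) (hbc : G.Adj b c)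
    (hcv : G.Adj c v) (huS : u ∉ S) (hvS : v ∉ S) {z : V} (hz : z ∈ S)
    (hvz : (G.shortcut u v huv {a, b, c}).Adj v z)
    (hS : ∀ p ∈ U \ {a, b, c}, (G.shortcut u v huv {a, b, c}).Dominated S p) :
    ∀ p ∈ U, G.Dominated (insert a S) p := by
  obtain ⟨hvz', -, hzK⟩ : G.Adj v z ∧ v ∉ ({a, b, c} : Finset V) ∧ z ∉ ({a, b, c} : Finset V) := by
    rcases hvz with h | ⟨rfl, h⟩ | ⟨-, rfl⟩
    · exact h
    · exact absurd rfl huv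
    · exact absurd hz huS
  have hza : z ≠ a := by
    rintro rfl
    simp at hzK
  intro p hp
  by_cases hpK : p ∈ ({a, b, c} : Finset V)
  · simp only [Finset.mem_insert, Finset.mem_singleton] at hpK
    rcases hpK with rfl | rfl | rfl
    · exact .of_mem (Finset.mem_insert_self _ _)
    · exact .of_adj (Finset.mem_insert_self _ _) hab.symm
    · exact .of_near (Finset.mem_insert_of_mem hz) (Finset.mem_insert_self _ _) hza ⟨v, hcv, hvz'⟩
        ⟨b, hbc.symm, hab.symm⟩
  by_cases hpu : p = u
  · exact .of_adj (Finset.mem_insert_self _ _) (hpu ▸ hua)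
  by_cases hpv : p = v
  · exact .of_adj (Finset.mem_insert_of_mem hz) (hpv ▸ hvz')
  exact (lift_other huS hvS hpu hpv (hS p (Finset.mem_sdiff.2 ⟨hp, hpK⟩))).mono
    (Finset.subset_insert _ _)

/-- When neither end has a neighbour in `S`, no two-step walk from an end to `S` uses the new edge,
so the ends are dominated as before and `b` covers the path. -/
theorem lift_of_not_adj {huv : u ≠ v} (hab : G.Adj a b) (hbc : G.Adj b c)
    (huS : u ∉ S) (hvS : v ∉ S) (hv : ∀ z ∈ S, ¬ (G.shortcut u v huv {a, b, c}).Adj v z)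
    (hu : ∀ z ∈ S, ¬ (G.shortcut u v huv {a, b, c}).Adj u z)
    (hS : ∀ p ∈ U \ {a, b, c}, (G.shortcut u v huv {a, b, c}).Dominated S p) :
    ∀ p ∈ U, G.Dominated (insert b S) p := by
  intro p hp
  by_cases hpK : p ∈ ({a, b, c} : Finset V)
  · simp only [Finset.mem_insert, Finset.mem_singleton] at hpK
    rcases hpK with rfl | rfl | rfl
    · exact .of_adj (Finset.mem_insert_self _ _) hab
    · exact .of_mem (Finset.mem_insert_self _ _)
    · exact .of_adj (Finset.mem_insert_self _ _) hbc.symm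
  have hp' := hS p (Finset.mem_sdiff.2 ⟨hp, hpK⟩)
  refine Dominated.mono ?_ (Finset.subset_insert _ _)
  by_cases hpuv : p = u ∨ p = v
  · have hnear : ∀ q ∈ S, (G.shortcut u v huv {a, b, c}).Near2 p q → G.Near2 p q := by
      rintro q hq ⟨m, h1, h2⟩
      have hmu : m ≠ u := by
        rintro rfl
        exact hu q hq h2
      have hmv : m ≠ v := by
        rintro rfl
        exact hv q hq h2
      refine ⟨m, ?_, ?_⟩
      · rcases h1 with h | ⟨-, h⟩ | ⟨-, h⟩
        exacts [h.1, absurd h hmv, absurd h hmu]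
      · rcases h2 with h | ⟨h, -⟩ | ⟨h, -⟩
        exacts [h.1, absurd h hmu, absurd h hmv]
    rcases hp' with h | ⟨q, hq, h⟩ | ⟨q, hq, r, hr, hne, h1, h2⟩
    · exact .of_mem h
    · rcases hpuv with rfl | rfl
      · exact absurd h (hu q hq)
      · exact absurd h (hv q hq)
    · exact .of_near hq hr hne (hnear q hq h1) (hnear r hr h2)
  · push Not at hpuv
    exact lift_other huS hvS hpuv.1 hpuv.2 hp'

/-- The one additional vertex is paid for by the three path vertices restored. Which of them it is
depends on how `S` meets the two ends and their neighbourhoods. -/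
theorem exists_lift {huv : u ≠ v} (hua : G.Adj u a) (hab : G.Adj a b) (hbc : G.Adj b c)
    (hcv : G.Adj c v) (hu : u ∉ ({a, b, c} : Finset V)) (hv : v ∉ ({a, b, c} : Finset V))
    (hS : ∀ p ∈ U \ {a, b, c}, (G.shortcut u v huv {a, b, c}).Dominated S p) :
    ∃ s, ∀ p ∈ U, G.Dominated (insert s S) p := by
  have hK : ({c, b, a} : Finset V) = {a, b, c} := by
    ext
    simp
    tauto
  have hcomm : G.shortcut v u huv.symm {c, b, a} = G.shortcut u v huv {a, b, c} := by
    rw [hK, shortcut_comm]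
  by_cases huS : u ∈ S
  · exact ⟨c, lift_of_mem huv hua hbc hcv hu hv huS hS⟩
  by_cases hvS : v ∈ S
  · exact ⟨a, lift_of_mem huv.symm hcv.symm hab.symm hua.symm (hK ▸ hv) (hK ▸ hu) hvS
      (by rwa [hcomm, hK])⟩
  by_cases hvz : ∃ z ∈ S, (G.shortcut u v huv {a, b, c}).Adj v z
  · obtain ⟨z, hz, hvz⟩ := hvz
    exact ⟨a, lift_of_adj hua hab hbc hcv huS hvS hz hvz hS⟩
  by_cases huz : ∃ z ∈ S, (G.shortcut u v huv {a, b, c}).Adj u z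
  · obtain ⟨z, hz, huz⟩ := huz
    exact ⟨c, lift_of_adj (huv := huv.symm) hcv.symm hbc.symm hab.symm hua.symm hvS huS hz
      (by rwa [hcomm]) (by rwa [hcomm, hK])⟩
  push Not at hvz huz
  exact ⟨b, lift_of_not_adj hab hbc huS hvS hvz huz hS⟩

namespace Critical

/-- Three consecutive vertices of degree two cannot be bypassed. -/
theorem not_path [Finite V] (hC : G.Critical S₀ U) (ha : G.Mid U u a b) (hb : G.Mid U a b c)
    (hc : G.Mid U b c v) (huv : u ≠ v) (hnadj : ¬ G.Adj u v) : False := by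
  have hua := ha.adj_left.symm
  have hab := ha.adj_right
  have hbc := hb.adj_right
  have hcv := hc.adj_right
  have hu : u ∉ ({a, b, c} : Finset V) := by
    simp only [Finset.mem_insert, Finset.mem_singleton, not_or]
    refine ⟨hua.ne, ha.ne, ?_⟩
    rintro rfl
    rcases hc.eq_or ha.mem hua with h | rfl
    · exact hab.ne h
    · exact hnadj hua
  have hv : v ∉ ({a, b, c} : Finset V) := by
    simp only [Finset.mem_insert, Finset.mem_singleton, not_or]
    refine ⟨?_, hc.ne.symm, hcv.ne.symm⟩
    rintro rfl
    exact hnadj hua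
  set K : Finset V := {a, b, c} with hK
  have hKU : K ⊆ U := by simp [hK, Finset.insert_subset_iff, ha.mem, hb.mem, hc.mem]
  have hKcard : K.card = 3 := Finset.card_eq_three.2 ⟨a, b, c, hab.ne, hb.ne, hbc.ne, rfl⟩
  have hexit : ∀ w ∈ U, w ∉ K → ∀ r ∈ K, G.Adj w r → (w = u ∧ r = a) ∨ (w = v ∧ r = c) := by
    intro w hw hwK r hr hwr
    simp only [hK, Finset.mem_insert, Finset.mem_singleton, not_or] at hwK hr
    rcases hr with rfl | rfl | rfl
    · have := ha.eq_or hw hwr.symm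
      tauto
    · have := hb.eq_or hw hwr.symm
      tauto
    · have := hc.eq_or hw hwr.symm
      tauto
  have hcardU := Finset.card_sdiff_add_card_eq_card hKU
  set G' := G.shortcut u v huv K with hG'
  have hle : ∀ {p q}, G.Adj p q → p ∉ K → q ∉ K → G'.Adj p q := fun h1 h2 h3 => Or.inl ⟨h1, h2, h3⟩
  have huv' : G'.Adj u v := Or.inr (Or.inl ⟨rfl, rfl⟩)
  have hgood : G'.Good S₀ (U \ K) := by
    refine ⟨hC.good.disj.mono_right Finset.sdiff_subset, fun w hw => Or.inr ?_, ?_⟩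
    · obtain ⟨hw, hwK⟩ := Finset.mem_sdiff.1 hw
      -- An end exchanges its path neighbour `x` for the other end `y`. This keeps its degree
      -- because `y` was not a neighbour before.
      have hend : ∀ x y, y ∈ U → y ∉ K → G'.Adj w y → ¬ G.Adj w y →
          (∀ r ∈ K, G.Adj w r → r = x) → 2 ≤ (G'.nb (U \ K) w).card := by
        intro x y hyU hyK hwy hnwy hx
        have hsub : insert y ((G.nb U w).erase x) ⊆ G'.nb (U \ K) w := by
          intro q hq
          simp only [Finset.mem_insert, Finset.mem_erase, mem_nb] at hq
          rw [mem_nb, Finset.mem_sdiff]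
          rcases hq with rfl | ⟨hqx, hqU, hwq⟩
          · exact ⟨⟨hyU, hyK⟩, hwy⟩
          · have hqK : q ∉ K := fun h => hqx (hx q h hwq)
            exact ⟨⟨hqU, hqK⟩, hle hwq hwK hqK⟩
        have h1 := Finset.card_le_card hsub
        rw [Finset.card_insert_of_notMem (by simp [mem_nb, hnwy])] at h1
        have h2 := Finset.pred_card_le_card_erase (a := x) (s := G.nb U w)
        have h3 := hC.two_le_card_nb hw
        omega
      by_cases hwu : w = u
      · subst hwu
        refine hend a v hc.right_mem hv huv' hnadj fun r hr hwr => ?_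
        rcases hexit w hw hwK r hr hwr with h | h
        · exact h.2
        · exact absurd h.1 huv
      by_cases hwv : w = v
      · subst hwv
        refine hend c u ha.left_mem hu huv'.symm (fun h => hnadj h.symm) fun r hr hwr => ?_
        rcases hexit w hw hwK r hr hwr with h | h
        · exact absurd h.1 huv.symm
        · exact h.2
      · refine (hC.two_le_card_nb hw).trans (Finset.card_le_card fun q hq => ?_)
        rw [mem_nb] at hq
        have hqK : q ∉ K := fun h => by
          have := hexit w hw hwK q h hq.2
          tauto
        exact mem_nb.2 ⟨Finset.mem_sdiff.2 ⟨hq.1, hqK⟩, hle hq.2 hwK hqK⟩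
    · intro A hAU hcl hex
      exfalso
      have hAU' : A ⊆ U := hAU.trans Finset.sdiff_subset
      have hAK : ∀ r ∈ K, r ∉ A := fun r hr h => (Finset.mem_sdiff.1 (hAU h)).2 hr
      have huU : u ∈ U \ K := Finset.mem_sdiff.2 ⟨ha.left_mem, hu⟩
      have hvU : v ∈ U \ K := Finset.mem_sdiff.2 ⟨hc.right_mem, hv⟩
      have hstep : ∀ p ∈ A, ∀ q ∈ U, q ∉ K → G.Adj p q → q ∈ A := fun p hp q hq hqK hpq =>
        hcl p hp q (Finset.mem_sdiff.2 ⟨hq, hqK⟩) (hle hpq (fun h => hAK p h hp) hqK)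
      -- An exceptional piece containing `u` contains `v` too, so `U` arises from it by putting the
      -- path back, which makes it solvable. A piece avoiding both ends would be closed already in
      -- `G`.
      by_cases huA : u ∈ A
      · have hvA := hcl u huA v hvU huv'
        have hU : A ∪ K = U := by
          refine hC.conn _ (Finset.union_subset hAU' hKU) (by simp [hK]) ?_
          intro p hp q hq hpq
          by_cases hqK : q ∈ K
          · exact Finset.mem_union_right _ hqK
          refine Finset.mem_union_left _ ?_
          rcases Finset.mem_union.1 hp with hp | hp
          · exact hstep p hp q hq hqK hpq
          · rcases hexit q hq hqK p hp hpq.symm with h | h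
            · exact h.1 ▸ huA
            · exact h.1 ▸ hvA
        refine hC.unsolved (hU ▸ hex.solve_path ?_ huA hvA huv (hAK a (by simp [hK]))
          (hAK b (by simp [hK])) (hAK c (by simp [hK])) hab.ne hb.ne hbc.ne hua hab hbc hcv)
        rintro p q (h | h | h)
        · exact Or.inl h.1
        · exact Or.inr (Or.inl h)
        · exact Or.inr (Or.inr h)
      · have hvA : v ∉ A := fun h => huA (hcl v h u huU huv'.symm)
        have : A = U := by
          refine hC.conn A hAU' hex.nonempty fun p hp q hq hpq => hstep p hp q hq (fun hqK => ?_) hpq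
          rcases hexit p (hAU' hp) (fun h => hAK p h hp) q hqK hpq with h | h
          · exact huA (h.1 ▸ hp)
          · exact hvA (h.1 ▸ hp)
        exact hAK a (by simp [hK]) (this ▸ ha.mem)
  -- Three vertices go and at most one edge is gained.
  have hmeasure : (U \ K).card + G'.edgeSet.ncard < U.card + G.edgeSet.ncard := by
    have hsub : G'.edgeSet ⊆ insert s(u, v) G.edgeSet := by
      intro e he
      induction e with
      | _ p q =>
        rcases he with h | ⟨rfl, rfl⟩ | ⟨rfl, rfl⟩
        · exact Set.mem_insert_of_mem _ h.1
        · exact Set.mem_insert _ _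
        · rw [Sym2.eq_swap]
          exact Set.mem_insert _ _
    have h1 := Set.ncard_le_ncard hsub (Set.toFinite _)
    have h2 := Set.ncard_insert_le s(u, v) G.edgeSet
    omega
  obtain ⟨S, h1, h2⟩ := hC.ih G' S₀ (U \ K) hmeasure hgood
  obtain ⟨s, hs⟩ := exists_lift hua hab hbc hcv hu hv h2
  refine hC.unsolved ⟨insert s S, ?_, fun p hp => ?_⟩
  · have := Finset.card_insert_le s S
    omega
  · rw [Finset.union_insert]
    exact hs p hp

end Critical

end Shortening
end SimpleGraph

namespace SimpleGraph

/-! ### Core vertices and the items attached to them. -/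

section Core

variable {V : Type*} [DecidableEq V] {G H : SimpleGraph V} {S₀ S₁ U R R' T T' A X Y : Finset V}
  {a b c u v f g h k x w : V}

theorem spans_fiveCycle {a b c d e : V} (hac : a ≠ c) (had : a ≠ d) (hbd : b ≠ d) (hbe : b ≠ e)
    (hce : c ≠ e) (hab : G.Adj a b) (hbc : G.Adj b c) (hcd : G.Adj c d) (hde : G.Adj d e)
    (hea : G.Adj e a) : G.Spans fiveCycle {a, b, c, d, e} := by
  have := Spans.of_list (G := G) (b := fiveCycle) [a, b, c, d, e] a rfl
    (by simp [hac, had, hbd, hbe, hce, hab.ne, hbc.ne, hcd.ne, hde.ne, hea.ne.symm])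
    (by simp [fiveCycle, hab, hbc, hcd, hde, hea])
  simpa using this

/-- One vertex dominates a four-cycle together with a source close to the opposite vertex. -/
theorem Spans.exists_opposite (hX : G.Spans fourCycle X) (hx : x ∈ X) :
    ∃ o ∈ X, ∀ S : Finset V, ∀ s ∈ S, o ∈ S → s ∉ X → (G.Adj x s ∨ G.Near2 x s) →
      ∀ p ∈ X, G.Dominated S p := by
  obtain ⟨b, c, d, hxc, hbd, hxb, hbc, hcd, hdx, rfl⟩ := hX.exists_cycle hx
  refine ⟨c, by simp, fun S s hs hc hsX hxs p hp => ?_⟩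
  simp only [Finset.mem_insert, Finset.mem_singleton, not_or] at hp hsX
  rcases hp with rfl | rfl | rfl | rfl
  · rcases hxs with h | h
    · exact .of_adj hs h
    · exact .of_near hs hc hsX.2.2.1 h ⟨b, hxb, hbc⟩
  · exact .of_adj hc hbc
  · exact .of_mem hc
  · exact .of_adj hc hcd.symm

theorem Spans.connected (hX : G.Spans fourCycle X) {B : Finset V} (hB : B ⊆ X) (hne : B.Nonempty)
    (hcl : G.ClosedIn X B) : B = X := by
  obtain ⟨x, hx⟩ := hne
  obtain ⟨b, c, d, hxc, hbd, hxb, hbc, hcd, hdx, rfl⟩ := hX.exists_cycle (hB hx)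
  have hb := hcl x hx b (by simp) hxb
  have hc := hcl b hb c (by simp) hbc
  have hd := hcl c hc d (by simp) hcd
  exact hB.antisymm (by simp [Finset.insert_subset_iff, hx, hb, hc, hd])

theorem Pendant.mem_of_mid (hX : G.Pendant U X x w) (hf : G.Mid U v f g) (hfX : f ∈ X) :
    v ∈ X ∧ g ∈ X := by
  obtain ⟨b, c, d, hxc, hbd, hxb, hbc, hcd, hdx, hX'⟩ := hX.spans.exists_cycle hfX
  have hb : b ∈ X := by simp [hX']
  have hd : d ∈ X := by simp [hX']
  have h1 := hf.eq_or (hX.sub hb) hxb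
  have h2 := hf.eq_or (hX.sub hd) hdx.symm
  rcases h1 with rfl | rfl <;> rcases h2 with rfl | rfl <;> first | exact absurd rfl hbd | tauto

/-- `v` has degree at least three and lies in no pendant four-cycle. -/
structure Core (G : SimpleGraph V) (U : Finset V) (v : V) : Prop where
  mem : v ∈ U
  card : 3 ≤ (G.nb U v).card
  notMem : ∀ X x w, G.Pendant U X x w → v ∉ X

/-- A connected set `R` that is attached only to the core vertex `v`, which has at least two
further neighbours, and is dominated by `v` together with the set `T`. -/
structure Item (G : SimpleGraph V) (U : Finset V) (v : V) (R T : Finset V) : Prop where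
  sub : R ⊆ U
  notMem : v ∉ R
  subset : T ⊆ R
  card : R.card = 3 * T.card + 1
  dom : ∀ r ∈ R, G.Dominated (insert v T) r
  exit : ∀ r ∈ R, ∀ q ∈ U, q ∉ R → G.Adj r q → q = v
  conn : ∀ B ⊆ R, B.Nonempty → G.ClosedIn R B → B = R
  not_core : ∀ r ∈ R, ¬ G.Core U r
  deg : (G.nb U v ∩ R).card + 2 ≤ (G.nb U v).card

namespace Critical

/-- If `w` had just one further neighbour `y`, the six vertices of `X`, `w` and `y` could be deleted
at the price of `y` and the vertex opposite `x`: both are two steps from `x`, and all exits are at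
`y`. -/
theorem three_le_of_pendant (hC : G.Critical S₀ U) (hX : G.Pendant U X x w) :
    3 ≤ (G.nb U w).card := by
  by_contra! hlt
  have h2 := hC.two_le_card_nb hX.memU
  obtain ⟨y, hw⟩ := exists_mid hX.memU (hX.sub hX.mem) hX.adj.symm (by omega)
  obtain ⟨o, ho, hdom⟩ := hX.spans.exists_opposite hX.mem
  have hyX : y ∉ X := fun hy =>
    hw.ne (hX.exit y hy w hX.memU hX.notMem hw.adj_right.symm).1.symm
  have hwy := hw.adj_right.ne
  refine hC.remove_of_exit (R := insert w (insert y X)) (S₁ := {o, y}) ?_ (by simp) ?_ ?_ ?_ ?_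
  · simp [Finset.insert_subset_iff, hX.sub, hX.memU, hw.right_mem]
  · simp [Finset.insert_subset_iff, ho]
  · rw [Finset.card_insert_of_notMem (s := insert y X) (by simp [hwy, hX.notMem]),
      Finset.card_insert_of_notMem hyX, hX.spans.card]
    have : ({o, y} : Finset V).card ≤ 2 := Finset.card_le_two
    change _ ≤ 4 + 1 + 1
    omega
  · intro p hp
    simp only [Finset.mem_insert] at hp
    rcases hp with rfl | rfl | hp
    · exact .of_adj (u := y) (by simp) hw.adj_right
    · exact .of_mem (by simp)
    · exact hdom _ y (by simp) (by simp) hyX (Or.inr ⟨w, hX.adj, hw.adj_right⟩) p hp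
  · intro p hp hpR r hr hpr
    simp only [Finset.mem_insert, not_or] at hr hpR
    rcases hr with rfl | rfl | hr
    · rcases hw.eq_or hp hpr.symm with rfl | rfl
      · exact absurd hX.mem hpR.2.2
      · exact absurd rfl hpR.2.1
    · exact ⟨r, by simp, hpr⟩
    · exact absurd (hX.exit r hr p hp hpR.2.2 hpr.symm).2 hpR.1

/-- A vertex of degree two with a neighbour in a pendant four-cycle belongs to it. -/
theorem mem_pendant (hC : G.Critical S₀ U) (hX : G.Pendant U X x w) (hf : G.Mid U v f g)
    {p : V} (hp : p ∈ X) (hpf : G.Adj p f) : f ∈ X := by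
  by_contra hfX
  obtain ⟨-, rfl⟩ := hX.exit p hp f hf.mem hfX hpf
  have := hC.three_le_of_pendant hX
  have := hf.card
  omega

theorem exists_mid_or (hC : G.Critical S₀ U) (hf : f ∈ U) (hv : v ∈ U) (hfv : G.Adj f v) :
    3 ≤ (G.nb U f).card ∨ ∃ g, G.Mid U v f g := by
  by_cases h3 : 3 ≤ (G.nb U f).card
  · exact Or.inl h3
  · have := hC.two_le_card_nb hf
    exact Or.inr (exists_mid hf hv hfv (by omega))

theorem item_of_pendant (hC : G.Critical S₀ U) (hX : G.Pendant U X x v) :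
    ∃ T, G.Item U v X T := by
  obtain ⟨o, ho, hdom⟩ := hX.spans.exists_opposite hX.mem
  refine ⟨{o}, hX.sub, hX.notMem, by simpa using ho, by rw [hX.spans.card]; rfl, ?_, ?_, ?_, ?_, ?_⟩
  · exact hdom _ v (by simp) (by simp) hX.notMem (Or.inl hX.adj)
  · exact fun r hr q hq hqX hrq => (hX.exit r hr q hq hqX hrq).2
  · exact fun B hB hne hcl => hX.spans.connected hB hne hcl
  · exact fun r hr hcore => hcore.notMem X x v hX hr
  · have h3 := hC.three_le_of_pendant hX
    have : G.nb U v ∩ X ⊆ {x} := by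
      intro q hq
      rw [Finset.mem_inter, mem_nb] at hq
      rw [Finset.mem_singleton]
      exact (hX.exit q hq.2 v hX.memU hX.notMem hq.1.2.symm).1
    have := Finset.card_le_card this
    rw [Finset.card_singleton] at this
    omega

/-- The vertex `g` covers `f` and `h`, and `v` covers `k`. If `v` had degree three, the five-cycle
would be a set of order 2 modulo 3 with a single exit; so `v` has two neighbours to spare. -/
theorem item_of_cycle (hC : G.Critical S₀ U) (hv : 3 ≤ (G.nb U v).card) (hf : G.Mid U v f g)
    (hg : G.Mid U f g h) (hh : G.Mid U g h k) (hk : G.Mid U h k v) :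
    ∃ T, G.Item U v {f, g, h, k} T := by
  have hvf := hf.adj_left.symm
  have hfg := hf.adj_right
  have hgh := hg.adj_right
  have hhk := hh.adj_right
  have hkv := hk.adj_right
  have hvg := hf.ne
  have hfh := hg.ne
  have hgk := hh.ne
  have hhv := hk.ne
  have hfk : f ≠ k := by
    rintro rfl
    rcases hk.eq_or hf.right_mem hfg with h | h
    · exact hgh.ne h
    · exact hvg h.symm
  have hexit : ∀ r ∈ ({f, g, h, k} : Finset V), ∀ q ∈ U, q ∉ ({f, g, h, k} : Finset V) →
      G.Adj r q → q = v := by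
    intro r hr q hq hqR hrq
    simp only [Finset.mem_insert, Finset.mem_singleton, not_or] at hqR hr
    rcases hr with rfl | rfl | rfl | rfl
    · have := hf.eq_or hq hrq
      tauto
    · have := hg.eq_or hq hrq
      tauto
    · have := hh.eq_or hq hrq
      tauto
    · have := hk.eq_or hq hrq
      tauto
  have hsub : ({f, g, h, k} : Finset V) ⊆ U := by
    simp [Finset.insert_subset_iff, hf.mem, hg.mem, hh.mem, hk.mem]
  have hvR : v ∉ ({f, g, h, k} : Finset V) := by
    simp [hvf.ne, hvg, hhv.symm, hkv.ne.symm]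
  have hfk' : ({f, k} : Finset V) ⊆ G.nb U v := by
    simp [Finset.insert_subset_iff, mem_nb, hvf, hkv.symm, hf.mem, hk.mem]
  have hcard := Finset.card_sdiff_add_card_eq_card hfk'
  rw [Finset.card_pair hfk] at hcard
  have hfour : 4 ≤ (G.nb U v).card := by
    by_contra! h4
    obtain ⟨w, hw⟩ := Finset.card_eq_one.1 (show (G.nb U v \ {f, k}).card = 1 by omega)
    have hw' : w ∈ G.nb U v \ {f, k} := by simp [hw]
    simp only [Finset.mem_sdiff, mem_nb, Finset.mem_insert, Finset.mem_singleton, not_or] at hw'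
    obtain ⟨⟨hwU, hvw⟩, hwf, hwk⟩ := hw'
    have hwR : w ∉ ({f, g, h, k} : Finset V) := by
      simp only [Finset.mem_insert, Finset.mem_singleton, not_or]
      refine ⟨hwf, ?_, ?_, hwk⟩
      · rintro rfl
        rcases hg.eq_or hf.left_mem hvw.symm with h | h
        · exact hvf.ne h
        · exact hhv h.symm
      · rintro rfl
        rcases hh.eq_or hf.left_mem hvw.symm with h | h
        · exact hvg h
        · exact hkv.ne h.symm
    refine hC.not_spansTwo (X := {v, f, g, h, k}) (x := v) (w := w) ?_ ⟨fiveCycle, by decide,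
      spans_fiveCycle hvg hhv.symm hfh hfk hgk hvf hfg hgh hhk hkv⟩ (by simp) hwU ?_ hvw ?_
    · exact Finset.insert_subset hf.left_mem hsub
    · rw [Finset.mem_insert, not_or]
      exact ⟨hvw.ne.symm, hwR⟩
    · intro p hp q hq hqX hpq
      rw [Finset.mem_insert, not_or] at hqX
      rcases Finset.mem_insert.1 hp with rfl | hp
      · have : q ∈ G.nb U p \ {f, k} := by
          have := hqX.2
          simp only [Finset.mem_insert, Finset.mem_singleton, not_or] at this
          simp [mem_nb, hq, hpq, this]
        rwa [hw, Finset.mem_singleton] at this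
      · exact absurd (hexit p hp q hq hqX.2 hpq) hqX.1
  refine ⟨{g}, hsub, hvR, by simp, ?_, ?_, hexit, ?_, ?_, ?_⟩
  · rw [Finset.card_eq_of_equiv_fin (n := 4)]
    · simp
    · refine Finset.equivFinOfCardEq ?_
      rw [Finset.card_insert_of_notMem (by simp [hfg.ne, hfh, hfk]),
        Finset.card_eq_three.2 ⟨g, h, k, hgh.ne, hgk, hhk.ne, rfl⟩]
  · intro r hr
    simp only [Finset.mem_insert, Finset.mem_singleton] at hr
    rcases hr with rfl | rfl | rfl | rfl
    · exact .of_adj (u := g) (by simp) hfg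
    · exact .of_mem (by simp)
    · exact .of_adj (u := g) (by simp) hgh.symm
    · exact .of_adj (u := v) (by simp) hkv
  · intro B hB hne hcl
    have h1 : f ∈ B ↔ g ∈ B := ⟨fun h => hcl f h g (by simp) hfg, fun h => hcl g h f (by simp) hfg.symm⟩
    have h2 : g ∈ B ↔ h ∈ B :=
      ⟨fun h' => hcl g h' h (by simp) hgh, fun h' => hcl h h' g (by simp) hgh.symm⟩
    have h3 : h ∈ B ↔ k ∈ B :=
      ⟨fun h' => hcl h h' k (by simp) hhk, fun h' => hcl k h' h (by simp) hhk.symm⟩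
    obtain ⟨p, hp⟩ := hne
    have hf' : f ∈ B := by
      have := hB hp
      simp only [Finset.mem_insert, Finset.mem_singleton] at this
      rcases this with rfl | rfl | rfl | rfl <;> tauto
    exact hB.antisymm (by simp [Finset.insert_subset_iff, ← h3, ← h2, ← h1, hf'])
  · intro r hr hcore
    have := hcore.card
    have := hf.card
    have := hg.card
    have := hh.card
    have := hk.card
    simp only [Finset.mem_insert, Finset.mem_singleton] at hr
    rcases hr with rfl | rfl | rfl | rfl <;> omega
  · have : G.nb U v ∩ {f, g, h, k} ⊆ {f, k} := by
      intro q hq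
      simp only [Finset.mem_inter, mem_nb, Finset.mem_insert, Finset.mem_singleton] at hq ⊢
      obtain ⟨⟨hq, hvq⟩, rfl | rfl | rfl | rfl⟩ := hq
      · simp
      · rcases hg.eq_or hf.left_mem hvq.symm with h | h
        · exact absurd h hvf.ne
        · exact absurd h hhv.symm
      · rcases hh.eq_or hf.left_mem hvq.symm with h | h
        · exact absurd h hvg
        · exact absurd h hkv.ne.symm
      · simp
    have := (Finset.card_le_card this).trans Finset.card_le_two
    omega

/-- Two large core vertices with a common neighbour of degree two are not adjacent. -/
theorem not_adj_of_mid [Finite V] (hC : G.Critical S₀ U) (hv : G.Core U v) (hf : G.Mid U v f g)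
    (hg : 3 ≤ (G.nb U g).card) : ¬ G.Adj v g := by
  intro hvg
  obtain ⟨X, hX | hX⟩ := hC.exists_pendant hv.mem hf.right_mem hvg hv.card hg
  · exact hv.notMem X _ _ hX hX.mem
  · exact hX.notMem (hX.mem_of_mid hf (hC.mem_pendant hX hf hX.mem hf.adj_right.symm)).1

/-- A pendant four-cycle through `g` would contain its degree-two neighbour `f`, and hence `v`. -/
theorem core_of_mid (hC : G.Critical S₀ U) (hv : G.Core U v) (hf : G.Mid U v f g)
    (hg : 3 ≤ (G.nb U g).card) : G.Core U g := by
  refine ⟨hf.right_mem, hg, fun X x w hX hgX => hv.notMem X x w hX ?_⟩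
  exact (hX.mem_of_mid hf (hC.mem_pendant hX hf hgX hf.adj_right.symm)).1

/-- A neighbour of a core vertex that has degree at least three belongs to an item. -/
theorem exists_item_of_adj [Finite V] (hC : G.Critical S₀ U) (hv : G.Core U v) (hf : f ∈ U)
    (hvf : G.Adj v f) (hf3 : 3 ≤ (G.nb U f).card) : ∃ R T, G.Item U v R T ∧ f ∈ R := by
  obtain ⟨X, hX | hX⟩ := hC.exists_pendant hv.mem hf hvf hv.card hf3
  · exact absurd hX.mem (hv.notMem X _ _ hX)
  · obtain ⟨T, hT⟩ := hC.item_of_pendant hX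
    exact ⟨X, T, hT, hX.mem⟩

/-- Inside `R` no edge leaves `R ∩ R'`, since it would end at `v`, which is not in `R`;
connectedness does the rest. -/
theorem item_eq_of_mem (h1 : G.Item U v R T) (h2 : G.Item U v R' T') (hx : x ∈ R) (hx' : x ∈ R') :
    R = R' := by
  have key : ∀ {R R' T T' : Finset V}, G.Item U v R T → G.Item U v R' T' → x ∈ R → x ∈ R' →
      R ⊆ R' := by
    intro R R' T T' h1 h2 hx hx'
    rw [← h1.conn (R ∩ R') Finset.inter_subset_left ⟨x, Finset.mem_inter.2 ⟨hx, hx'⟩⟩]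
    · exact Finset.inter_subset_right
    · intro a ha b hb hab
      refine Finset.mem_inter.2 ⟨hb, ?_⟩
      by_contra hbR
      exact h1.notMem (h2.exit a (Finset.mem_inter.1 ha).2 b (h1.sub hb) hbR hab ▸ hb)
  exact (key h1 h2 hx hx').antisymm (key h2 h1 hx' hx)

/-- Two items share the price of `v`: the orders 3t + 1 and 3t' + 1 together with `v` give 3(t + t'
+ 1), and all exits are at `v`. -/
theorem not_item_item (hC : G.Critical S₀ U) (hv : G.Core U v) (h1 : G.Item U v R T)
    (h2 : G.Item U v R' T') (hd : Disjoint R R') : False := by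
  refine hC.remove_of_exit (R := insert v (R ∪ R')) (S₁ := insert v (T ∪ T')) ?_ (by simp) ?_ ?_ ?_ ?_
  · exact Finset.insert_subset hv.mem (Finset.union_subset h1.sub h2.sub)
  · exact Finset.insert_subset_insert _ (Finset.union_subset_union h1.subset h2.subset)
  · rw [Finset.card_insert_of_notMem (s := R ∪ R') (by simp [h1.notMem, h2.notMem]),
      Finset.card_union_of_disjoint hd, h1.card, h2.card]
    have := Finset.card_insert_le v (T ∪ T')
    have := Finset.card_union_le T T'
    omega
  · intro p hp
    simp only [Finset.mem_insert, Finset.mem_union] at hp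
    rcases hp with rfl | hp | hp
    · exact .of_mem (by simp)
    · refine (h1.dom p hp).mono ?_
      intro q
      simp
      tauto
    · refine (h2.dom p hp).mono ?_
      intro q
      simp
      tauto
  · intro p hp hpR r hr hpr
    simp only [Finset.mem_insert, Finset.mem_union, not_or] at hr hpR
    rcases hr with rfl | hr | hr
    · exact ⟨r, by simp, hpr⟩
    · exact absurd (h1.exit r hr p hp hpR.2.1 hpr.symm) hpR.1
    · exact absurd (h2.exit r hr p hp hpR.2.2 hpr.symm) hpR.1

theorem not_item_mid [Finite V] (hC : G.Critical S₀ U) (hv : G.Core U v) (h1 : G.Item U v R T)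
    (hf : G.Mid U v f g) (hg : 3 ≤ (G.nb U g).card) (hfR : f ∉ R) : False := by
  have hvf := hf.adj_left.symm
  have hRU : insert v (insert f R) ⊆ U :=
    Finset.insert_subset hv.mem (Finset.insert_subset hf.mem h1.sub)
  have hexit : ∀ w ∈ U, w ∉ insert v (insert f R) → ∀ r ∈ insert v (insert f R), G.Adj w r →
      ¬ G.Adj w v → w = g ∧ r = f := by
    intro w hw hwR r hr hwr hwv
    simp only [Finset.mem_insert, not_or] at hr hwR
    rcases hr with rfl | rfl | hr
    · exact absurd hwr hwv
    · have := hf.eq_or hw hwr.symm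
      tauto
    · exact absurd (h1.exit r hr w hw hwR.2.2 hwr.symm) hwR.1
  refine hC.remove (R := insert v (insert f R)) (S₁ := insert v T) hRU (by simp) ?_ ?_ ?_ ?_ ?_
  · exact Finset.insert_subset_insert _ (h1.subset.trans (Finset.subset_insert _ _))
  · rw [Finset.card_insert_of_notMem (s := insert f R) (by simp [h1.notMem, hvf.ne]),
      Finset.card_insert_of_notMem hfR, h1.card]
    have := Finset.card_insert_le v T
    omega
  · intro p hp
    simp only [Finset.mem_insert] at hp
    rcases hp with rfl | rfl | hp
    · exact .of_mem (by simp)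
    · exact .of_adj (u := v) (by simp) hvf.symm
    · exact (h1.dom p hp).mono Finset.subset_union_right
  · intro w hw hwR hwS
    have hwv := hwS v (by simp)
    by_cases hwg : w = g
    · subst hwg
      have := card_nb_sdiff (G := G) (U := U) (R := insert v (insert f R)) (v := w) (k := 1) (by
        refine (Finset.card_le_card (t := {f}) fun q hq => ?_).trans (by simp)
        rw [Finset.mem_inter, mem_nb] at hq
        rw [Finset.mem_singleton]
        exact (hexit w hw hwR q hq.2 hq.1.2 hwv).2)
      exact Or.inr (by omega)
    · exact hC.two_le_card_nb_sdiff hw fun r hr hwr => hwg (hexit w hw hwR r hr hwr hwv).1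
  · intro A hAU hAR hcl hex hAS
    have hAR' : ∀ p ∈ A, p ∉ insert v (insert f R) := fun p hp => Finset.disjoint_left.1 hAR hp
    obtain ⟨p, hp, r, hr, hpr⟩ := hC.exists_adj_of_closedIn (by simp) hRU hAU hAR hcl hex.nonempty
    obtain ⟨rfl, rfl⟩ := hexit p (hAU hp) (hAR' p hp) r hr hpr (hAS p hp v (by simp))
    rcases hex with hex | hex
    · exact hex.solve_fourCycle hp (s := v) (by simp)
        (fun hvA => hAR' v hvA (by simp)) (Or.inr ⟨r, hpr, hvf.symm⟩)
    · exfalso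
      refine hC.not_spansTwo hAU hex hp hf.mem (fun h => hAR' r h (by simp)) hpr ?_
      intro q hq t ht htA hqt
      have htR : t ∈ insert v (insert r R) := by
        by_contra htR
        exact htA (hcl q hq t (Finset.mem_sdiff.2 ⟨ht, htR⟩) hqt)
      exact (hexit q (hAU hq) (hAR' q hq) t htR hqt (hAS q hq v (by simp))).2

end Critical

end Core
end SimpleGraph

namespace SimpleGraph

/-! ### Two degree-two neighbours of a core vertex that lead on to large vertices. -/

section TwoMids

variable {V : Type*} [DecidableEq V] {G H : SimpleGraph V} {S₀ S₁ U R R' T T' A X Y : Finset V}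
  {f₁ f₂ g₁ g₂ v f g h k x w : V}

theorem exists_third (h₁ : f₁ ∈ G.nb U v) (h₂ : f₂ ∈ G.nb U v) (hne : f₁ ≠ f₂)
    (hc : (G.nb U v).card = 3) : ∃ w, w ≠ f₁ ∧ w ≠ f₂ ∧ G.nb U v = {f₁, f₂, w} := by
  have hsub : ({f₁, f₂} : Finset V) ⊆ G.nb U v := by simp [Finset.insert_subset_iff, h₁, h₂]
  have hcard := Finset.card_sdiff_add_card_eq_card hsub
  rw [Finset.card_pair hne] at hcard
  obtain ⟨w, hw⟩ := Finset.card_eq_one.1 (show (G.nb U v \ {f₁, f₂}).card = 1 by omega)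
  have hw' : w ∈ G.nb U v \ {f₁, f₂} := by simp [hw]
  simp only [Finset.mem_sdiff, Finset.mem_insert, Finset.mem_singleton, not_or] at hw'
  refine ⟨w, hw'.2.1, hw'.2.2, ?_⟩
  rw [← Finset.union_sdiff_of_subset hsub, hw]
  ext
  simp

theorem spans_bipartite23 {a b c d e : V} (hab : a ≠ b) (hcd : c ≠ d) (hce : c ≠ e) (hde : d ≠ e)
    (hac : G.Adj a c) (had : G.Adj a d) (hae : G.Adj a e) (hbc : G.Adj b c) (hbd : G.Adj b d)
    (hbe : G.Adj b e) : G.Spans bipartite23 {a, b, c, d, e} := by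
  have := Spans.of_list (G := G) (b := bipartite23) [a, b, c, d, e] a rfl
    (by simp [hab, hcd, hce, hde, hac.ne, had.ne, hae.ne, hbc.ne, hbd.ne, hbe.ne])
    (by simp [bipartite23, hac, had, hae, hbc, hbd, hbe])
  simpa using this

namespace Critical

/-- Delete `v`, `f₁`, `f₂` at the price of `v`: each of `g₁`, `g₂` loses at most one neighbour. The
critical remainder is an exceptional set of order 2 modulo 3 containing both. -/
theorem not_mid_mid_of_ne [Finite V] (hC : G.Critical S₀ U) (hv : G.Core U v)
    (hf₁ : G.Mid U v f₁ g₁) (hf₂ : G.Mid U v f₂ g₂) (hf : f₁ ≠ f₂) (hg : g₁ ≠ g₂)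
    (hg₁ : 3 ≤ (G.nb U g₁).card) (hg₂ : 3 ≤ (G.nb U g₂).card) : False := by
  have hvf₁ := hf₁.adj_left.symm
  have hvf₂ := hf₂.adj_left.symm
  have hRU : ({v, f₁, f₂} : Finset V) ⊆ U := by
    simp [Finset.insert_subset_iff, hv.mem, hf₁.mem, hf₂.mem]
  have hexit : ∀ w ∈ U, w ∉ ({v, f₁, f₂} : Finset V) → ∀ r ∈ ({v, f₁, f₂} : Finset V), G.Adj w r →
      ¬ G.Adj w v → w = g₁ ∧ r = f₁ ∨ w = g₂ ∧ r = f₂ := by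
    intro w hw hwR r hr hwr hwv
    simp only [Finset.mem_insert, Finset.mem_singleton, not_or] at hr hwR
    rcases hr with rfl | rfl | rfl
    · exact absurd hwr hwv
    · have := hf₁.eq_or hw hwr.symm
      tauto
    · have := hf₂.eq_or hw hwr.symm
      tauto
  refine hC.remove (R := {v, f₁, f₂}) (S₁ := {v}) hRU (by simp) (by simp) ?_ ?_ ?_ ?_
  · rw [Finset.card_eq_three.2 ⟨v, f₁, f₂, hvf₁.ne, hvf₂.ne, hf, rfl⟩]
    simp
  · intro p hp
    simp only [Finset.mem_insert, Finset.mem_singleton] at hp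
    rcases hp with rfl | rfl | rfl
    · exact .of_mem (by simp)
    · exact .of_adj (u := v) (by simp) hvf₁.symm
    · exact .of_adj (u := v) (by simp) hvf₂.symm
  · intro w hw hwR hwS
    have hwv := hwS v (by simp)
    by_cases hwg : w = g₁ ∨ w = g₂
    · have h3 : 3 ≤ (G.nb U w).card := by rcases hwg with rfl | rfl <;> assumption
      have := card_nb_sdiff (G := G) (U := U) (R := {v, f₁, f₂}) (v := w) (k := 1) (by
        refine (Finset.card_le_card (t := {if w = g₁ then f₁ else f₂}) fun q hq => ?_).trans (by simp)
        rw [Finset.mem_inter, mem_nb] at hq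
        rw [Finset.mem_singleton]
        rcases hexit w hw hwR q hq.2 hq.1.2 hwv with ⟨h1, h2⟩ | ⟨h1, h2⟩
        · rw [if_pos h1, h2]
        · rw [if_neg (h1 ▸ hg.symm), h2])
      exact Or.inr (by omega)
    · refine hC.two_le_card_nb_sdiff hw fun r hr hwr => hwg ?_
      exact (hexit w hw hwR r hr hwr hwv).imp And.left And.left
  · intro A hAU hAR hcl hex hAS
    have hAR' : ∀ p ∈ A, p ∉ ({v, f₁, f₂} : Finset V) := fun p hp => Finset.disjoint_left.1 hAR hp
    have hvA : v ∉ A := fun h => hAR' v h (by simp)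
    have hAexit : ∀ p ∈ A, ∀ q ∈ U, q ∉ A → G.Adj p q → p = g₁ ∧ q = f₁ ∨ p = g₂ ∧ q = f₂ := by
      intro p hp q hq hqA hpq
      refine hexit p (hAU hp) (hAR' p hp) q ?_ hpq (hAS p hp v (by simp))
      by_contra hqR
      exact hqA (hcl p hp q (Finset.mem_sdiff.2 ⟨hq, hqR⟩) hpq)
    rcases hex with hex | hex
    · obtain ⟨p, hp, r, hr, hpr⟩ := hC.exists_adj_of_closedIn (by simp) hRU hAU hAR hcl
        (hex.nonempty (by decide))
      refine hex.solve_fourCycle hp (s := v) (by simp) hvA (Or.inr ⟨r, hpr, ?_⟩)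
      rcases hexit p (hAU hp) (hAR' p hp) r hr hpr (hAS p hp v (by simp)) with ⟨-, rfl⟩ | ⟨-, rfl⟩
      exacts [hvf₁.symm, hvf₂.symm]
    exfalso
    have hf₁A : f₁ ∉ A := fun h => hAR' _ h (by simp)
    have hf₂A : f₂ ∉ A := fun h => hAR' _ h (by simp)
    by_cases hg₂A : g₂ ∈ A; swap
    · obtain ⟨p, hp, r, hr, hrA, hpr⟩ := hC.exists_exit hAU (SpansEx.nonempty (Or.inr hex))
        (fun h => hvA (h ▸ hv.mem))
      have hone : ∀ p ∈ A, ∀ q ∈ U, q ∉ A → G.Adj p q → p = g₁ ∧ q = f₁ := by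
        intro p hp q hq hqA hpq
        refine (hAexit p hp q hq hqA hpq).resolve_right ?_
        rintro ⟨rfl, -⟩
        exact hg₂A hp
      obtain ⟨rfl, rfl⟩ := hone p hp r hr hrA hpr
      exact hC.not_spansTwo hAU hex hp hf₁.mem hf₁A hpr
        fun p hp q hq hqA hpq => (hone p hp q hq hqA hpq).2
    by_cases hg₁A : g₁ ∈ A; swap
    · have hone : ∀ p ∈ A, ∀ q ∈ U, q ∉ A → G.Adj p q → q = f₂ := by
        intro p hp q hq hqA hpq
        refine ((hAexit p hp q hq hqA hpq).resolve_left ?_).2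
        rintro ⟨rfl, -⟩
        exact hg₁A hp
      exact hC.not_spansTwo hAU hex hg₂A hf₂.mem hf₂A hf₂.adj_right.symm hone
    -- If `g₁` and `g₂` are adjacent, a pendant four-cycle through one of them would contain `v`.
    -- Otherwise `A`, `f₁` and `f₂` are deleted instead, with `f₁` as the extra dominator: it is
    -- adjacent to the exit `v`, and `f₂` is covered because `g₂` is in or next to `S`.
    rcases hex.exists_of_adj_of_mem hg₁A hg₂A hf₁A hf₁.adj_right.symm hg with
      hadj | ⟨S, hSA, hS, hg₂S, hdom⟩
    · obtain ⟨X, hX | hX⟩ := hC.exists_pendant hf₁.right_mem hf₂.right_mem hadj hg₁ hg₂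
      · exact hv.notMem X _ _ hX
          (hX.mem_of_mid hf₁ (hC.mem_pendant hX hf₁ hX.mem hf₁.adj_right.symm)).1
      · exact hv.notMem X _ _ hX
          (hX.mem_of_mid hf₂ (hC.mem_pendant hX hf₂ hX.mem hf₂.adj_right.symm)).1
    refine hC.remove_of_exit (R := A ∪ {f₁, f₂}) (S₁ := insert f₁ S) ?_ (by simp) ?_ ?_ ?_ ?_
    · exact Finset.union_subset hAU (by simp [Finset.insert_subset_iff, hf₁.mem, hf₂.mem])
    · exact Finset.insert_subset (by simp) (hSA.trans Finset.subset_union_left)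
    · rw [Finset.card_union_of_disjoint (by simp [hf₁A, hf₂A]), Finset.card_pair hf]
      have := Finset.card_insert_le f₁ S
      omega
    · intro p hp
      refine Dominated.mono ?_ (Finset.subset_union_right (s₁ := S₀))
      simp only [Finset.mem_union, Finset.mem_insert, Finset.mem_singleton] at hp
      rcases hp with hp | rfl | rfl
      · exact hdom p hp
      · exact .of_mem (by simp)
      · rcases hg₂S with h | ⟨u, hu, h⟩
        · exact .of_adj (Finset.mem_insert_of_mem h) hf₂.adj_right
        · refine .of_near (Finset.mem_insert_self _ _) (Finset.mem_insert_of_mem hu) ?_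
            ⟨v, hvf₂.symm, hvf₁⟩ ⟨g₂, hf₂.adj_right, h⟩
          rintro rfl
          exact hf₁A (hSA hu)
    · intro p hp hpR r hr hpr
      simp only [Finset.mem_union, Finset.mem_insert, Finset.mem_singleton, not_or] at hr hpR
      rcases hr with hr | rfl | rfl
      · have := hAexit r hr p hp hpR.1 hpr.symm
        tauto
      · exact ⟨r, by simp, hpr⟩
      · rcases hf₂.eq_or hp hpr.symm with rfl | rfl
        · exact ⟨f₁, by simp, hvf₁⟩
        · exact absurd hg₂A hpR.1

/-- Deleting `v`, `f₁`, `f₂` at the price of `v` leaves `g` two neighbours. This fails only if `g`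
lies in an exceptional `A` of order 2 modulo 3. A dominating set of `A` through `g` then covers `f₁`
and `f₂` as well, and `A` is deleted from the other side. -/
theorem not_double_of_four_le (hC : G.Critical S₀ U) (hv : G.Core U v)
    (hf₁ : G.Mid U v f₁ g) (hf₂ : G.Mid U v f₂ g) (hf : f₁ ≠ f₂)
    (hg : 4 ≤ (G.nb U g).card) : False := by
  have hvf₁ := hf₁.adj_left.symm
  have hvf₂ := hf₂.adj_left.symm
  have hRU : ({v, f₁, f₂} : Finset V) ⊆ U := by
    simp [Finset.insert_subset_iff, hv.mem, hf₁.mem, hf₂.mem]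
  have hexit : ∀ w ∈ U, w ∉ ({v, f₁, f₂} : Finset V) → ∀ r ∈ ({v, f₁, f₂} : Finset V), G.Adj w r →
      ¬ G.Adj w v → w = g ∧ (r = f₁ ∨ r = f₂) := by
    intro w hw hwR r hr hwr hwv
    simp only [Finset.mem_insert, Finset.mem_singleton, not_or] at hr hwR
    rcases hr with rfl | rfl | rfl
    · exact absurd hwr hwv
    · have := hf₁.eq_or hw hwr.symm
      tauto
    · have := hf₂.eq_or hw hwr.symm
      tauto
  refine hC.remove (R := {v, f₁, f₂}) (S₁ := {v}) hRU (by simp) (by simp) ?_ ?_ ?_ ?_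
  · rw [Finset.card_eq_three.2 ⟨v, f₁, f₂, hvf₁.ne, hvf₂.ne, hf, rfl⟩]
    simp
  · intro p hp
    simp only [Finset.mem_insert, Finset.mem_singleton] at hp
    rcases hp with rfl | rfl | rfl
    · exact .of_mem (by simp)
    · exact .of_adj (u := v) (by simp) hvf₁.symm
    · exact .of_adj (u := v) (by simp) hvf₂.symm
  · intro w hw hwR hwS
    have hwv := hwS v (by simp)
    by_cases hwg : w = g
    · have := card_nb_sdiff (G := G) (U := U) (R := {v, f₁, f₂}) (v := w) (k := 2) (by
        refine (Finset.card_le_card (t := {f₁, f₂}) fun q hq => ?_).trans Finset.card_le_two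
        rw [Finset.mem_inter, mem_nb] at hq
        simpa using (hexit w hw hwR q hq.2 hq.1.2 hwv).2)
      subst hwg
      exact Or.inr (by omega)
    · exact hC.two_le_card_nb_sdiff hw fun r hr hwr => hwg (hexit w hw hwR r hr hwr hwv).1
  · intro A hAU hAR hcl hex hAS
    have hAR' : ∀ p ∈ A, p ∉ ({v, f₁, f₂} : Finset V) := fun p hp => Finset.disjoint_left.1 hAR hp
    have hvA : v ∉ A := fun h => hAR' v h (by simp)
    have hf₁A : f₁ ∉ A := fun h => hAR' _ h (by simp)
    have hf₂A : f₂ ∉ A := fun h => hAR' _ h (by simp)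
    have hAv : ∀ p ∈ A, ¬ G.Adj p v := fun p hp => hAS p hp v (by simp)
    have hAexit : ∀ p ∈ A, ∀ q ∈ U, q ∉ A → G.Adj p q → p = g ∧ (q = f₁ ∨ q = f₂) := by
      intro p hp q hq hqA hpq
      refine hexit p (hAU hp) (hAR' p hp) q ?_ hpq (hAv p hp)
      by_contra hqR
      exact hqA (hcl p hp q (Finset.mem_sdiff.2 ⟨hq, hqR⟩) hpq)
    obtain ⟨p, hp, r, hr, hpr⟩ := hC.exists_adj_of_closedIn (by simp) hRU hAU hAR hcl hex.nonempty
    obtain ⟨rfl, -⟩ := hexit p (hAU hp) (hAR' p hp) r hr hpr (hAv p hp)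
    rcases hex with hex | hex
    · exact hex.solve_fourCycle hp (s := v) (by simp) hvA
        (Or.inr ⟨f₁, hf₁.adj_right.symm, hvf₁.symm⟩)
    exfalso
    obtain ⟨S, hSA, hpS, hS, hdom⟩ := hex.exists_mem hp
    by_cases hv4 : 4 ≤ (G.nb U v).card
    · have hRU' : A ∪ {f₁, f₂} ⊆ U :=
        Finset.union_subset hAU (by simp [Finset.insert_subset_iff, hf₁.mem, hf₂.mem])
      have hexit' : ∀ w ∈ U, w ∉ A ∪ {f₁, f₂} → ∀ r ∈ A ∪ {f₁, f₂}, G.Adj w r →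
          w = v ∧ (r = f₁ ∨ r = f₂) := by
        intro w hw hwR r hr hwr
        simp only [Finset.mem_union, Finset.mem_insert, Finset.mem_singleton, not_or] at hr hwR
        rcases hr with hr | rfl | rfl
        · have := hAexit r hr w hw hwR.1 hwr.symm
          tauto
        · rcases hf₁.eq_or hw hwr.symm with rfl | rfl <;> tauto
        · rcases hf₂.eq_or hw hwr.symm with rfl | rfl <;> tauto
      have hcardR : (A ∪ {f₁, f₂}).card = A.card + 2 := by
        rw [Finset.card_union_of_disjoint (by simp [hf₁A, hf₂A]), Finset.card_pair hf]
      refine hC.remove (R := A ∪ {f₁, f₂}) (S₁ := S) hRU' (by simp)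
        (hSA.trans Finset.subset_union_left) (by omega) ?_ ?_ ?_
      · intro q hq
        refine Dominated.mono ?_ (Finset.subset_union_right (s₁ := S₀))
        simp only [Finset.mem_union, Finset.mem_insert, Finset.mem_singleton] at hq
        rcases hq with hq | rfl | rfl
        · exact hdom q hq
        · exact .of_adj hpS hf₁.adj_right
        · exact .of_adj hpS hf₂.adj_right
      · intro w hw hwR _
        by_cases hwv : w = v
        · have := card_nb_sdiff (G := G) (U := U) (R := A ∪ {f₁, f₂}) (v := w) (k := 2) (by
            refine (Finset.card_le_card (t := {f₁, f₂}) fun q hq => ?_).trans Finset.card_le_two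
            rw [Finset.mem_inter, mem_nb] at hq
            simpa using (hexit' w hw hwR q hq.2 hq.1.2).2)
          subst hwv
          exact Or.inr (by omega)
        · exact hC.two_le_card_nb_sdiff hw fun r hr hwr => hwv (hexit' w hw hwR r hr hwr).1
      · intro B hBU hBR hcl' hexB _
        have hBR' : ∀ p ∈ B, p ∉ A ∪ {f₁, f₂} := fun p hp => Finset.disjoint_left.1 hBR hp
        obtain ⟨v', hvB, r, hr, hvr⟩ := hC.exists_adj_of_closedIn (by simp) hRU' hBU hBR hcl'
          hexB.nonempty
        obtain ⟨rfl, -⟩ := hexit' v' (hBU hvB) (hBR' v' hvB) r hr hvr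
        rcases hexB with hexB | hexB
        · exact hexB.solve_fourCycle hvB (s := p) (Finset.mem_union_right _ hpS)
            (fun h => hBR' p h (by simp [hp])) (Or.inr ⟨f₁, hvf₁, hf₁.adj_right⟩)
        exfalso
        have hUB : B ∪ (A ∪ {f₁, f₂}) = U := by
          refine hC.conn _ (Finset.union_subset hBU hRU') (by simp) ?_
          intro a ha b hb hab
          by_cases hbR : b ∈ A ∪ {f₁, f₂}
          · exact Finset.mem_union_right _ hbR
          refine Finset.mem_union_left _ ?_
          rcases Finset.mem_union.1 ha with ha | ha
          · exact hcl' a ha b (Finset.mem_sdiff.2 ⟨hb, hbR⟩) hab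
          · rw [(hexit' b hb hbR a ha hab.symm).1]
            exact hvB
        -- Now `U` consists of `A`, `B`, `f₁`, `f₂`. Taking `f₁` as outside help for `A` and `f₂`
        -- for `B` costs at most (|A| + |B| + 2)/3.
        obtain ⟨S₂, -, hS₂, hdom₂⟩ := hex.exists_of_adj hp hf₁A hf₁.adj_right.symm
        obtain ⟨S₃, -, hS₃, hdom₃⟩ := hexB.exists_of_adj hvB (fun h => hBR' f₂ h (by simp)) hvf₂
        refine hC.unsolved ⟨insert f₁ S₂ ∪ insert f₂ S₃, ?_, fun q hq => ?_⟩
        · have h1 := Finset.card_union_le (insert f₁ S₂) (insert f₂ S₃)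
          have h2 := Finset.card_insert_le f₁ S₂
          have h3 := Finset.card_insert_le f₂ S₃
          have h4 := Finset.card_union_of_disjoint hBR
          rw [hUB] at h4
          omega
        · refine Dominated.mono ?_ (Finset.subset_union_right (s₁ := S₀))
          rw [← hUB] at hq
          simp only [Finset.mem_union, Finset.mem_insert, Finset.mem_singleton] at hq
          rcases hq with hq | hq | rfl | rfl
          · exact (hdom₃ q hq).mono Finset.subset_union_right
          · exact (hdom₂ q hq).mono Finset.subset_union_left
          · exact .of_mem (by simp)
          · exact .of_mem (by simp)
    · have hv3 := hv.card
      obtain ⟨w, hw₁, hw₂, hnb⟩ := exists_third (mem_nb.2 ⟨hf₁.mem, hvf₁⟩) (mem_nb.2 ⟨hf₂.mem, hvf₂⟩)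
        hf (show (G.nb U v).card = 3 by omega)
      obtain ⟨hwU, hvw⟩ : w ∈ U ∧ G.Adj v w := mem_nb.1 (by simp [hnb])
      have hwA : w ∉ A := fun h => hAv w h hvw.symm
      -- The third neighbour `w` of `v` is the only exit. The four extra vertices pay for it and for
      -- the one unit by which 3|S| may exceed |A|.
      refine hC.remove_of_exit (R := A ∪ {w, v, f₁, f₂}) (S₁ := insert w S) ?_ (by simp) ?_ ?_ ?_ ?_
      · refine Finset.union_subset hAU ?_
        simp [Finset.insert_subset_iff, hf₁.mem, hf₂.mem, hv.mem, hwU]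
      · exact Finset.insert_subset (by simp) (hSA.trans Finset.subset_union_left)
      · have : ({w, v, f₁, f₂} : Finset V).card = 3 + 1 := by
          rw [Finset.card_insert_of_notMem (by simp [hvw.ne.symm, hw₁, hw₂]),
            Finset.card_eq_three.2 ⟨v, f₁, f₂, hvf₁.ne, hvf₂.ne, hf, rfl⟩]
        rw [Finset.card_union_of_disjoint (by simp [hf₁A, hf₂A, hvA, hwA]), this]
        have := Finset.card_insert_le w S
        omega
      · intro q hq
        refine Dominated.mono ?_ (Finset.subset_union_right (s₁ := S₀))
        simp only [Finset.mem_union, Finset.mem_insert, Finset.mem_singleton] at hq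
        rcases hq with hq | rfl | rfl | rfl | rfl
        · exact (hdom q hq).mono (Finset.subset_insert _ _)
        · exact .of_mem (by simp)
        · exact .of_adj (Finset.mem_insert_self _ _) hvw
        · exact .of_adj (Finset.mem_insert_of_mem hpS) hf₁.adj_right
        · exact .of_adj (Finset.mem_insert_of_mem hpS) hf₂.adj_right
      · intro t ht htR r hr htr
        simp only [Finset.mem_union, Finset.mem_insert, Finset.mem_singleton, not_or] at hr htR
        rcases hr with hr | rfl | rfl | rfl | rfl
        · have := hAexit r hr t ht htR.1 htr.symm
          tauto
        · exact ⟨r, by simp, htr⟩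
        · have : t ∈ G.nb U r := mem_nb.2 ⟨ht, htr.symm⟩
          simp only [hnb, Finset.mem_insert, Finset.mem_singleton] at this
          tauto
        · rcases hf₁.eq_or ht htr.symm with rfl | rfl <;> tauto
        · rcases hf₂.eq_or ht htr.symm with rfl | rfl <;> tauto

/-- With third neighbours `w` of `v` and `h` of `g`, the choice depends on what lies behind `w`: a
pendant four-cycle (nine vertices, three taken), a large vertex (six vertices, `v` and `h` taken, or
else K₂,₃ if `w = h`), or a vertex `w'` of degree two (six vertices, `w'` and `g` taken, both two
steps from `v`). -/
theorem not_double_of_three [Finite V] (hC : G.Critical S₀ U) (hv : G.Core U v) (hg : G.Core U g)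
    (hf₁ : G.Mid U v f₁ g) (hf₂ : G.Mid U v f₂ g) (hf : f₁ ≠ f₂) (hv3 : (G.nb U v).card = 3)
    (hg3 : (G.nb U g).card = 3) : False := by
  have hvf₁ := hf₁.adj_left.symm
  have hvf₂ := hf₂.adj_left.symm
  have hgf₁ := hf₁.adj_right.symm
  have hgf₂ := hf₂.adj_right.symm
  have hvg := hf₁.ne
  have hnvg := hC.not_adj_of_mid hv hf₁ hg.card
  obtain ⟨w, hw₁, hw₂, hnb⟩ := exists_third (mem_nb.2 ⟨hf₁.mem, hvf₁⟩) (mem_nb.2 ⟨hf₂.mem, hvf₂⟩)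
    hf hv3
  obtain ⟨hwU, hvw⟩ : w ∈ U ∧ G.Adj v w := mem_nb.1 (by simp [hnb])
  obtain ⟨h, hh₁, hh₂, hnb'⟩ := exists_third (mem_nb.2 ⟨hf₁.mem, hgf₁⟩) (mem_nb.2 ⟨hf₂.mem, hgf₂⟩)
    hf hg3
  obtain ⟨hhU, hgh⟩ : h ∈ U ∧ G.Adj g h := mem_nb.1 (by simp [hnb'])
  have hnv : ∀ t ∈ U, G.Adj t v → t = f₁ ∨ t = f₂ ∨ t = w := by
    intro t ht htv
    have : t ∈ G.nb U v := mem_nb.2 ⟨ht, htv.symm⟩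
    simpa [hnb] using this
  have hng : ∀ t ∈ U, G.Adj t g → t = f₁ ∨ t = f₂ ∨ t = h := by
    intro t ht htv
    have : t ∈ G.nb U g := mem_nb.2 ⟨ht, htv.symm⟩
    simpa [hnb'] using this
  have hwg : w ≠ g := by
    rintro rfl
    exact hnvg hvw
  have hhv : h ≠ v := by
    rintro rfl
    exact hnvg hgh.symm
  rcases hC.exists_mid_or hwU hv.mem hvw.symm with hw3 | ⟨w', hw'⟩
  · obtain ⟨X, hX | hX⟩ := hC.exists_pendant hv.mem hwU hvw hv.card hw3
    · exact hv.notMem X _ _ hX hX.mem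
    have hvX := hX.notMem
    have hgX := hg.notMem X _ _ hX
    have hhX : h ∉ X := fun hhX => hvg (hX.exit h hhX g hg.mem hgX hgh.symm).2.symm
    have hfX : ∀ f, G.Adj f g → G.Mid U v f g → f ∉ X := fun f _ hf hfX =>
      hgX (hX.mem_of_mid hf hfX).2
    obtain ⟨o, ho, hdom⟩ := hX.spans.exists_opposite hX.mem
    refine hC.remove_of_exit (R := X ∪ {v, f₁, f₂, g, h}) (S₁ := {o, v, h}) ?_ (by simp) ?_ ?_ ?_ ?_
    · refine Finset.union_subset hX.sub ?_
      simp [Finset.insert_subset_iff, hf₁.mem, hf₂.mem, hv.mem, hg.mem, hhU]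
    · simp [Finset.insert_subset_iff, ho]
    · have h1 : ({v, f₁, f₂, g, h} : Finset V).card = 3 + 1 + 1 := by
        rw [Finset.card_insert_of_notMem (by simp [hvf₁.ne, hvf₂.ne, hvg, hhv.symm]),
          Finset.card_insert_of_notMem (by simp [hf, hgf₁.ne.symm, hh₁.symm]),
          Finset.card_eq_three.2 ⟨f₂, g, h, hgf₂.ne.symm, hh₂.symm, hgh.ne, rfl⟩]
      rw [Finset.card_union_of_disjoint (by
        simp [hvX, hgX, hhX, hfX f₁ hgf₁.symm hf₁, hfX f₂ hgf₂.symm hf₂]), h1, hX.spans.card]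
      have : ({o, v, h} : Finset V).card ≤ 3 := Finset.card_le_three
      change _ ≤ 4 + _
      omega
    · intro q hq
      refine Dominated.mono ?_ (Finset.subset_union_right (s₁ := S₀))
      simp only [Finset.mem_union, Finset.mem_insert, Finset.mem_singleton] at hq
      rcases hq with hq | rfl | rfl | rfl | rfl | rfl
      · exact hdom _ v (by simp) (by simp) hvX (Or.inl hvw.symm) q hq
      · exact .of_mem (by simp)
      · exact .of_adj (u := v) (by simp) hvf₁.symm
      · exact .of_adj (u := v) (by simp) hvf₂.symm
      · exact .of_adj (u := h) (by simp) hgh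
      · exact .of_mem (by simp)
    · intro t ht htR r hr htr
      simp only [Finset.mem_union, Finset.mem_insert, Finset.mem_singleton, not_or] at hr htR
      rcases hr with hr | rfl | rfl | rfl | rfl | rfl
      · exact absurd (hX.exit r hr t ht htR.1 htr.symm).2 htR.2.1
      · exact ⟨r, by simp, htr⟩
      · have := hf₁.eq_or ht htr.symm
        tauto
      · have := hf₂.eq_or ht htr.symm
        tauto
      · have := hng t ht htr
        tauto
      · exact ⟨r, by simp, htr⟩
  have hww' := hw'.adj_right
  rcases hC.exists_mid_or hw'.right_mem hwU hww'.symm with hw3 | ⟨y, hy⟩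
  · by_cases hwh : w = h
    · subst hwh
      obtain rfl : w' = g := by
        rcases hw'.eq_or hg.mem hgh.symm with h | h
        · exact absurd h hvg.symm
        · exact h.symm
      refine hC.not_spansEx (Or.inr ⟨bipartite23, by decide, ?_⟩)
      have hs := spans_bipartite23 hvg hf hw₁.symm hw₂.symm hvf₁ hvf₂ hvw hgf₁ hgf₂ hgh
      rwa [hC.conn {v, w', f₁, f₂, w} (by
        simp [Finset.insert_subset_iff, hf₁.mem, hf₂.mem, hv.mem, hg.mem, hhU]) (by simp)] at hs
      intro r hr t ht hrt
      simp only [Finset.mem_insert, Finset.mem_singleton] at hr ⊢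
      rcases hr with rfl | rfl | rfl | rfl | rfl
      · have := hnv t ht hrt.symm
        tauto
      · have := hng t ht hrt.symm
        tauto
      · have := hf₁.eq_or ht hrt
        tauto
      · have := hf₂.eq_or ht hrt
        tauto
      · have := hw'.eq_or ht hrt
        tauto
    have hRU : ({v, f₁, f₂, g, h, w} : Finset V) ⊆ U := by
      simp [Finset.insert_subset_iff, hf₁.mem, hf₂.mem, hv.mem, hg.mem, hhU, hwU]
    have hexit : ∀ t ∈ U, t ∉ ({v, f₁, f₂, g, h, w} : Finset V) →
        ∀ r ∈ ({v, f₁, f₂, g, h, w} : Finset V), G.Adj t r → ¬ G.Adj t h → t = w' ∧ r = w := by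
      intro t ht htR r hr htr hth
      simp only [Finset.mem_insert, Finset.mem_singleton, not_or] at hr htR
      rcases hr with rfl | rfl | rfl | rfl | rfl | rfl
      · have := hnv t ht htr
        tauto
      · have := hf₁.eq_or ht htr.symm
        tauto
      · have := hf₂.eq_or ht htr.symm
        tauto
      · have := hng t ht htr
        tauto
      · exact absurd htr hth
      · have := hw'.eq_or ht htr.symm
        tauto
    refine hC.remove (R := {v, f₁, f₂, g, h, w}) (S₁ := {v, h}) hRU (by simp) ?_ ?_ ?_ ?_ ?_
    · simp [Finset.insert_subset_iff]
    · have h1 : ({v, f₁, f₂, g, h, w} : Finset V).card = 3 + 1 + 1 + 1 := by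
        rw [Finset.card_insert_of_notMem (by simp [hvf₁.ne, hvf₂.ne, hvg, hhv.symm, hvw.ne]),
          Finset.card_insert_of_notMem (by simp [hf, hgf₁.ne.symm, hh₁.symm, hw₁.symm]),
          Finset.card_insert_of_notMem (by simp [hgf₂.ne.symm, hh₂.symm, hw₂.symm]),
          Finset.card_eq_three.2 ⟨g, h, w, hgh.ne, hwg.symm, Ne.symm hwh, rfl⟩]
      have : ({v, h} : Finset V).card ≤ 2 := Finset.card_le_two
      omega
    · intro q hq
      refine Dominated.mono ?_ (Finset.subset_union_right (s₁ := S₀))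
      simp only [Finset.mem_insert, Finset.mem_singleton] at hq
      rcases hq with rfl | rfl | rfl | rfl | rfl | rfl
      · exact .of_mem (by simp)
      · exact .of_adj (u := v) (by simp) hvf₁.symm
      · exact .of_adj (u := v) (by simp) hvf₂.symm
      · exact .of_adj (u := h) (by simp) hgh
      · exact .of_mem (by simp)
      · exact .of_adj (u := v) (by simp) hvw.symm
    · intro t ht htR htS
      have hth := htS h (by simp)
      by_cases htw : t = w'
      · have := card_nb_sdiff (G := G) (U := U) (R := {v, f₁, f₂, g, h, w}) (v := t) (k := 1) (by
          refine (Finset.card_le_card (t := {w}) fun q hq => ?_).trans (by simp)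
          rw [Finset.mem_inter, mem_nb] at hq
          simpa using (hexit t ht htR q hq.2 hq.1.2 hth).2)
        subst htw
        exact Or.inr (by omega)
      · exact hC.two_le_card_nb_sdiff ht fun r hr htr => htw (hexit t ht htR r hr htr hth).1
    · intro A hAU hAR hcl hex hAS
      have hAR' : ∀ p ∈ A, p ∉ ({v, f₁, f₂, g, h, w} : Finset V) :=
        fun p hp => Finset.disjoint_left.1 hAR hp
      obtain ⟨p, hp, r, hr, hpr⟩ := hC.exists_adj_of_closedIn (by simp) hRU hAU hAR hcl hex.nonempty
      obtain ⟨rfl, rfl⟩ := hexit p (hAU hp) (hAR' p hp) r hr hpr (hAS p hp h (by simp))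
      rcases hex with hex | hex
      · exact hex.solve_fourCycle hp (s := v) (by simp) (fun hvA => hAR' v hvA (by simp))
          (Or.inr ⟨r, hpr, hvw.symm⟩)
      · exfalso
        refine hC.not_spansTwo hAU hex hp hwU (fun h => hAR' r h (by simp)) hpr ?_
        intro q hq t ht htA hqt
        have htR : t ∈ ({v, f₁, f₂, g, h, r} : Finset V) := by
          by_contra htR
          exact htA (hcl q hq t (Finset.mem_sdiff.2 ⟨ht, htR⟩) hqt)
        exact (hexit q (hAU hq) (hAR' q hq) t htR hqt (hAS q hq h (by simp))).2
  · have hw'2 := hy.card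
    have hw'g : w' ≠ g := by
      rintro rfl
      omega
    have hw'f : ∀ f, G.Mid U v f g → w' ≠ f := by
      rintro f hf rfl
      rcases hf.eq_or hwU hww'.symm with h | h
      · exact hvw.ne h.symm
      · exact hwg h
    refine hC.remove_of_exit (R := {v, f₁, f₂, g, w, w'}) (S₁ := {w', g}) ?_ (by simp) ?_ ?_ ?_ ?_
    · simp [Finset.insert_subset_iff, hf₁.mem, hf₂.mem, hv.mem, hg.mem, hwU, hy.mem]
    · simp [Finset.insert_subset_iff]
    · have h1 : ({v, f₁, f₂, g, w, w'} : Finset V).card = 3 + 1 + 1 + 1 := by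
        rw [Finset.card_insert_of_notMem (by simp [hvf₁.ne, hvf₂.ne, hvg, hw'.ne, hvw.ne]),
          Finset.card_insert_of_notMem (by
            simp [hf, hgf₁.ne.symm, (hw'f f₁ hf₁).symm, hw₁.symm]),
          Finset.card_insert_of_notMem (by simp [hgf₂.ne.symm, (hw'f f₂ hf₂).symm, hw₂.symm]),
          Finset.card_eq_three.2 ⟨g, w, w', hwg.symm, hw'g.symm, hww'.ne, rfl⟩]
      have : ({w', g} : Finset V).card ≤ 2 := Finset.card_le_two
      omega
    · intro q hq
      refine Dominated.mono ?_ (Finset.subset_union_right (s₁ := S₀))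
      simp only [Finset.mem_insert, Finset.mem_singleton] at hq
      rcases hq with rfl | rfl | rfl | rfl | rfl | rfl
      · exact .of_near (u := w') (w := g) (by simp) (by simp) hw'g ⟨w, hvw, hww'⟩
          ⟨f₁, hvf₁, hgf₁.symm⟩
      · exact .of_adj (u := g) (by simp) hgf₁.symm
      · exact .of_adj (u := g) (by simp) hgf₂.symm
      · exact .of_mem (by simp)
      · exact .of_adj (u := w') (by simp) hww'
      · exact .of_mem (by simp)
    · intro t ht htR r hr htr
      simp only [Finset.mem_insert, Finset.mem_singleton, not_or] at hr htR
      rcases hr with rfl | rfl | rfl | rfl | rfl | rfl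
      · have := hnv t ht htr
        tauto
      · have := hf₁.eq_or ht htr.symm
        tauto
      · have := hf₂.eq_or ht htr.symm
        tauto
      · exact ⟨r, by simp, htr⟩
      · have := hw'.eq_or ht htr.symm
        tauto
      · exact ⟨r, by simp, htr⟩

/-- A core vertex has at most one neighbour of degree two with another large neighbour. -/
theorem not_mid_mid [Finite V] (hC : G.Critical S₀ U) (hv : G.Core U v)
    (hf₁ : G.Mid U v f₁ g₁) (hf₂ : G.Mid U v f₂ g₂) (hf : f₁ ≠ f₂)
    (hg₁ : 3 ≤ (G.nb U g₁).card) (hg₂ : 3 ≤ (G.nb U g₂).card) : False := by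
  by_cases hg : g₁ = g₂
  · subst hg
    have hcore := hC.core_of_mid hv hf₁ hg₁
    by_cases hg4 : 4 ≤ (G.nb U g₁).card
    · exact hC.not_double_of_four_le hv hf₁ hf₂ hf hg4
    by_cases hv4 : 4 ≤ (G.nb U v).card
    · exact hC.not_double_of_four_le hcore hf₁.symm hf₂.symm hf hv4
    have := hv.card
    exact hC.not_double_of_three hv hcore hf₁ hf₂ hf (by omega) (by omega)
  · exact hC.not_mid_mid_of_ne hv hf₁ hf₂ hf hg hg₁ hg₂

end Critical

end TwoMids
end SimpleGraph

namespace SimpleGraph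

/-! ### Discharging and the end of the induction. -/

section Counting

variable {V : Type*} [DecidableEq V] {G H : SimpleGraph V} {S₀ S₁ U R R' T T' A X Y : Finset V}
  {a b p q u v v' f g h k x w : V}

/-- The vertices charged to the core vertex `v`. -/
def Charged (G : SimpleGraph V) (U : Finset V) (v b : V) : Prop :=
  b = v ∨ (∃ g, G.Mid U v b g ∧ (G.nb U g).card = 2) ∨ ∃ R T, G.Item U v R T ∧ b ∈ R

namespace Critical

/-- Let `w` lie in a pendant four-cycle `Y`. If `Y` is disjoint from `X`, then `U` is two linked
four-cycles. If they meet, the cycle `Y` passes between `w` and `X`, but `xw` is the only edge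
leaving `X`, and a cycle cannot cross a cut once. -/
theorem core_of_pendant (hC : G.Critical S₀ U) (hX : G.Pendant U X x w) : G.Core U w := by
  refine ⟨hX.memU, hC.three_le_of_pendant hX, fun Y y w' hY hwY => ?_⟩
  obtain ⟨b', c', d', hwc, hbd', hwb, hbc', hcd', hdw, hY'⟩ := hY.spans.exists_cycle hwY
  have hbY : b' ∈ Y := by simp [hY']
  have hcY : c' ∈ Y := by simp [hY']
  have hdY : d' ∈ Y := by simp [hY']
  by_cases hd : Disjoint X Y
  · have hxY := Finset.disjoint_left.1 hd hX.mem
    obtain ⟨rfl, rfl⟩ := hY.exit w hwY x (hX.sub hX.mem) hxY hX.adj.symm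
    obtain ⟨b, c, d, hxc, hbd, hxb, hbc, hcd, hdx, hX'⟩ := hX.spans.exists_cycle hX.mem
    have hU : X ∪ Y = U := by
      refine hC.conn _ (Finset.union_subset hX.sub hY.sub) ⟨x, Finset.mem_union_left _ hX.mem⟩ ?_
      intro p hp q hq hpq
      by_contra hqn
      rw [Finset.mem_union, not_or] at hqn
      rcases Finset.mem_union.1 hp with hp | hp
      · exact hqn.2 ((hX.exit p hp q hq hqn.1 hpq).2 ▸ hwY)
      · exact hqn.1 ((hY.exit p hp q hq hqn.2 hpq).2 ▸ hX.mem)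
    refine hC.not_spansEx (Or.inr ⟨linkedFourCycles, by decide, ?_⟩)
    have := Spans.of_list (G := G) (b := linkedFourCycles) [x, b, c, d, w, b', c', d'] x rfl (by
      rw [hX', hY'] at hd
      simp only [Finset.disjoint_insert_left, Finset.disjoint_singleton_left, Finset.mem_insert,
        Finset.mem_singleton, not_or] at hd
      simp [hxc, hbd, hwc, hbd', hxb.ne, hbc.ne, hcd.ne, hdx.ne.symm, hwb.ne, hbc'.ne, hcd'.ne,
        hdw.ne.symm, hd])
      (by simp [linkedFourCycles, hxb, hbc, hcd, hdx, hwb, hbc', hcd', hdw, hX.adj])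
    rwa [← hU, show X ∪ Y = [x, b, c, d, w, b', c', d'].toFinset by
      rw [hX', hY']
      ext
      simp
      tauto]
  · obtain ⟨z, hzX, hzY⟩ := Finset.not_disjoint_iff.1 hd
    have hxY : x ∈ Y := by
      by_contra hxY
      have : Y ∩ X = Y := by
        refine hY.spans.connected Finset.inter_subset_left ⟨z, by simp [hzX, hzY]⟩ ?_
        intro p hp q hq hpq
        rw [Finset.mem_inter] at hp ⊢
        refine ⟨hq, ?_⟩
        by_contra hqX
        exact hxY ((hX.exit p hp.2 q (hY.sub hq) hqX hpq).1 ▸ hp.1)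
      exact hX.notMem (Finset.mem_of_mem_inter_right (this ▸ hwY))
    have hmem : ∀ p ∈ Y, G.Adj w p → p ∈ X → p = x := fun p hp hwp hpX =>
      (hX.exit p hpX w hX.memU hX.notMem hwp.symm).1
    have hexit : ∀ q ∈ Y, G.Adj x q → q ≠ w → q ∈ X := by
      intro q hq hxq hqw
      by_contra hqX
      exact hqw (hX.exit x hX.mem q (hY.sub hq) hqX hxq).2
    have hexit' : ∀ p ∈ X, ∀ q ∈ Y, G.Adj p q → p ≠ x → q ∈ X := by
      intro p hp q hq hpq hpx
      by_contra hqX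
      exact hpx (hX.exit p hp q (hY.sub hq) hqX hpq).1
    have hxY' := hxY
    rw [hY'] at hxY'
    simp only [Finset.mem_insert, Finset.mem_singleton] at hxY'
    rcases hxY' with rfl | rfl | rfl | rfl
    · exact hX.notMem hX.mem
    · have hcX := hexit c' hcY hbc' hwc.symm
      exact hbd' (hmem d' hdY hdw.symm (hexit' c' hcX d' hdY hcd' hbc'.ne.symm)).symm
    · exact hbc'.ne (hmem b' hbY hwb (hexit b' hbY hbc'.symm hwb.ne.symm))
    · have hcX := hexit c' hcY hcd'.symm hwc.symm
      exact hbd' (hmem b' hbY hwb (hexit' c' hcX b' hbY hbc'.symm hcd'.ne))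

theorem exists_adj_item (hC : G.Critical S₀ U) (hv : G.Core U v) (hR : G.Item U v R T) :
    ∃ r ∈ R, G.Adj v r := by
  obtain ⟨a, ha, b, hb, hbR, hab⟩ := hC.exists_exit hR.sub
    (Finset.card_pos.1 (by rw [hR.card]; omega)) (fun h => hR.notMem (h ▸ hv.mem))
  rw [hR.exit a ha b hb hbR hab] at hab
  exact ⟨a, ha, hab.symm⟩

/-- A charged vertex of degree two has just one neighbour of degree at least three. Items contain no
core vertex and are left only towards their own core vertex, so two that meet coincide, and so do
their core vertices. -/
theorem eq_of_charged (hC : G.Critical S₀ U) (hv : G.Core U v) (hv' : G.Core U v')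
    (h : G.Charged U v b) (h' : G.Charged U v' b) : v = v' := by
  have hmid : ∀ {v v' g}, G.Core U v → G.Core U v' → G.Mid U v b g → (G.nb U g).card = 2 →
      G.Charged U v' b → v = v' := by
    intro v v' g hv hv' hb hg h'
    rcases h' with rfl | ⟨g', hb', hg'⟩ | ⟨R, T, hR, hbR⟩
    · have := hv'.card
      have := hb.card
      omega
    · rcases hb.eq_or hb'.left_mem hb'.adj_left with h | rfl
      · exact h.symm
      · have := hv'.card
        omega
    · by_cases hvR : v ∈ R
      · exact absurd hv (hR.not_core v hvR)
      · exact hR.exit b hbR v hv.mem hvR hb.adj_left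
  rcases h with rfl | ⟨g, hb, hg⟩ | ⟨R, T, hR, hbR⟩
  · rcases h' with h' | ⟨g', hb', hg'⟩ | ⟨R', T', hR', hbR'⟩
    · exact h'
    · exact (hmid hv' hv hb' hg' (Or.inl rfl)).symm
    · exact absurd hv (hR'.not_core _ hbR')
  · exact hmid hv hv' hb hg h'
  · rcases h' with rfl | ⟨g', hb', hg'⟩ | ⟨R', T', hR', hbR'⟩
    · exact absurd hv' (hR.not_core _ hbR)
    · exact (hmid hv' hv hb' hg' (Or.inr (Or.inr ⟨R, T, hR, hbR⟩))).symm
    · have key : ∀ {v v' R R' T T'}, G.Item U v R T → G.Item U v' R' T' → G.Core U v → b ∈ R →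
          b ∈ R' → R' ⊆ R := by
        intro v v' R R' T T' hR hR' hv hbR hbR'
        rw [← hR'.conn (R' ∩ R) Finset.inter_subset_left ⟨b, by simp [hbR, hbR']⟩]
        · exact Finset.inter_subset_right
        · intro a ha c hc hac
          rw [Finset.mem_inter] at ha ⊢
          refine ⟨hc, ?_⟩
          by_contra hcR
          exact hR'.not_core c hc (hR.exit a ha.2 c (hR'.sub hc) hcR hac ▸ hv)
      have hsub := key hR hR' hv hbR hbR'
      have hsub' := key hR' hR hv' hbR' hbR
      obtain ⟨r, hr, hvr⟩ := hC.exists_adj_item hv hR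
      exact hR'.exit r (hsub' hr) v hv.mem (fun h => hR.notMem (hsub h)) hvr.symm

/-- A core vertex, together with one vertex for its item if there is one, can be charged to three
times as many vertices. -/
theorem exists_block [Finite V] (hC : G.Critical S₀ U) (hv : G.Core U v) :
    ∃ B S : Finset V, B ⊆ U ∧ v ∈ S ∧ 3 * S.card ≤ B.card ∧ (∀ b ∈ B, G.Charged U v b) ∧
      ∀ R T, G.Item U v R T → ∀ r ∈ R, G.Dominated S r := by
  have hv3 := hv.card
  have hmid : ∀ f ∈ G.nb U v, (∃ R T, G.Item U v R T ∧ f ∈ R) ∨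
      (∃ g, G.Mid U v f g ∧ 3 ≤ (G.nb U g).card) ∨ ∃ g, G.Mid U v f g ∧ (G.nb U g).card = 2 := by
    intro f hf
    rw [mem_nb] at hf
    rcases hC.exists_mid_or hf.1 hv.mem hf.2.symm with h | ⟨g, hg⟩
    · exact Or.inl (hC.exists_item_of_adj hv hf.1 hf.2 h)
    · rcases hC.exists_mid_or hg.right_mem hf.1 hg.adj_right.symm with h | ⟨h, hh⟩
      · exact Or.inr (Or.inl ⟨g, hg, h⟩)
      · exact Or.inr (Or.inr ⟨g, hg, hh.card⟩)
  by_cases hitem : ∃ R T, G.Item U v R T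
  · obtain ⟨R, T, hR⟩ := hitem
    have heq : ∀ R' T', G.Item U v R' T' → R = R' := by
      intro R' T' hR'
      by_contra hne
      refine hC.not_item_item hv hR hR' (Finset.disjoint_left.2 fun x hx hx' => hne ?_)
      exact item_eq_of_mem hR hR' hx hx'
    -- By `Item.deg` at least two neighbours lie outside `R`, so the block has at least 1 + (3t + 1)
    -- + 2 vertices against t + 1 chosen ones.
    refine ⟨insert v (R ∪ (G.nb U v \ R)), insert v T, ?_, by simp, ?_, ?_, ?_⟩
    · refine Finset.insert_subset hv.mem (Finset.union_subset hR.sub ?_)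
      exact fun q hq => (mem_nb.1 (Finset.mem_sdiff.1 hq).1).1
    · rw [Finset.card_insert_of_notMem (s := R ∪ (G.nb U v \ R)) (by simp [hR.notMem, mem_nb]),
        Finset.card_union_of_disjoint Finset.disjoint_sdiff, hR.card]
      have h1 := hR.deg
      have h2 := Finset.card_sdiff_add_card_inter (G.nb U v) R
      have h3 := Finset.card_insert_le v T
      omega
    · intro b hb
      simp only [Finset.mem_insert, Finset.mem_union, Finset.mem_sdiff] at hb
      rcases hb with rfl | hb | ⟨hb, hbR⟩
      · exact Or.inl rfl
      · exact Or.inr (Or.inr ⟨R, T, hR, hb⟩)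
      · rcases hmid b hb with ⟨R', T', hR', hb'⟩ | ⟨g, hg, hg3⟩ | h
        · exact absurd (heq R' T' hR' ▸ hb') hbR
        · exact (hC.not_item_mid hv hR hg hg3 hbR).elim
        · exact Or.inr (Or.inl h)
    · intro R' T' hR' r hr
      exact hR.dom r (heq R' T' hR' ▸ hr)
  · obtain ⟨f₀, hf₀⟩ : ∃ f₀, ∀ f ∈ G.nb U v, f ≠ f₀ → ∃ g, G.Mid U v f g ∧ (G.nb U g).card = 2 := by
      by_cases h : ∃ f₀ ∈ G.nb U v, ∃ g, G.Mid U v f₀ g ∧ 3 ≤ (G.nb U g).card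
      · obtain ⟨f₀, -, g₀, hg₀, h3⟩ := h
        refine ⟨f₀, fun f hf hne => ?_⟩
        rcases hmid f hf with ⟨R, T, hR, -⟩ | ⟨g, hg, hg3⟩ | h
        · exact absurd ⟨R, T, hR⟩ hitem
        · exact (hC.not_mid_mid hv hg hg₀ hne hg3 h3).elim
        · exact h
      -- A dummy value: `v` is not its own neighbour, so no neighbour is excluded.
      · refine ⟨v, fun f hf _ => ?_⟩
        rcases hmid f hf with ⟨R, T, hR, -⟩ | ⟨g, hg, hg3⟩ | h'
        · exact absurd ⟨R, T, hR⟩ hitem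
        · exact absurd ⟨f, hf, g, hg, hg3⟩ h
        · exact h'
    refine ⟨insert v ((G.nb U v).erase f₀), {v}, ?_, by simp, ?_, ?_, ?_⟩
    · refine Finset.insert_subset hv.mem fun q hq => ?_
      exact (mem_nb.1 (Finset.mem_of_mem_erase hq)).1
    · rw [Finset.card_insert_of_notMem (by simp [mem_nb]), Finset.card_singleton]
      have := Finset.pred_card_le_card_erase (a := f₀) (s := G.nb U v)
      omega
    · intro b hb
      rw [Finset.mem_insert, Finset.mem_erase] at hb
      rcases hb with rfl | ⟨hne, hb⟩
      · exact Or.inl rfl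
      · exact Or.inr (Or.inl (hf₀ b hb hne))
    · exact fun R T hR => absurd ⟨R, T, hR⟩ hitem

/-- A set that contains all core vertices and dominates all items dominates everything. -/
theorem dominated_of_core [Finite V] (hC : G.Critical S₀ U) {S : Finset V}
    (hcore : ∀ v, G.Core U v → v ∈ S)
    (hitem : ∀ v R T, G.Core U v → G.Item U v R T → ∀ r ∈ R, G.Dominated S r) (hu : u ∈ U) :
    G.Dominated S u := by
  have hpend : ∀ X x w, G.Pendant U X x w → u ∈ X → G.Dominated S u := by
    intro X x w hX huX
    obtain ⟨T, hT⟩ := hC.item_of_pendant hX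
    exact hitem w X T (hC.core_of_pendant hX) hT u huX
  by_contra hun
  have hnot : ∀ X x w, G.Pendant U X x w → u ∉ X := fun X x w hX h => hun (hpend X x w hX h)
  have hcard : ¬ 3 ≤ (G.nb U u).card := fun h3 => hun (.of_mem (hcore u ⟨hu, h3, hnot⟩))
  have h2 := hC.two_le_card_nb hu
  obtain ⟨p, hp⟩ := Finset.card_pos.1 (show 0 < (G.nb U u).card by omega)
  rw [mem_nb] at hp
  obtain ⟨q, hq⟩ := exists_mid hu hp.1 hp.2 (by omega)
  -- A large neighbour of `u` would be a core vertex and dominate it; so `u` is the middle of three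
  -- consecutive vertices of degree two.
  have hmid : ∀ {p q}, G.Mid U p u q → ∃ p', G.Mid U p' p u := by
    intro p q hq
    rcases hC.exists_mid_or hq.left_mem hu hq.adj_left.symm with h3 | ⟨p', hp'⟩
    · refine absurd (.of_adj (hcore p ⟨hq.left_mem, h3, fun X x w hX hpX => ?_⟩) hq.adj_left) hun
      exact hnot X x w hX (hC.mem_pendant hX hq hpX hq.adj_left.symm)
    · exact ⟨p', hp'.symm⟩
  obtain ⟨p', hp'⟩ := hmid hq
  obtain ⟨q', hq'⟩ := hmid hq.symm
  have hq' := hq'.symm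
  by_cases hpq : p' = q'
  · subst hpq
    obtain ⟨-, w, hw⟩ := hC.exists_pendant_of_cycle hp' hq hq'
    exact hnot _ _ _ hw (by simp)
  have hadj : G.Adj p' q' := by
    by_contra hadj
    exact hC.not_path hp' hq hq' hpq hadj
  have hp'q : p' ≠ q := by
    rintro rfl
    exact hC.not_triangle hp' hq
  have hq'p : q' ≠ p := by
    rintro rfl
    exact hC.not_triangle hq hq'
  have hpX : ∀ X x w, G.Pendant U X x w → p' ∉ X := fun X x w hX h =>
    hnot X x w hX (hX.mem_of_mid hp' (hC.mem_pendant hX hp' h hp'.adj_left.symm)).2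
  have hqX : ∀ X x w, G.Pendant U X x w → q' ∉ X := fun X x w hX h =>
    hnot X x w hX (hX.mem_of_mid hq' (hC.mem_pendant hX hq' h hq'.adj_right.symm)).1
  have hp'' := hC.exists_mid_or hp'.left_mem hp'.mem hp'.adj_left.symm
  have hq'' := hC.exists_mid_or hq'.right_mem hq'.mem hq'.adj_right.symm
  have hmidp : ∀ y, G.Mid U p p' y → G.Mid U p p' q' := by
    intro y hy
    rcases hy.eq_or hq'.right_mem hadj with h | rfl
    · exact absurd h hq'p
    · exact hy
  have hmidq : ∀ y, G.Mid U q q' y → G.Mid U q q' p' := by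
    intro y hy
    rcases hy.eq_or hp'.left_mem hadj.symm with h | rfl
    · exact absurd h hp'q
    · exact hy
  -- Now `p' p u q q'` is a five-cycle. If both `p'` and `q'` are large, one lies in a pendant
  -- four-cycle; if just one is, the others form an item at it; if neither is, the cycle is all of
  -- `U`.
  rcases hp'' with hp3 | ⟨y, hy⟩
  · rcases hq'' with hq3 | ⟨z, hz⟩
    · obtain ⟨X, hX | hX⟩ := hC.exists_pendant hp'.left_mem hq'.right_mem hadj hp3 hq3
      · exact hpX X _ _ hX hX.mem
      · exact hqX X _ _ hX hX.mem
    · obtain ⟨T, hT⟩ := hC.item_of_cycle hp3 hp' hq hq' (hmidq z hz)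
      exact hun (hitem p' _ T ⟨hp'.left_mem, hp3, hpX⟩ hT u (by simp))
  · have hy := hmidp y hy
    rcases hq'' with hq3 | ⟨z, hz⟩
    · obtain ⟨T, hT⟩ := hC.item_of_cycle hq3 hq'.symm hq.symm hp'.symm hy
      exact hun (hitem q' _ T ⟨hq'.right_mem, hq3, hqX⟩ hT u (by simp))
    · have hz := hmidq z hz
      refine hC.not_spansEx (Or.inr ⟨fiveCycle, by decide, ?_⟩)
      have hs := spans_fiveCycle hp'.ne hp'q hq.ne hy.ne hq'.ne hp'.adj_left.symm hp'.adj_right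
        hq.adj_right hq'.adj_right hadj.symm
      rwa [hC.conn {p', p, u, q, q'} (by
        simp [Finset.insert_subset_iff, hp'.mem, hq.mem, hq'.mem, hp'.left_mem, hq'.right_mem])
        (by simp)] at hs
      intro r hr t ht hrt
      simp only [Finset.mem_insert, Finset.mem_singleton] at hr ⊢
      rcases hr with rfl | rfl | rfl | rfl | rfl
      · have := hy.eq_or ht hrt
        tauto
      · have := hp'.eq_or ht hrt
        tauto
      · have := hq.eq_or ht hrt
        tauto
      · have := hq'.eq_or ht hrt
        tauto
      · have := hz.eq_or ht hrt
        tauto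

theorem false [Finite V] (hC : G.Critical S₀ U) : False := by
  classical
  have hblock : ∀ v, ∃ B S : Finset V, G.Core U v → B ⊆ U ∧ v ∈ S ∧ 3 * S.card ≤ B.card ∧
      (∀ b ∈ B, G.Charged U v b) ∧ ∀ R T, G.Item U v R T → ∀ r ∈ R, G.Dominated S r := by
    intro v
    by_cases hv : G.Core U v
    · obtain ⟨B, S, h⟩ := hC.exists_block hv
      exact ⟨B, S, fun _ => h⟩
    · exact ⟨∅, ∅, fun h => absurd h hv⟩
  choose B S hBS using hblock
  set C := U.filter (G.Core U) with hCdef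
  have hmemC : ∀ v, v ∈ C ↔ G.Core U v := by
    intro v
    simp only [hCdef, Finset.mem_filter, and_iff_right_iff_imp]
    exact fun h => h.mem
  refine hC.unsolved ⟨C.biUnion S, ?_, fun u hu => ?_⟩
  · have h1 : (C.biUnion B).card = ∑ v ∈ C, (B v).card := by
      refine Finset.card_biUnion fun v hv v' hv' hne => Finset.disjoint_left.2 fun b hb hb' => ?_
      rw [Finset.mem_coe, hmemC] at hv hv'
      exact hne (hC.eq_of_charged hv hv' ((hBS v hv).2.2.2.1 b hb) ((hBS v' hv').2.2.2.1 b hb'))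
    have h2 : (C.biUnion B).card ≤ U.card :=
      Finset.card_le_card (Finset.biUnion_subset.2 fun v hv => (hBS v ((hmemC v).1 hv)).1)
    calc 3 * (C.biUnion S).card ≤ 3 * ∑ v ∈ C, (S v).card :=
          Nat.mul_le_mul_left _ Finset.card_biUnion_le
      _ = ∑ v ∈ C, 3 * (S v).card := Finset.mul_sum _ _ _
      _ ≤ ∑ v ∈ C, (B v).card :=
          Finset.sum_le_sum fun v hv => (hBS v ((hmemC v).1 hv)).2.2.1
      _ ≤ U.card := h1 ▸ h2
  · refine (hC.dominated_of_core (S := C.biUnion S) ?_ ?_ hu).mono Finset.subset_union_right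
    · intro v hv
      exact Finset.mem_biUnion.2 ⟨v, (hmemC v).2 hv, (hBS v hv).2.1⟩
    · intro v R T hv hR r hr
      exact ((hBS v hv).2.2.2.2 R T hR r hr).mono (Finset.subset_biUnion_of_mem S ((hmemC v).2 hv))

end Critical

/-- A proper nonempty closed set splits `U` into two parts that inherit `Good` and are solved
separately; so a minimal counterexample is connected, hence `Critical`. -/
theorem Good.solve [Finite V] (h : G.Good S₀ U) : G.Solve S₀ U := by
  induction hn : U.card + G.edgeSet.ncard using Nat.strong_induction_on generalizing G S₀ U with
  | _ n ih =>
    subst hn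
    by_contra hun
    by_cases hconn : ∀ A ⊆ U, A.Nonempty → G.ClosedIn U A → A = U
    · refine Critical.false (G := G) (S₀ := S₀) (U := U) ⟨h, hconn, hun, ?_⟩
      exact fun H T₀ W hlt hg => ih _ hlt hg rfl
    · push Not at hconn
      obtain ⟨A, hAU, hne, hcl, hAne⟩ := hconn
      have hcl' : G.ClosedIn U (U \ A) := by
        intro a ha b hb hab
        rw [Finset.mem_sdiff] at ha ⊢
        exact ⟨hb, fun hbA => ha.2 (hcl b hbA a ha.1 hab.symm)⟩
      have key : ∀ W ⊆ U, W.card < U.card → G.ClosedIn U W → G.Solve S₀ W := by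
        intro W hWU hcard hWcl
        refine ih _ (Nat.add_lt_add_right hcard _) ⟨h.disj.mono_right hWU, ?_, ?_⟩ rfl
        · intro v hv
          refine (h.deg v (hWU hv)).imp_right fun h2 => h2.trans (Finset.card_le_card ?_)
          intro q hq
          rw [mem_nb] at hq ⊢
          exact ⟨hWcl v hv q hq.1 hq.2, hq.2⟩
        · intro B hB hBcl hex
          refine h.ex B (hB.trans hWU) (fun a ha b hb hab => ?_) hex
          exact hBcl a ha b (hWcl a (hB ha) b hb hab) hab
      have hA := Finset.card_lt_card (Finset.ssubset_iff_subset_ne.2 ⟨hAU, hAne⟩)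
      have hsum := Finset.card_sdiff_add_card_eq_card hAU
      have hpos := hne.card_pos
      have := (key A hAU hA hcl).union (key (U \ A) Finset.sdiff_subset (by omega) hcl')
        Finset.disjoint_sdiff
      rw [Finset.union_sdiff_of_subset hAU] at this
      exact hun this

end Counting
end SimpleGraph

namespace SimpleGraph

/-! ### Return to distances and identification of the exceptional components. -/

section Recognition

variable {V : Type*} {G : SimpleGraph V}

theorem dist_eq_two_of_near2 {v u : V} (hne : v ≠ u) (hadj : ¬ G.Adj v u) (h : G.Near2 v u) :
    G.dist v u = 2 := by
  obtain ⟨a, h1, h2⟩ := h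
  have : G.edist v u = 2 := edist_eq_two_iff.2 ⟨hne, hadj, a, h1, h2.symm⟩
  simp [dist, this]

/-- Walks of length two are needed only at vertices neither in `S` nor adjacent to it, and from
there they do realise distance two. -/
theorem isDisjunctiveDominating_of_dominated {S : Finset V} (h : ∀ v, G.Dominated S v) :
    G.IsDisjunctiveDominating S := by
  intro v hv
  by_cases hadj : ∃ u ∈ S, G.Adj v u
  · exact Or.inl hadj
  · rcases h v with h | h | ⟨u, hu, w, hw, hne, h1, h2⟩
    · exact absurd h hv
    · exact absurd h hadj
    · push Not at hadj
      refine Or.inr ⟨u, hu, w, hw, hne, ?_, ?_⟩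
      · exact dist_eq_two_of_near2 (fun e => hv (e ▸ hu)) (hadj u hu) h1
      · exact dist_eq_two_of_near2 (fun e => hv (e ▸ hw)) (hadj w hw) h2

theorem nonempty_iso_of_exact {W : Type*} (c : G.ConnectedComponent) (M : SimpleGraph W)
    (ψ : W → V) (hinj : Function.Injective ψ) (hmem : ∀ w, ψ w ∈ c.supp)
    (hsurj : ∀ v ∈ c.supp, ∃ w, ψ w = v) (hadj : ∀ a b, G.Adj (ψ a) (ψ b) ↔ M.Adj a b) :
    Nonempty (c.toSimpleGraph ≃g M) := by
  let e : W ≃ c := Equiv.ofBijective (fun w => ⟨ψ w, hmem w⟩)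
    ⟨fun a b h => hinj (congrArg Subtype.val h), fun v =>
      (hsurj v.1 v.2).imp fun w hw => Subtype.ext hw⟩
  have iso : M ≃g c.toSimpleGraph := ⟨e, fun {a b} => hadj a b⟩
  exact ⟨iso.symm⟩

def houseList : ℕ × List (ℕ × ℕ) := (5, [(0, 1), (1, 2), (2, 3), (3, 4), (4, 0), (1, 4)])

def twoChordsList : ℕ × List (ℕ × ℕ) :=
  (5, [(0, 1), (1, 2), (2, 3), (3, 4), (4, 0), (1, 4), (0, 2)])

def gluedChordList : ℕ × List (ℕ × ℕ) :=
  (8, [(0, 1), (1, 2), (2, 3), (3, 0), (0, 4), (4, 5), (5, 6), (6, 7), (7, 0), (4, 7)])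

theorem cycleGraph_four_adj (i j : Fin 4) :
    (cycleGraph 4).Adj i j ↔ listAdj fourCycle.2 i j = true := by
  rw [cycleGraph_adj]
  revert i j
  decide

theorem cycleGraph_five_adj (i j : Fin 5) :
    (cycleGraph 5).Adj i j ↔ listAdj fiveCycle.2 i j = true := by
  rw [cycleGraph_adj]
  revert i j
  decide

theorem exceptionalG1_adj (i j : Fin 5) :
    exceptionalG1.Adj i j ↔ listAdj houseList.2 i j = true := by
  simp only [exceptionalG1, fromEdgeSet_adj, Set.mem_insert_iff, Set.mem_singleton_iff, Sym2.eq_iff]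
  revert i j
  decide +kernel

theorem exceptionalG2_adj (i j : Fin 5) :
    exceptionalG2.Adj i j ↔ listAdj twoChordsList.2 i j = true := by
  simp only [exceptionalG2, fromEdgeSet_adj, Set.mem_insert_iff, Set.mem_singleton_iff, Sym2.eq_iff]
  revert i j
  decide +kernel

theorem exceptionalG4_adj (i j : Fin 8) :
    exceptionalG4.Adj i j ↔ listAdj linkedFourCycles.2 i j = true := by
  simp only [exceptionalG4, fromEdgeSet_adj, Set.mem_insert_iff, Set.mem_singleton_iff, Sym2.eq_iff]
  revert i j
  decide +kernel

theorem exceptionalG5_adj (i j : Fin 8) :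
    exceptionalG5.Adj i j ↔ listAdj gluedCycles.2 i j = true := by
  simp only [exceptionalG5, fromEdgeSet_adj, Set.mem_insert_iff, Set.mem_singleton_iff, Sym2.eq_iff]
  revert i j
  decide +kernel

theorem exceptionalG6_adj (i j : Fin 8) :
    exceptionalG6.Adj i j ↔ listAdj gluedChordList.2 i j = true := by
  simp only [exceptionalG6, fromEdgeSet_adj, Set.mem_insert_iff, Set.mem_singleton_iff, Sym2.eq_iff]
  revert i j
  decide +kernel

def exceptionalLists : List (ℕ × List (ℕ × ℕ)) :=
  [fourCycle, fiveCycle, houseList, twoChordsList, bipartite23, linkedFourCycles, gluedCycles,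
    gluedChordList]

theorem isExceptional_of_exact (c : G.ConnectedComponent) {t : ℕ × List (ℕ × ℕ)}
    (ht : t ∈ exceptionalLists) {φ : ℕ → V} (hφ : ∀ i < t.1, ∀ j < t.1, φ i = φ j → i = j)
    (hmem : ∀ i < t.1, φ i ∈ c.supp) (hsurj : ∀ v ∈ c.supp, ∃ i < t.1, φ i = v)
    (hadj : ∀ i < t.1, ∀ j < t.1, G.Adj (φ i) (φ j) ↔ listAdj t.2 i j = true) :
    c.toSimpleGraph.IsExceptional := by
  have key : ∀ M : SimpleGraph (Fin t.1), (∀ i j, M.Adj i j ↔ listAdj t.2 i j = true) →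
      Nonempty (c.toSimpleGraph ≃g M) := by
    intro M hM
    refine nonempty_iso_of_exact c M (fun i => φ i) ?_ (fun i => hmem i i.2) ?_ ?_
    · exact fun i j hij => Fin.ext (hφ i i.2 j j.2 hij)
    · intro v hv
      obtain ⟨i, hi, h⟩ := hsurj v hv
      exact ⟨⟨i, hi⟩, h⟩
    · exact fun i j => (hadj i i.2 j j.2).trans (hM i j).symm
  simp only [exceptionalLists, List.mem_cons, List.not_mem_nil, or_false] at ht
  unfold IsExceptional
  rcases ht with rfl | rfl | rfl | rfl | rfl | rfl | rfl | rfl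
  · exact Or.inl (key _ cycleGraph_four_adj)
  · exact Or.inr (Or.inl (key _ cycleGraph_five_adj))
  · exact Or.inr (Or.inr (Or.inl (key _ exceptionalG1_adj)))
  · exact Or.inr (Or.inr (Or.inr (Or.inl (key _ exceptionalG2_adj))))
  · refine Or.inr (Or.inr (Or.inr (Or.inr (Or.inl ?_))))
    -- The vertices of K₂,₃ form a sum type; its two sides receive the labels 0, 1 and 2, 3, 4 of
    -- `bipartite23`.
    let ι : Fin 2 ⊕ Fin 3 → ℕ := Sum.elim (fun i => i) (fun i => i + 2)
    have hι : ∀ a, ι a < 5 := by decide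
    refine nonempty_iso_of_exact c _ (fun a => φ (ι a)) ?_ (fun a => hmem _ (hι a)) ?_ ?_
    · intro a b hab
      exact (by decide : ∀ a b, ι a = ι b → a = b) a b (hφ _ (hι a) _ (hι b) hab)
    · intro v hv
      obtain ⟨i, hi, rfl⟩ := hsurj v hv
      obtain ⟨a, rfl⟩ : ∃ a, ι a = i := (by decide : ∀ i < 5, ∃ a, ι a = i) i hi
      exact ⟨a, rfl⟩
    · intro a b
      refine (hadj _ (hι a) _ (hι b)).trans ?_
      unfold exceptionalG3
      rw [completeBipartiteGraph_adj]
      revert a b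
      decide
  · exact Or.inr (Or.inr (Or.inr (Or.inr (Or.inr (Or.inl (key _ exceptionalG4_adj))))))
  · exact Or.inr (Or.inr (Or.inr (Or.inr (Or.inr (Or.inr (Or.inl (key _ exceptionalG5_adj)))))))
  · exact Or.inr (Or.inr (Or.inr (Or.inr (Or.inr (Or.inr (Or.inr (key _ exceptionalG6_adj)))))))

/-- For each minimal exceptional graph: the additional edges that may leave it unsolvable, and
relabellings onto exceptional graphs. -/
def relabelTable : List ((ℕ × List (ℕ × ℕ)) × List (ℕ × ℕ) ×
    List ((ℕ × List (ℕ × ℕ)) × List ℕ)) :=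
  [(fourCycle, [(0, 2), (1, 3)], [(fourCycle, [0, 1, 2, 3])]),
   (fiveCycle, [(0, 2), (0, 3), (1, 3), (1, 4), (2, 4)],
    [(fiveCycle, [0, 1, 2, 3, 4]), (houseList, [1, 0, 4, 3, 2]), (houseList, [4, 0, 1, 2, 3]),
     (houseList, [2, 1, 0, 4, 3]), (houseList, [0, 1, 2, 3, 4]), (houseList, [3, 2, 1, 0, 4]),
     (twoChordsList, [1, 2, 0, 4, 3]), (twoChordsList, [0, 1, 2, 3, 4]),
     (twoChordsList, [0, 4, 1, 2, 3]), (twoChordsList, [3, 4, 0, 1, 2]),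
     (twoChordsList, [2, 3, 1, 0, 4])]),
   (bipartite23, [(0, 1), (2, 3), (2, 4), (3, 4)],
    [(bipartite23, [0, 1, 2, 3, 4]), (twoChordsList, [2, 3, 0, 4, 1]),
     (twoChordsList, [2, 4, 0, 3, 1]), (twoChordsList, [3, 4, 0, 2, 1])]),
   (linkedFourCycles, [(0, 5), (0, 7), (1, 4), (3, 4)],
    [(linkedFourCycles, [0, 1, 2, 3, 4, 5, 6, 7]), (gluedChordList, [0, 1, 2, 3, 4, 7, 6, 5]),
     (gluedChordList, [0, 1, 2, 3, 4, 5, 6, 7]), (gluedChordList, [4, 5, 6, 7, 0, 3, 2, 1]),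
     (gluedChordList, [4, 5, 6, 7, 0, 1, 2, 3])]),
   (gluedCycles, [(4, 7)],
    [(gluedCycles, [0, 1, 2, 3, 4, 5, 6, 7]), (gluedChordList, [0, 1, 2, 3, 4, 5, 6, 7])])]

theorem relabelTable_mem : ∀ b ∈ fourCycle :: residueTwo, ∃ r ∈ relabelTable, r.1 = b := by
  decide

/-- Any extra edge missing from the table makes the graph solvable on its own, so only subsets of
the tabulated edges remain to be examined. -/
theorem relabelTable_edge : ∀ r ∈ relabelTable, ∀ i < r.1.1, ∀ j < r.1.1,
    i = j ∨ listAdj (r.1.2 ++ r.2.1) i j = true ∨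
      ∃ S ∈ smallSets r.1.1, ∀ k < r.1.1, listDominated ((i, j) :: r.1.2) S k = true := by
  decide +kernel

theorem relabelTable_target : ∀ r ∈ relabelTable, ∀ t ∈ r.2.2,
    t.1 ∈ exceptionalLists ∧ t.1.1 = r.1.1 ∧ t.2.length = r.1.1 ∧ t.2.Nodup ∧
      ∀ i < r.1.1, t.2.getD i 0 < r.1.1 := by
  decide +kernel

theorem relabelTable_check : ∀ r ∈ relabelTable, ∀ c ∈ r.2.1.sublists,
    (∃ S ∈ smallSets r.1.1, ∀ k < r.1.1, listDominated (r.1.2 ++ c) S k = true) ∨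
      ∃ t ∈ r.2.2, ∀ i < r.1.1, ∀ j < r.1.1,
        listAdj (r.1.2 ++ c) (t.2.getD i 0) (t.2.getD j 0) = listAdj t.1.2 i j := by
  decide +kernel

/-- Every vertex is within three steps of vertex 0, which places a copy in a single component. -/
theorem diameter_check : ∀ b ∈ fourCycle :: residueTwo, 0 < b.1 ∧ ∀ i < b.1,
    i = 0 ∨ listAdj b.2 i 0 = true ∨
      ∃ j < b.1, listNear b.2 i j = true ∧ (j = 0 ∨ listAdj b.2 j 0 = true) := by
  decide +kernel

variable [DecidableEq V]

theorem solve_of_check {b : ℕ × List (ℕ × ℕ)} (hb : b ∈ fourCycle :: residueTwo) {φ : ℕ → V}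
    (hφ : ∀ i < b.1, ∀ j < b.1, φ i = φ j → i = j) {L : List (ℕ × ℕ)} (hL : G.ListHom L φ)
    (h : ∃ S ∈ smallSets b.1, ∀ k < b.1, listDominated L S k = true) :
    G.Solve ∅ ((Finset.range b.1).image φ) := by
  obtain ⟨S, hS, hdom⟩ := h
  obtain ⟨h1, h2⟩ := smallSets_card b hb S hS
  refine ⟨(S.map φ).toFinset, ?_, ?_⟩
  · have := card_map_le S φ
    rw [Finset.card_image_of_injOn, Finset.card_range]
    · omega
    · intro i hi j hj
      simp only [Finset.coe_range, Set.mem_Iio] at hi hj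
      exact hφ i hi j hj
  · intro v hv
    obtain ⟨k, hk, rfl⟩ := Finset.mem_image.1 hv
    refine hL.dominated (fun i hi => ?_) (fun i hi j hj => hφ i (h2 i hi) j (h2 j hj))
      (hdom k (Finset.mem_range.1 hk))
    exact Finset.mem_union_right _ (List.mem_toFinset.2 (List.mem_map_of_mem hi))

theorem ListHom.append {L L' : List (ℕ × ℕ)} {φ : ℕ → V} (h : G.ListHom L φ)
    (h' : G.ListHom L' φ) : G.ListHom (L ++ L') φ := by
  intro e he
  rcases List.mem_append.1 he with he | he
  exacts [h e he, h' e he]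

/-- Being closed and connected, `A` is a component. Its edges are those of the spanning pattern and
some tabulated extra ones, and every unsolvable combination is matched with a member of the family
by a relabelling. -/
theorem isExceptional_of_spans [Fintype V] {A : Finset V} (hA : G.SpansEx A)
    (hcl : G.ClosedIn Finset.univ A) (hun : ¬ G.Solve ∅ A) :
    ∃ c : G.ConnectedComponent, c.toSimpleGraph.IsExceptional := by
  classical
  obtain ⟨b, hb, φ, hφ, rfl, hL⟩ := hA.exists_spans
  obtain ⟨r, hr, rfl⟩ := relabelTable_mem b hb
  obtain ⟨hpos, hdiam⟩ := diameter_check r.1 hb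
  refine ⟨G.connectedComponentMk (φ 0), ?_⟩
  have hsupp : ∀ v, v ∈ (G.connectedComponentMk (φ 0)).supp ↔ ∃ i < r.1.1, φ i = v := by
    intro v
    rw [ConnectedComponent.mem_supp_iff, ConnectedComponent.eq]
    constructor
    · rintro ⟨p⟩
      have hp : ∀ {x y : V} (p : G.Walk x y), y ∈ (Finset.range r.1.1).image φ →
          x ∈ (Finset.range r.1.1).image φ := by
        intro x y p
        induction p with
        | nil => exact id
        | cons h _ ih => exact fun hy => hcl _ (ih hy) _ (Finset.mem_univ _) h.symm
      have := hp p (Finset.mem_image_of_mem φ (Finset.mem_range.2 hpos))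
      simpa using this
    · rintro ⟨i, hi, rfl⟩
      have hnear : ∀ {x y}, G.Near2 x y → G.Reachable x y := fun ⟨a, h1, h2⟩ =>
        h1.reachable.trans h2.reachable
      rcases hdiam i hi with rfl | h | ⟨j, hj, h1, rfl | h2⟩
      · exact .rfl
      · exact (hL.adj h).reachable
      · exact hnear (hL.near h1)
      · exact (hnear (hL.near h1)).trans (hL.adj h2).reachable
  -- The tabulated extra edges that are present in `G`; with the pattern they give the induced graph
  -- exactly.
  set c := r.2.1.filter fun e => decide (G.Adj (φ e.1) (φ e.2)) with hc
  have hLc : G.ListHom (r.1.2 ++ c) φ := by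
    refine hL.append fun e he => ?_
    rw [hc, List.mem_filter] at he
    exact of_decide_eq_true he.2
  have hexact : ∀ i < r.1.1, ∀ j < r.1.1, G.Adj (φ i) (φ j) ↔ listAdj (r.1.2 ++ c) i j = true := by
    intro i hi j hj
    refine ⟨fun h => ?_, hLc.adj⟩
    rcases relabelTable_edge r hr i hi j hj with rfl | h' | h'
    · exact absurd h (G.loopless.irrefl _)
    · simp only [listAdj, Bool.or_eq_true, List.contains_iff_mem, List.mem_append, hc,
        List.mem_filter, decide_eq_true_eq] at h' ⊢
      have := h.symm
      tauto
    · exact absurd (solve_of_check hb hφ (hL.cons h) h') hun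
  obtain ⟨t, ht, hcheck⟩ := (relabelTable_check r hr c
    (List.mem_sublists.2 List.filter_sublist)).resolve_left
      fun h => hun (solve_of_check hb hφ hLc h)
  obtain ⟨ht1, ht2, ht3, ht4, ht5⟩ := relabelTable_target r hr t ht
  have hinj : ∀ i < r.1.1, ∀ j < r.1.1, t.2.getD i 0 = t.2.getD j 0 → i = j := by
    intro i hi j hj hij
    rw [← ht3] at hi hj
    rw [List.getD_eq_getElem _ _ hi, List.getD_eq_getElem _ _ hj] at hij
    exact ht4.getElem_inj_iff.1 hij
  refine isExceptional_of_exact _ ht1 (φ := fun i => φ (t.2.getD i 0)) ?_ ?_ ?_ ?_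
  · rw [ht2]
    exact fun i hi j hj hij => hinj i hi j hj (hφ _ (ht5 i hi) _ (ht5 j hj) hij)
  · rw [ht2]
    exact fun i hi => (hsupp _).2 ⟨_, ht5 i hi, rfl⟩
  · rw [ht2]
    intro v hv
    obtain ⟨k, hk, rfl⟩ := (hsupp v).1 hv
    have himg : (Finset.range r.1.1).image (fun i => t.2.getD i 0) = Finset.range r.1.1 := by
      refine Finset.eq_of_subset_of_card_le ?_ ?_
      · intro x hx
        obtain ⟨i, hi, rfl⟩ := Finset.mem_image.1 hx
        exact Finset.mem_range.2 (ht5 i (Finset.mem_range.1 hi))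
      · rw [Finset.card_image_of_injOn]
        intro i hi j hj
        simp only [Finset.coe_range, Set.mem_Iio] at hi hj
        exact hinj i hi j hj
    have : k ∈ (Finset.range r.1.1).image (fun i => t.2.getD i 0) := by
      rw [himg]
      exact Finset.mem_range.2 hk
    obtain ⟨i, hi, rfl⟩ := Finset.mem_image.1 this
    exact ⟨i, Finset.mem_range.1 hi, rfl⟩
  · rw [ht2]
    intro i hi j hj
    rw [hexact _ (ht5 i hi) _ (ht5 j hj), hcheck i hi j hj]

end Recognition

end SimpleGraph

theorem theorem2p6 {V : Type*} [Fintype V] (G : SimpleGraph V) [DecidableRel G.Adj]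
    (hcard : 3 ≤ Fintype.card V)
    (hdeg : 2 ≤ G.minDegree)
    (hcomp : ∀ c : G.ConnectedComponent, ¬ c.toSimpleGraph.IsExceptional) :
    (G.disjunctiveDominationNumber : ℝ) ≤ (Fintype.card V : ℝ) / 3 := by
  classical
  -- With no sources and all vertices in `U`, `Good` says that the minimum degree is at least two
  -- and that every closed exceptional piece is solvable.
  have hgood : G.Good ∅ Finset.univ := by
    refine ⟨Finset.disjoint_empty_left _, fun v _ => Or.inr ?_, fun A _ hcl hex => ?_⟩
    · have h : G.nb Finset.univ v = G.neighborFinset v := by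
        ext u
        simp [SimpleGraph.mem_nb]
      rw [h, G.card_neighborFinset_eq_degree]
      exact hdeg.trans (G.minDegree_le_degree v)
    · by_contra hun
      obtain ⟨c, hc⟩ := SimpleGraph.isExceptional_of_spans hex hcl hun
      exact hcomp c hc
  obtain ⟨S, hS, hdom⟩ := hgood.solve
  have hle : G.disjunctiveDominationNumber ≤ S.card := by
    refine Nat.sInf_le ⟨S, ?_, rfl⟩
    refine SimpleGraph.isDisjunctiveDominating_of_dominated fun v => ?_
    simpa using hdom v (Finset.mem_univ v)
  rw [Finset.card_univ] at hS
  rw [le_div_iff₀ (by norm_num)]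
  exact_mod_cast (by omega : G.disjunctiveDominationNumber * 3 ≤ Fintype.card V)
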